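/- Let $\Gamma$ be the free group on a finite set $S$, and let $e$ be its identity. Call a finite set $F\subset\Gamma$ grounded if it contains $e$ and is connected in the left Cayley graph of $\Gamma$, whose edges are the pairs $\{g,sg\}$ with $g\in\Gamma$ and $s\in S\cup S^{-1}$. For a positive integer $k$, let $\mathcal{S}^{\mathrm u}_k(F)$ be the set of all positive semidefinite $F$-by-$F$ block matrices $q=[q(g,h)]_{g,h\in F}$ with blocks $q(g,h)\in \mathrm{M}_k(\mathbf{C})$ such that $q(g,g)=I_k$ for all $g\in F$, and $q(g_1,h_1)=q(g_2,h_2)$ whenever $g_1,h_1,g_2,h_2\in F$ and $g_1^{-1}h_1=g_2^{-1}h_2$. For $E\subset F$ let $q[E]$ be the submatrix of $q$ with block rows and block columns indexed by $E$. For $q\in\mathcal{S}^{\mathrm u}_k(F)$ define $$h_F(q)=\log\det q-\sum_{s\in S}\log\det q[F\cap sF]\quad\text{if } q \text{ is nonsingular},\qquad h_F(q)=-\infty\quad\text{if } q\text{ is singular}.$$ For each $n\ge 1$, let $(\pi_n(s))_{s\in S}$ be independent random unitary $n$-by-$n$ matrices, each with the Haar distribution on $\mathrm{U}(n)$, and extend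 them to a random unitary representation $\pi_n$ of $\Gamma$ on $\mathbf{C}^n$. For each $n\ge k$, fix an $n$-by-$k$ matrix $V=V_n$ with orthonormal columns, and let $$Q^{\pi_n}[F]=[V^*\pi_n(g^{-1}h)V]_{g,h\in F}\in\mathcal{S}^{\mathrm u}_k(F).$$ **Theorem B.** Let $F$ be a grounded subset of $\Gamma$ and let $q\in\mathcal{S}^{\mathrm u}_k(F)$. (a) For all sufficiently large $n$, the matrix $Q^{\pi_n}[F]$ is almost surely nonsingular. (b) For every neighbourhood $O$ of $q$ in $\mathcal{S}^{\mathrm u}_k(F)$, $$\log\mathbf{P}\big(Q^{\pi_n}[F]\in O\big)\ge h_F(q)\cdot n-o(n)\qquad\text{as } n\to\infty.$$ (c) For every real number $a>h_F(q)$ there is a neighbourhood $O$ of $q$ in $\mathcal{S}^{\mathrm u}_k(F)$ such that $$\log\mathbf{P}\big(Q^{\pi_n}[F]\in O\big)\le a n+o(n)\qquad\text{as } n\to\infty.$$ Here $\log 0=-\infty$. -/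

import Mathlib

open Filter Topology MeasureTheory Asymptotics
open scoped Matrix ComplexOrder Pointwise

noncomputable section

namespace FreeGram

variable {S : Type*}

/-- The left Cayley graph of the free group on `S`: the edges are the pairs `{g, s g}` for a
generator `s` or its inverse. -/
def leftCayleyGraph (S : Type*) : SimpleGraph (FreeGroup S) :=
  SimpleGraph.fromRel (fun g h => ∃ s : S, h = FreeGroup.of s * g)

/-- A finite subset of the free group is grounded if it contains the identity and is connected in
the left Cayley graph. -/
def IsGrounded (F : Finset (FreeGroup S)) : Prop :=
  (1 : FreeGroup S) ∈ F ∧ ((leftCayleyGraph S).induce (F : Set (FreeGroup S))).Connected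

/-- `F`-by-`F` block matrices with `k`-by-`k` complex blocks; the entry at `((g, i), (h, j))` is
the `(i, j)` entry of the block in position `(g, h)`. -/
abbrev BlockMatrix (F : Finset (FreeGroup S)) (k : ℕ) : Type _ :=
  Matrix (F × Fin k) (F × Fin k) ℂ

/-- The `k`-by-`k` block of a block matrix in position `(g, h)`. -/
def block {F : Finset (FreeGroup S)} {k : ℕ} (q : BlockMatrix F k) (g h : F) :
    Matrix (Fin k) (Fin k) ℂ :=
  Matrix.of fun i j => q (g, i) (h, j)

/-- The submatrix of a block matrix given by the block rows and block columns in `E ⊆ F`. -/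
def blockSubmatrix {E F : Finset (FreeGroup S)} {k : ℕ} (hE : E ⊆ F) (q : BlockMatrix F k) :
    BlockMatrix E k :=
  q.submatrix (fun p => (⟨p.1.1, hE p.1.2⟩, p.2)) (fun p => (⟨p.1.1, hE p.1.2⟩, p.2))

/-- The partial positive definite functions over `F`: the positive semidefinite block matrices
with identity diagonal blocks whose `(g, h)` block depends only on `g⁻¹ * h`. -/
def partialPD (F : Finset (FreeGroup S)) (k : ℕ) : Set (BlockMatrix F k) :=
  {q | q.PosSemidef ∧ (∀ g : F, block q g g = 1) ∧
    ∀ g₁ h₁ g₂ h₂ : F, (g₁ : FreeGroup S)⁻¹ * h₁ = (g₂ : FreeGroup S)⁻¹ * h₂ →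
      block q g₁ h₁ = block q g₂ h₂}

/-- The logarithm of the determinant of a positive definite matrix (whose determinant is a
positive real number). -/
def logDet {ι : Type*} [Fintype ι] [DecidableEq ι] (q : Matrix ι ι ℂ) : ℝ :=
  Real.log q.det.re

/-- The negative of the rate function: `log det q - ∑ s, log det q[F ∩ sF]` if `q` is nonsingular,
and `-∞` if `q` is singular. -/
def hFun [Fintype S] [DecidableEq S] {F : Finset (FreeGroup S)} {k : ℕ} (q : BlockMatrix F k) :
    EReal :=
  if q.det ≠ 0 then
    ((logDet q - ∑ s : S, logDet (blockSubmatrix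
      (Finset.inter_subset_left : F ∩ (FreeGroup.of s • F) ⊆ F) q) : ℝ) : EReal)
  else ⊥

/-- The Borel sigma-algebra of the unitary group `U(n)`. -/
instance unitaryMeasurableSpace (n : ℕ) : MeasurableSpace (Matrix.unitaryGroup (Fin n) ℂ) :=
  borel _

instance unitaryBorelSpace (n : ℕ) : BorelSpace (Matrix.unitaryGroup (Fin n) ℂ) := ⟨rfl⟩

instance unitaryCompactSpace (n : ℕ) : CompactSpace (Matrix.unitaryGroup (Fin n) ℂ) := by
  have hK : IsCompact (Set.pi Set.univ fun _ : Fin n => Set.pi Set.univ fun _ : Fin n =>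
      Metric.closedBall (0 : ℂ) 1) :=
    isCompact_univ_pi fun _ => isCompact_univ_pi fun _ => isCompact_closedBall 0 1
  refine isCompact_iff_compactSpace.mp
    (hK.of_isClosed_subset (isClosed_unitary (R := Matrix (Fin n) (Fin n) ℂ)) ?_)
  intro U hU i _ j _
  simpa using entry_norm_bound_of_unitary hU i j

/-- The Haar probability measure of the unitary group `U(n)`. -/
def unitaryHaar (n : ℕ) : Measure (Matrix.unitaryGroup (Fin n) ℂ) :=
  Measure.haarMeasure ⊤

/-- The law of a family, indexed by `S`, of independent random elements of `U(n)` that all have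
the Haar distribution. -/
def generatorLaw (S : Type*) [Fintype S] (n : ℕ) :
    Measure (S → Matrix.unitaryGroup (Fin n) ℂ) :=
  Measure.pi fun _ => unitaryHaar n

/-- The unitary representation of the free group that sends each generator `s` to `u s`. -/
def freeRep {n : ℕ} (u : S → Matrix.unitaryGroup (Fin n) ℂ) :
    FreeGroup S →* Matrix.unitaryGroup (Fin n) ℂ :=
  FreeGroup.lift u

/-- The map `g ↦ V* π(g) V`, where `π` is the representation with generators `u`. -/
def compress {n k : ℕ} (V : Matrix (Fin n) (Fin k) ℂ)
    (u : S → Matrix.unitaryGroup (Fin n) ℂ) (g : FreeGroup S) : Matrix (Fin k) (Fin k) ℂ :=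
  Vᴴ * (freeRep u g : Matrix (Fin n) (Fin n) ℂ) * V

/-- The Gram matrix `[V* π(g⁻¹ h) V]`, where `g, h ∈ F`. -/
def gramMatrix {n k : ℕ} (V : Matrix (Fin n) (Fin k) ℂ) (F : Finset (FreeGroup S))
    (u : S → Matrix.unitaryGroup (Fin n) ℂ) : BlockMatrix F k :=
  Matrix.of fun p r => compress V u ((p.1 : FreeGroup S)⁻¹ * r.1) p.2 r.2

end FreeGram

end

open FreeGram

namespace FreeGram

noncomputable section

open scoped InnerProductSpace MatrixOrder

/-! The probability is found by double counting against Lebesgue measure. The orbit vectors `π(g) V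
eᵢ`, for `g ∈ F`, are compared with arbitrary families `X` of vectors of `ℂⁿ` indexed by `F × Fin
k`: measure the pairs `(u, X)` in which `X` has Gram matrix near `q` and lies within small
prescribed radii of the orbit of `u`. For fixed `u` these `X` fill, or are contained in, a product
of balls whose volume does not depend on `u`. For fixed `X`, since a grounded set is a subtree
rooted at the identity, closeness to the orbit means essentially that the base of `X` is close to
the columns of `V` and that each `u s` carries the tails of the `s`-edges close to their heads. The
generators are independent, so the latter event has probability a product over `s`
(`volume_mul_law_le`, `le_volume_mul_law`).

Each factor is a `hit` probability: a Haar unitary carries `Y` to within `ε` of `Z`, both with Gram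
matrix near `M`, with probability about `((∏ ε j ^ 2) / det M) ^ n`. This is a second double
counting (`eventually_hit_le`, `eventually_le_hit`); it uses that families with nearly equal
nonsingular Gram matrices are nearly unitarily equivalent, and that in high dimension a random
perturbation is nearly orthogonal to given vectors. The families with Gram matrix near `q` have
volume about `(det q) ^ n` times a power of the volume of the unit ball. Every nontrivial element of
`F` is the far end of exactly one edge (`prod_edges`), so all radii cancel and `(det q / ∏ det q[F ∩
sF]) ^ n` remains.

The radius at `g` is `c * τ⁻¹ ^ |g|`. At each edge the near end is then negligible, and closeness
along edges is equivalent to closeness to the orbit up to factors `1 + O(τ)` in the radii. These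
cost a factor exponential in `n` whose rate tends to zero with `τ`.

For singular `q` the upper bound is applied on a smaller set `E` where `q[E]` is singular but its
edge restrictions are not (`exists_minimal_singular`); it then holds at every exponential rate.
Almost sure nonsingularity is a zero-one law: along one-parameter groups the Gram determinant is
real analytic, and the lower bound at the identity matrix supplies one nonsingular sample. -/

/-- The Hermitian space `ℂⁿ`. -/
abbrev Vec (n : ℕ) : Type := EuclideanSpace ℂ (Fin n)

/-- The volume of the unit ball of `ℂⁿ`. -/
def ballVol (n : ℕ) : ENNReal := volume (Metric.closedBall (0 : Vec n) 1)

/-! ### Haar measure and the unitary action on vectors -/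

instance matrixSecondCountable (m n : ℕ) : SecondCountableTopology (Matrix (Fin m) (Fin n) ℂ) :=
  inferInstanceAs (SecondCountableTopology (Fin m → Fin n → ℂ))

instance unitarySecondCountable (n : ℕ) :
    SecondCountableTopology (Matrix.unitaryGroup (Fin n) ℂ) :=
  TopologicalSpace.Subtype.secondCountableTopology _

instance unitaryHaar_isHaar (n : ℕ) : (unitaryHaar n).IsHaarMeasure :=
  Measure.isHaarMeasure_haarMeasure _

instance unitaryHaar_isProb (n : ℕ) : IsProbabilityMeasure (unitaryHaar n) :=
  ⟨by
    have := Measure.haarMeasure_self (K₀ := (⊤ : TopologicalSpace.PositiveCompacts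
      (Matrix.unitaryGroup (Fin n) ℂ)))
    simpa [unitaryHaar] using this⟩

instance generatorLaw_isProb (S : Type*) [Fintype S] (n : ℕ) :
    IsProbabilityMeasure (generatorLaw S n) :=
  inferInstanceAs (IsProbabilityMeasure (Measure.pi _))

instance familyVolume_isAddHaar {ι : Type*} [Fintype ι] (n : ℕ) :
    (volume : Measure (ι → Vec n)).IsAddHaarMeasure :=
  Measure.pi.isAddHaarMeasure fun _ : ι => (volume : Measure (Vec n))

/-- The action of `U(n)` on `ℂⁿ`. -/
def uact {n : ℕ} (U : Matrix.unitaryGroup (Fin n) ℂ) : Vec n ≃ₗᵢ[ℂ] Vec n :=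
  Unitary.linearIsometryEquiv ⟨Matrix.toEuclideanCLM (𝕜 := ℂ) (U : Matrix (Fin n) (Fin n) ℂ),
    Unitary.map_mem (Matrix.toEuclideanCLM (n := Fin n) (𝕜 := ℂ)) U.2⟩

lemma uact_apply {n : ℕ} (U : Matrix.unitaryGroup (Fin n) ℂ) (x : Vec n) :
    uact U x = WithLp.toLp 2 ((U : Matrix (Fin n) (Fin n) ℂ) *ᵥ x.ofLp) := rfl

lemma uact_mul {n : ℕ} (U W : Matrix.unitaryGroup (Fin n) ℂ) (x : Vec n) :
    uact (U * W) x = uact U (uact W x) := by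
  simp [uact_apply, Matrix.mulVec_mulVec]

lemma uact_one {n : ℕ} (x : Vec n) : uact (1 : Matrix.unitaryGroup (Fin n) ℂ) x = x := by
  simp [uact_apply]

lemma uact_apply_inv {n : ℕ} (U : Matrix.unitaryGroup (Fin n) ℂ) (x : Vec n) :
    uact U (uact U⁻¹ x) = x := by
  rw [← uact_mul, mul_inv_cancel, uact_one]

lemma uact_surjective {n : ℕ} (T : Vec n ≃ₗᵢ[ℂ] Vec n) : ∃ U, uact U = T := by
  set T' := Unitary.linearIsometryEquiv.symm T with hT'
  refine ⟨⟨(Matrix.toEuclideanCLM (n := Fin n) (𝕜 := ℂ)).symm T'.1,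
    Unitary.map_mem (Matrix.toEuclideanCLM (n := Fin n) (𝕜 := ℂ)).symm T'.2⟩, ?_⟩
  rw [← MulEquiv.apply_symm_apply Unitary.linearIsometryEquiv T, ← hT', uact]
  congr 1
  exact Subtype.ext (by simp)

lemma continuous_uact {n : ℕ} :
    Continuous fun p : Matrix.unitaryGroup (Fin n) ℂ × Vec n => uact p.1 p.2 := by
  simp only [uact_apply]
  fun_prop

lemma inner_uact {n : ℕ} (U : Matrix.unitaryGroup (Fin n) ℂ) (x y : Vec n) :
    ⟪uact U x, uact U y⟫_ℂ = ⟪x, y⟫_ℂ := (uact U).inner_map_map x y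

lemma norm_uact {n : ℕ} (U : Matrix.unitaryGroup (Fin n) ℂ) (x : Vec n) :
    ‖uact U x‖ = ‖x‖ := (uact U).norm_map x

lemma measurePreserving_isometry {n : ℕ} (T : Vec n ≃ₗᵢ[ℂ] Vec n) :
    MeasurePreserving T volume volume := by
  refine ⟨T.continuous.measurable, ?_⟩
  let T' : Vec n ≃ₗᵢ[ℝ] Vec n :=
    { (T.toLinearEquiv.restrictScalars ℝ) with norm_map' := T.norm_map }
  exact T'.measurePreserving.map_eq

/-! ### Double counting, volumes of products of balls, and linear changes of families -/

/-- If a product-measurable relation has large sections over `A`, small sections in the other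
direction, and vanishes off `B`, then `A` is small compared to `B`. -/
lemma double_counting {α β : Type*} [MeasurableSpace α] [MeasurableSpace β] {μ : Measure α}
    {ν : Measure β} [SFinite μ] [SFinite ν] {R : Set (α × β)} (hR : MeasurableSet R)
    {A : Set α} {B : Set β} {x y : ENNReal}
    (hA : ∀ a ∈ A, x ≤ ν {b | (a, b) ∈ R}) (hB : ∀ b ∈ B, μ {a | (a, b) ∈ R} ≤ y)
    (hBc : ∀ a b, (a, b) ∈ R → b ∈ B) :
    x * μ A ≤ y * ν B := by
  have h1 : x * μ A ≤ μ.prod ν R := by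
    rw [Measure.prod_apply hR]
    calc x * μ A ≤ x * μ {a | x ≤ ν (Prod.mk a ⁻¹' R)} := by
          gcongr; exact fun a ha => hA a ha
      _ ≤ _ := mul_meas_ge_le_lintegral (measurable_measure_prodMk_left hR) x
  have h2 : μ.prod ν R ≤ y * ν B := by
    rw [Measure.prod_apply_symm hR]
    calc ∫⁻ b, μ ((fun a => (a, b)) ⁻¹' R) ∂ν
        ≤ ∫⁻ b, (toMeasurable ν B).indicator (fun _ => y) b ∂ν := by
          refine lintegral_mono fun b => ?_
          by_cases hb : b ∈ B
          · rw [Set.indicator_of_mem (subset_toMeasurable ν B hb)]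
            exact hB b hb
          · have : (fun a => (a, b)) ⁻¹' R = ∅ := by
              ext a; simp only [Set.mem_preimage, Set.mem_empty_iff_false, iff_false]
              exact fun h => hb (hBc a b h)
            simp [this]
      _ = y * ν B := by
          rw [lintegral_indicator_const (measurableSet_toMeasurable ν B), measure_toMeasurable]
  exact h1.trans h2

lemma finrank_vec (n : ℕ) : Module.finrank ℝ (Vec n) = 2 * n := by
  rw [← Module.finrank_mul_finrank ℝ ℂ (Vec n), Complex.finrank_real_complex]
  simp

lemma ballVol_ne_top (n : ℕ) : ballVol n ≠ ⊤ := measure_closedBall_lt_top.ne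

lemma ballVol_ne_zero (n : ℕ) : ballVol n ≠ 0 :=
  (Metric.measure_closedBall_pos _ _ one_pos).ne'

lemma volume_closedBall_vec {n : ℕ} (x : Vec n) {r : ℝ} (hr : 0 ≤ r) :
    volume (Metric.closedBall x r) = ENNReal.ofReal (r ^ (2 * n)) * ballVol n := by
  rw [ballVol, Measure.addHaar_closedBall _ x hr, Measure.addHaar_closedBall _ 0 zero_le_one,
    finrank_vec]
  simp

/-- The polydisc-like product of balls around a family of vectors. -/
def famBall {ι : Type*} {n : ℕ} (X : ι → Vec n) (ε : ι → ℝ) : Set (ι → Vec n) :=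
  {Z | ∀ j, ‖X j - Z j‖ ≤ ε j}

lemma famBall_eq_pi {ι : Type*} {n : ℕ} (X : ι → Vec n) (ε : ι → ℝ) :
    famBall X ε = Set.univ.pi fun j => Metric.closedBall (X j) (ε j) := by
  ext Z
  simp [famBall, dist_eq_norm, norm_sub_rev]

lemma volume_famBall {ι : Type*} [Fintype ι] {n : ℕ} (X : ι → Vec n) {ε : ι → ℝ}
    (hε : ∀ j, 0 ≤ ε j) :
    volume (famBall X ε) =
      ENNReal.ofReal ((∏ j, ε j ^ 2) ^ n) * ballVol n ^ Fintype.card ι := by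
  rw [famBall_eq_pi, volume_pi_pi]
  simp_rw [fun j => volume_closedBall_vec (X j) (hε j)]
  rw [Finset.prod_mul_distrib, Finset.prod_const, ← ENNReal.ofReal_prod_of_nonneg
    (fun j _ => pow_nonneg (hε j) _), ← Finset.prod_pow]
  simp [pow_mul]

/-- Right multiplication of a family of vectors, seen as a matrix with these columns. -/
def rmul {ι : Type*} [Fintype ι] {n : ℕ} (C : Matrix ι ι ℂ) :
    (ι → Vec n) →ₗ[ℂ] (ι → Vec n) where
  toFun W := fun j => ∑ i, C i j • W i
  map_add' W W' := by ext1 j; simp [Finset.sum_add_distrib]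
  map_smul' c W := by
    ext1 j; simp only [Pi.smul_apply, Finset.smul_sum, RingHom.id_apply]
    exact Finset.sum_congr rfl fun i _ => smul_comm _ _ _

lemma rmul_apply {ι : Type*} [Fintype ι] {n : ℕ} (C : Matrix ι ι ℂ) (W : ι → Vec n) (j : ι) :
    rmul C W j = ∑ i, C i j • W i := rfl

lemma rmul_rmul {ι : Type*} [Fintype ι] {n : ℕ} (C D : Matrix ι ι ℂ) (W : ι → Vec n) :
    rmul D (rmul C W) = rmul (C * D) W := by
  ext1 j
  simp only [rmul_apply, Matrix.mul_apply, Finset.smul_sum, Finset.sum_smul, smul_smul]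
  rw [Finset.sum_comm]
  simp_rw [mul_comm]

lemma rmul_one {ι : Type*} [Fintype ι] [DecidableEq ι] {n : ℕ} (W : ι → Vec n) :
    rmul 1 W = W := by
  ext1 j
  simp [rmul_apply, Matrix.one_apply]

lemma gram_rmul {ι : Type*} [Fintype ι] {n : ℕ} (C : Matrix ι ι ℂ) (W : ι → Vec n) :
    Matrix.gram ℂ (rmul C W) = Cᴴ * Matrix.gram ℂ W * C := by
  ext i j
  simp only [Matrix.gram_apply, rmul_apply, Matrix.mul_apply, sum_inner, inner_sum,
    inner_smul_left, inner_smul_right, Matrix.conjTranspose_apply, Finset.sum_mul]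
  refine Finset.sum_congr rfl fun a _ => ?_
  rw [Finset.mul_sum]
  refine Finset.sum_congr rfl fun b _ => ?_
  simp only [starRingEnd_apply]
  ring

/-- Regrouping a family by its `n` coordinates turns `rmul C` into `n` independent copies of the map
given by `Cᵀ`. -/
lemma det_rmul {ι : Type*} [Fintype ι] [DecidableEq ι] {n : ℕ} (C : Matrix ι ι ℂ) :
    LinearMap.det (rmul (n := n) C) = C.det ^ n := by
  let e : (ι → Vec n) ≃ₗ[ℂ] (Fin n → ι → ℂ) :=
    { toFun := fun W a j => W j a
      invFun := fun M j => WithLp.toLp 2 fun a => M a j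
      map_add' := fun _ _ => rfl
      map_smul' := fun _ _ => rfl
      left_inv := fun _ => rfl
      right_inv := fun _ => rfl }
  rw [← LinearMap.det_conj (rmul (n := n) C) e]
  have : (e ∘ₗ rmul (n := n) C ∘ₗ e.symm : (Fin n → ι → ℂ) →ₗ[ℂ] (Fin n → ι → ℂ)) =
      LinearMap.pi fun a => Matrix.toLin' Cᵀ ∘ₗ LinearMap.proj a := by
    refine LinearMap.ext fun M => ?_
    ext a j
    change (rmul C (e.symm M) j) a = _
    simp [e, rmul_apply, Matrix.mulVec, dotProduct]
  rw [this, LinearMap.det_pi]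
  simp

/-- The real Jacobian of a complex linear map is the squared modulus of its complex determinant. -/
lemma volume_image_rmul {ι : Type*} [Fintype ι] [DecidableEq ι] {n : ℕ} (C : Matrix ι ι ℂ)
    (A : Set (ι → Vec n)) :
    volume (rmul C '' A) = ENNReal.ofReal ((‖C.det‖ ^ 2) ^ n) * volume A := by
  have h := Measure.addHaar_image_linearMap (volume : Measure (ι → Vec n))
    ((rmul C).restrictScalars ℝ) A
  rw [LinearMap.det_restrictScalars, det_rmul, Algebra.norm_complex_apply,
    Complex.normSq_eq_norm_sq,
    norm_pow, abs_of_nonneg (by positivity)] at h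
  rw [← pow_mul, mul_comm 2 n, pow_mul]
  exact h

/-! ### Almost orthonormal families -/

/-- The families of vectors whose Gram matrix is entrywise within `d` of the identity. -/
def nearON (ι : Type*) [DecidableEq ι] (n : ℕ) (d : ℝ) : Set (ι → Vec n) :=
  {W | ∀ i j, ‖Matrix.gram ℂ W i j - (1 : Matrix ι ι ℂ) i j‖ ≤ d}

lemma measurable_gram {ι : Type*} (n : ℕ) (i j : ι) :
    Measurable fun W : ι → Vec n => Matrix.gram ℂ W i j := by
  simp only [Matrix.gram_apply]
  fun_prop

lemma measurableSet_nearON (ι : Type*) [Fintype ι] [DecidableEq ι] (n : ℕ) (d : ℝ) :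
    MeasurableSet (nearON ι n d) := by
  have : nearON ι n d =
      ⋂ i, ⋂ j, {W | ‖Matrix.gram ℂ W i j - (1 : Matrix ι ι ℂ) i j‖ ≤ d} := by
    ext; simp [nearON]
  rw [this]
  exact MeasurableSet.iInter fun i => MeasurableSet.iInter fun j =>
    measurableSet_le ((measurable_gram n i j).sub_const _).norm measurable_const

/-- Polar decomposition: `W = rmul N e` with `N` the square root of the Gram matrix `M` and `e`
orthonormal. The displacement is governed by `N - 1`, which is dominated by `M - 1`. -/
lemma exists_orthonormal_near {ι : Type*} [Fintype ι] [DecidableEq ι] {n : ℕ} {d : ℝ}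
    (hd : Fintype.card ι * d < 1) {W : ι → Vec n} (hW : W ∈ nearON ι n d) :
    ∃ e : ι → Vec n, Orthonormal ℂ e ∧ ∀ i, ‖W i - e i‖ ≤ Fintype.card ι * d := by
  set M := Matrix.gram ℂ W with hM
  have hMp : M.PosSemidef := Matrix.posSemidef_gram ℂ W
  have hdet : M.det ≠ 0 := by
    refine det_ne_zero_of_sum_row_lt_diag fun k => ?_
    have h1 : ∑ j ∈ Finset.univ.erase k, ‖M k j‖ ≤ ∑ j ∈ Finset.univ.erase k, d := by
      refine Finset.sum_le_sum fun j hj => ?_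
      have := hW k j
      rwa [Matrix.one_apply_ne (Finset.ne_of_mem_erase hj).symm, sub_zero] at this
    have h2 : 1 - d ≤ ‖M k k‖ := by
      have h := hW k k
      rw [Matrix.one_apply_eq] at h
      have h3 := norm_sub_norm_le (1 : ℂ) (M k k)
      rw [norm_one, norm_sub_rev] at h3
      linarith
    rw [Finset.sum_const, Finset.card_erase_of_mem (Finset.mem_univ k), Finset.card_univ,
      nsmul_eq_mul, Nat.cast_sub (Fintype.card_pos_iff.mpr ⟨k⟩)] at h1
    push_cast at h1
    linarith
  set N := CFC.sqrt M with hN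
  have hNp : N.PosSemidef := Matrix.nonneg_iff_posSemidef.mp (CFC.sqrt_nonneg M)
  have hNN : N * N = M := CFC.sqrt_mul_sqrt_self M hMp.nonneg
  have hNdet : IsUnit N.det := by
    rw [isUnit_iff_ne_zero]
    intro h
    apply hdet
    rw [← hNN, Matrix.det_mul, h, zero_mul]
  have hNH : Nᴴ = N := hNp.1
  set e := rmul N⁻¹ W with he
  have heg : Matrix.gram ℂ e = 1 := by
    rw [he, gram_rmul, ← hM, Matrix.conjTranspose_nonsing_inv, hNH, ← hNN, ← mul_assoc,
      Matrix.nonsing_inv_mul _ hNdet, one_mul, Matrix.mul_nonsing_inv _ hNdet]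
  have hWe : W = rmul N e := by
    rw [he, rmul_rmul, Matrix.nonsing_inv_mul _ hNdet, rmul_one]
  refine ⟨e, ?_, fun i => ?_⟩
  · rw [orthonormal_iff_ite]
    intro i j
    have := congrFun (congrFun heg i) j
    rwa [Matrix.gram_apply, Matrix.one_apply] at this
  have hd0 : 0 ≤ d := (norm_nonneg _).trans (hW i i)
  have h1 : W i - e i = rmul (N - 1) e i := by
    rw [hWe]
    simp [rmul_apply, sub_smul, Matrix.one_apply]
  have hsub : (N - 1)ᴴ = N - 1 := by rw [Matrix.conjTranspose_sub, hNH, Matrix.conjTranspose_one]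
  have h2 : ((‖W i - e i‖ ^ 2 : ℝ) : ℂ) = ((N - 1) * (N - 1)) i i := by
    have := congrFun (congrFun (gram_rmul (N - 1) e) i) i
    rw [heg, mul_one, hsub, Matrix.gram_apply, ← h1, inner_self_eq_norm_sq_to_K] at this
    push_cast
    exact this
  -- The matrix form of `|√x - 1| ≤ |x - 1|`: with `M = N * N` the difference is `(N - 1)(N² + 2N)(N
  -- - 1)`.
  have h3 : ((M - 1) * (M - 1) - (N - 1) * (N - 1)).PosSemidef := by
    have : (M - 1) * (M - 1) - (N - 1) * (N - 1) = (N - 1) * (N * N + (N + N)) * (N - 1)ᴴ := by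
      rw [← hNN, hsub]; noncomm_ring
    rw [this]
    refine Matrix.PosSemidef.mul_mul_conjTranspose_same ?_ _
    rw [hNN]
    exact hMp.add (hNp.add hNp)
  have h4 : ((M - 1) * (M - 1)) i i = ((∑ j, ‖(M - 1) i j‖ ^ 2 : ℝ) : ℂ) := by
    have hMH : (M - 1)ᴴ = M - 1 := by
      rw [Matrix.conjTranspose_sub, hMp.1, Matrix.conjTranspose_one]
    rw [Matrix.mul_apply]
    push_cast
    refine Finset.sum_congr rfl fun j _ => ?_
    conv_lhs => rw [← hMH]
    conv_lhs => enter [1]; rw [hMH]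
    rw [Matrix.conjTranspose_apply, ← Complex.mul_conj']
    rfl
  have h5 : ‖W i - e i‖ ^ 2 ≤ ∑ j, ‖(M - 1) i j‖ ^ 2 := by
    have := h3.diag_nonneg (i := i)
    rw [Matrix.sub_apply, h4, ← h2, ← Complex.ofReal_sub, Complex.zero_le_real] at this
    linarith
  have h6 : ∑ j, ‖(M - 1) i j‖ ^ 2 ≤ Fintype.card ι * d ^ 2 := by
    calc ∑ j, ‖(M - 1) i j‖ ^ 2 ≤ ∑ _j : ι, d ^ 2 :=
          Finset.sum_le_sum fun j _ => pow_le_pow_left₀ (norm_nonneg _) (hW i j) 2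
      _ = _ := by simp
  refine abs_le_of_sq_le_sq' ?_ (by positivity) |>.2
  have hc : (1 : ℝ) ≤ Fintype.card ι := by
    exact_mod_cast Fintype.card_pos_iff.mpr ⟨i⟩
  calc ‖W i - e i‖ ^ 2 ≤ Fintype.card ι * d ^ 2 := h5.trans h6
    _ ≤ Fintype.card ι * (Fintype.card ι * d ^ 2) := by
        have : 0 ≤ (Fintype.card ι : ℝ) * d ^ 2 := by positivity
        nlinarith
    _ = _ := by ring

lemma exists_orthonormalBasis_of_orthonormal {ι : Type*} [Fintype ι] {n : ℕ} {e : ι → Vec n}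
    (he : Orthonormal ℂ e) (f : ι ↪ Fin n) :
    ∃ b : OrthonormalBasis (Fin n) ℂ (Vec n), ∀ i, b (f i) = e i := by
  classical
  obtain ⟨b, hb⟩ := Orthonormal.exists_orthonormalBasis_extension_of_card_eq (𝕜 := ℂ)
    (E := Vec n) (ι := Fin n) (by simp) (v := Function.extend f e 0) (s := Set.range f) (by
      have : (Set.range f).domRestrict (Function.extend f e 0) =
          e ∘ (Equiv.ofInjective f f.injective).symm := by
        ext1 ⟨x, i, hi⟩
        subst hi
        change Function.extend f e 0 (f i) = e ((Equiv.ofInjective f f.injective).symm _)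
        rw [f.injective.extend_apply, Equiv.ofInjective_symm_apply]
      change Orthonormal ℂ ((Set.range f).domRestrict (Function.extend f e 0))
      rw [this]
      exact he.comp _ (Equiv.injective _))
  exact ⟨b, fun i => by rw [hb _ ⟨i, rfl⟩, f.injective.extend_apply]⟩

lemma exists_uact_orthonormal {ι : Type*} [Fintype ι] {n : ℕ} {e e' : ι → Vec n}
    (he : Orthonormal ℂ e) (he' : Orthonormal ℂ e') :
    ∃ U : Matrix.unitaryGroup (Fin n) ℂ, ∀ i, uact U (e' i) = e i := by
  have hc : Fintype.card ι ≤ Fintype.card (Fin n) := by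
    simpa using he.linearIndependent.fintype_card_le_finrank
  obtain ⟨f⟩ := Function.Embedding.nonempty_of_card_le hc
  obtain ⟨b, hb⟩ := exists_orthonormalBasis_of_orthonormal he f
  obtain ⟨b', hb'⟩ := exists_orthonormalBasis_of_orthonormal he' f
  obtain ⟨U, hU⟩ := uact_surjective (b'.equiv b (Equiv.refl _))
  refine ⟨U, fun i => ?_⟩
  rw [hU, ← hb, ← hb', OrthonormalBasis.equiv_apply_basis]
  rfl

/-- Orthonormal families of equal size are unitarily equivalent, and both families are close to
such. This near transitivity makes hitting probabilities comparable across families with nearly the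
same Gram matrix. -/
lemma exists_uact_nearON {ι : Type*} [Fintype ι] [DecidableEq ι] {n : ℕ} {d d' : ℝ}
    (hd : Fintype.card ι * d < 1) (hd' : Fintype.card ι * d' < 1) {W W' : ι → Vec n}
    (hW : W ∈ nearON ι n d) (hW' : W' ∈ nearON ι n d') :
    ∃ U : Matrix.unitaryGroup (Fin n) ℂ,
      ∀ i, ‖uact U (W' i) - W i‖ ≤ Fintype.card ι * (d + d') := by
  obtain ⟨e, he, h⟩ := exists_orthonormal_near hd hW
  obtain ⟨e', he', h'⟩ := exists_orthonormal_near hd' hW'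
  obtain ⟨U, hU⟩ := exists_uact_orthonormal he he'
  refine ⟨U, fun i => ?_⟩
  have h1 : uact U (W' i) - W i = uact U (W' i - e' i) - (W i - e i) := by
    rw [map_sub, hU]; abel
  rw [h1]
  refine (norm_sub_le _ _).trans ?_
  rw [norm_uact]
  linarith [h i, h' i]

/-! ### Near-orthogonality in high dimension -/

/-- In high dimension, most vectors of a ball are almost orthogonal to a given vector. -/
lemma volume_ball_inner_large {n : ℕ} (v : Vec n) (ρ : ℝ) {t : ℝ} (ht : 0 < t) :
    n * volume {x ∈ Metric.closedBall (0 : Vec n) ρ | t < ‖⟪v, x⟫_ℂ‖} ≤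
      ENNReal.ofReal ((‖v‖ * ρ / t) ^ 2) * volume (Metric.closedBall (0 : Vec n) ρ) := by
  have hm : ∀ (v : Vec n) (t : ℝ),
      MeasurableSet {x ∈ Metric.closedBall (0 : Vec n) ρ | t < ‖⟪v, x⟫_ℂ‖} := fun v t =>
    Metric.isClosed_closedBall.measurableSet.inter (measurableSet_lt measurable_const
        (continuous_const.inner continuous_id).norm.measurable)
  have key : ∀ v : Vec n, ‖v‖ = 1 → ∀ t : ℝ, 0 < t →
      n * volume {x ∈ Metric.closedBall (0 : Vec n) ρ | t < ‖⟪v, x⟫_ℂ‖} ≤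
      ENNReal.ofReal ((ρ / t) ^ 2) * volume (Metric.closedBall (0 : Vec n) ρ) := by
    intro v hv t ht
    let b := EuclideanSpace.basisFun (Fin n) ℂ
    -- By rotation invariance the bad set has the same volume for every basis vector. Summing the
    -- `n` indicators, Parseval and Markov give the bound pointwise.
    have heq : ∀ i, volume {x ∈ Metric.closedBall (0 : Vec n) ρ | t < ‖⟪b i, x⟫_ℂ‖} =
        volume {x ∈ Metric.closedBall (0 : Vec n) ρ | t < ‖⟪v, x⟫_ℂ‖} := by
      intro i
      have h1 : Orthonormal ℂ (fun _ : Unit => b i) :=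
        ⟨fun _ => b.orthonormal.1 i, fun i j h => (h rfl).elim⟩
      have h2 : Orthonormal ℂ (fun _ : Unit => v) := ⟨fun _ => hv, fun i j h => (h rfl).elim⟩
      obtain ⟨U, hU⟩ := exists_uact_orthonormal h1 h2
      rw [← (measurePreserving_isometry (uact U)).measure_preimage (hm _ _).nullMeasurableSet]
      congr 1
      ext x
      simp only [Set.preimage_ofPred_eq, Set.mem_ofPred_eq, mem_closedBall_zero_iff, norm_uact]
      rw [← hU (), inner_uact]
    calc (n : ENNReal) * volume {x ∈ Metric.closedBall (0 : Vec n) ρ | t < ‖⟪v, x⟫_ℂ‖}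
        = ∑ i, volume {x ∈ Metric.closedBall (0 : Vec n) ρ | t < ‖⟪b i, x⟫_ℂ‖} := by
          rw [Finset.sum_congr rfl fun i _ => heq i]
          simp
      _ = ∫⁻ x, ∑ i, {x ∈ Metric.closedBall (0 : Vec n) ρ | t < ‖⟪b i, x⟫_ℂ‖}.indicator 1 x := by
          rw [lintegral_finsetSum _ fun i _ => measurable_one.indicator (hm _ _)]
          simp_rw [lintegral_indicator_one (hm _ _)]
      _ ≤ ∫⁻ x, (Metric.closedBall (0 : Vec n) ρ).indicator
            (fun _ => ENNReal.ofReal ((ρ / t) ^ 2)) x := by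
          refine lintegral_mono fun x => ?_
          by_cases hx : x ∈ Metric.closedBall (0 : Vec n) ρ
          · rw [Set.indicator_of_mem hx]
            have h1 : ∀ i, {x ∈ Metric.closedBall (0 : Vec n) ρ | t < ‖⟪b i, x⟫_ℂ‖}.indicator
                (1 : Vec n → ENNReal) x ≤ ENNReal.ofReal (‖⟪b i, x⟫_ℂ‖ ^ 2 / t ^ 2) := by
              intro i
              by_cases h : t < ‖⟪b i, x⟫_ℂ‖
              · rw [Set.indicator_of_mem (by exact ⟨hx, h⟩), Pi.one_apply, ENNReal.one_le_ofReal,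
                  ← div_pow]
                exact one_le_pow₀ (by rw [one_le_div ht]; exact h.le)
              · rw [Set.indicator_of_notMem (fun h' => h h'.2)]
                positivity
            refine (Finset.sum_le_sum fun i _ => h1 i).trans ?_
            rw [← ENNReal.ofReal_sum_of_nonneg fun i _ => by positivity]
            refine ENNReal.ofReal_le_ofReal ?_
            rw [← Finset.sum_div, b.sum_sq_norm_inner_right, div_pow]
            gcongr
            simpa using hx
          · rw [Set.indicator_of_notMem hx]
            simp only [nonpos_iff_eq_zero, Finset.sum_eq_zero_iff]
            exact fun i _ => Set.indicator_of_notMem (fun h => hx h.1) _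
      _ = _ := lintegral_indicator_const Metric.isClosed_closedBall.measurableSet _
  by_cases hv : v = 0
  · simp [hv, ht.not_gt]
  have hv' : 0 < ‖v‖ := norm_pos_iff.mpr hv
  have := key ((‖v‖⁻¹ : ℂ) • v) (by simp [norm_smul, hv'.ne']) (t / ‖v‖) (by positivity)
  have hset : {x ∈ Metric.closedBall (0 : Vec n) ρ | t / ‖v‖ < ‖⟪(‖v‖⁻¹ : ℂ) • v, x⟫_ℂ‖} =
      {x ∈ Metric.closedBall (0 : Vec n) ρ | t < ‖⟪v, x⟫_ℂ‖} := by
    ext x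
    simp only [Set.mem_ofPred_eq, inner_smul_left, norm_mul, map_inv₀, Complex.conj_ofReal,
      norm_inv,
      Complex.norm_real, norm_norm]
    rw [div_eq_inv_mul, mul_lt_mul_iff_right₀ (by positivity)]
  rw [hset] at this
  convert this using 3
  field_simp

lemma famBall_zero_measurable {ι : Type*} [Fintype ι] {n : ℕ} (X : ι → Vec n) (ρ : ι → ℝ) :
    MeasurableSet (famBall X ρ) := by
  rw [famBall_eq_pi]
  exact MeasurableSet.univ_pi fun _ => Metric.isClosed_closedBall.measurableSet

/-- In high dimension, in most families of vectors of balls, the vector at `j` is almost orthogonal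
to a vector that is determined by the other members of the family. -/
lemma volume_famBall_inner_large {ι : Type*} [Fintype ι] [DecidableEq ι] {n : ℕ} {ρ : ι → ℝ}
    (j : ι) (hρ : 0 ≤ ρ j) {t R : ℝ} (ht : 0 < t) (φ : (ι → Vec n) → Vec n) (hφ : Measurable φ)
    (hφj : ∀ ξ x, φ (Function.update ξ j x) = φ ξ)
    (hR : ∀ ξ ∈ famBall 0 ρ, ‖φ ξ‖ ≤ R) :
    n * volume {ξ ∈ famBall (0 : ι → Vec n) ρ | t < ‖⟪φ ξ, ξ j⟫_ℂ‖} ≤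
      ENNReal.ofReal ((R * ρ j / t) ^ 2) * volume (famBall (0 : ι → Vec n) ρ) := by
  have hB := famBall_zero_measurable (0 : ι → Vec n) ρ
  have hS : MeasurableSet {ξ ∈ famBall (0 : ι → Vec n) ρ | t < ‖⟪φ ξ, ξ j⟫_ℂ‖} :=
    hB.inter (measurableSet_lt measurable_const (hφ.inner (measurable_pi_apply j)).norm)
  rw [← lintegral_indicator_one hS, ← lintegral_indicator_one hB,
    ← lintegral_const_mul _ (measurable_one.indicator hS),
    ← lintegral_const_mul _ (measurable_one.indicator hB)]
  -- It suffices to compare after integrating out coordinate `j` alone: `φ` does not depend on it,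
  -- so this is the estimate for a single ball.
  have := lmarginal_le_of_subset (μ := fun _ : ι => (volume : Measure (Vec n)))
    (s := {j}) (t := Finset.univ)
    (f := fun ξ => n * {ξ ∈ famBall (0 : ι → Vec n) ρ | t < ‖⟪φ ξ, ξ j⟫_ℂ‖}.indicator 1 ξ)
    (g := fun ξ => ENNReal.ofReal ((R * ρ j / t) ^ 2) *
      (famBall (0 : ι → Vec n) ρ).indicator 1 ξ)
    (Finset.subset_univ _) ((measurable_one.indicator hS).const_mul _)
    ((measurable_one.indicator hB).const_mul _) ?_
  · rw [lmarginal_univ, lmarginal_univ] at this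
    exact this 0
  intro ξ
  rw [lmarginal_singleton, lmarginal_singleton]
  have hmem : ∀ x, Function.update ξ j x ∈ famBall (0 : ι → Vec n) ρ ↔
      (∀ i ≠ j, ‖ξ i‖ ≤ ρ i) ∧ x ∈ Metric.closedBall (0 : Vec n) (ρ j) := by
    intro x
    simp only [famBall, Pi.zero_apply, zero_sub, norm_neg, Set.mem_ofPred_eq,
      mem_closedBall_zero_iff]
    constructor
    · intro h
      refine ⟨fun i hi => by simpa [hi] using h i, by simpa using h j⟩
    · rintro ⟨h1, h2⟩ i
      by_cases hi : i = j
      · subst hi; simpa using h2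
      · simpa [hi] using h1 i hi
  by_cases hξ : ∀ i ≠ j, ‖ξ i‖ ≤ ρ i
  · have h1 : ∀ x, {ξ ∈ famBall (0 : ι → Vec n) ρ | t < ‖⟪φ ξ, ξ j⟫_ℂ‖}.indicator
        (1 : (ι → Vec n) → ENNReal) (Function.update ξ j x) =
        {x ∈ Metric.closedBall (0 : Vec n) (ρ j) | t < ‖⟪φ ξ, x⟫_ℂ‖}.indicator 1 x := by
      intro x
      have : Function.update ξ j x ∈ {ξ ∈ famBall (0 : ι → Vec n) ρ | t < ‖⟪φ ξ, ξ j⟫_ℂ‖} ↔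
          x ∈ {x ∈ Metric.closedBall (0 : Vec n) (ρ j) | t < ‖⟪φ ξ, x⟫_ℂ‖} := by
        rw [Set.mem_sep_iff, Set.mem_sep_iff, hmem, hφj, Function.update_self]
        exact ⟨fun h => ⟨h.1.2, h.2⟩, fun h => ⟨⟨hξ, h.1⟩, h.2⟩⟩
      classical
      rw [Set.indicator_apply, Set.indicator_apply]
      exact if_congr this rfl rfl
    have h2 : ∀ x, (famBall (0 : ι → Vec n) ρ).indicator
        (1 : (ι → Vec n) → ENNReal) (Function.update ξ j x) =
        (Metric.closedBall (0 : Vec n) (ρ j)).indicator 1 x := by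
      intro x
      classical
      rw [Set.indicator_apply, Set.indicator_apply]
      exact if_congr ((hmem x).trans ⟨fun h => h.2, fun h => ⟨hξ, h⟩⟩) rfl rfl
    have hm : MeasurableSet {x ∈ Metric.closedBall (0 : Vec n) (ρ j) | t < ‖⟪φ ξ, x⟫_ℂ‖} :=
      Metric.isClosed_closedBall.measurableSet.inter
        (measurableSet_lt measurable_const
        (continuous_const.inner continuous_id).norm.measurable)
    have hm' : MeasurableSet (Metric.closedBall (0 : Vec n) (ρ j)) :=
      Metric.isClosed_closedBall.measurableSet
    simp_rw [h1, h2]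
    rw [lintegral_const_mul _ (measurable_one.indicator hm),
      lintegral_const_mul _ (measurable_one.indicator hm'), lintegral_indicator_one hm,
      lintegral_indicator_one hm']
    refine (volume_ball_inner_large (φ ξ) (ρ j) ht).trans ?_
    gcongr
    have := hR (Function.update ξ j 0) ((hmem 0).mpr ⟨hξ, by simpa using hρ⟩)
    rwa [hφj] at this
  · have h1 : ∀ x, {ξ ∈ famBall (0 : ι → Vec n) ρ | t < ‖⟪φ ξ, ξ j⟫_ℂ‖}.indicator
        (1 : (ι → Vec n) → ENNReal) (Function.update ξ j x) = 0 := by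
      intro x
      refine Set.indicator_of_notMem (fun h => hξ ?_) _
      exact ((hmem x).mp h.1).1
    simp [h1]

/-! ### Families with prescribed Gram matrix -/

/-- The families of vectors whose Gram matrix is entrywise within `d` of `q`. -/
def gramNear {ι : Type*} (q : Matrix ι ι ℂ) (n : ℕ) (d : ℝ) : Set (ι → Vec n) :=
  {W | ∀ i j, ‖Matrix.gram ℂ W i j - q i j‖ ≤ d}

lemma isClosed_gramNear {ι : Type*} [Fintype ι] (q : Matrix ι ι ℂ) (n : ℕ) (d : ℝ) :
    IsClosed (gramNear q n d) := by
  have : gramNear q n d = ⋂ i, ⋂ j, {W | ‖Matrix.gram ℂ W i j - q i j‖ ≤ d} := by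
    ext; simp [gramNear]
  rw [this]
  refine isClosed_iInter fun i => isClosed_iInter fun j => isClosed_le ?_ continuous_const
  simp only [Matrix.gram_apply]
  exact (((continuous_apply i).inner (continuous_apply j)).sub continuous_const).norm

/-- The sum of the norms of the entries. -/
def entSum {ι : Type*} [Fintype ι] (D : Matrix ι ι ℂ) : ℝ := ∑ i, ∑ j, ‖D i j‖

lemma entSum_nonneg {ι : Type*} [Fintype ι] (D : Matrix ι ι ℂ) : 0 ≤ entSum D :=
  Finset.sum_nonneg fun _ _ => Finset.sum_nonneg fun _ _ => norm_nonneg _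

lemma sum_col_le_entSum {ι : Type*} [Fintype ι] (D : Matrix ι ι ℂ) (j : ι) :
    ∑ i, ‖D i j‖ ≤ entSum D :=
  Finset.sum_le_sum fun i _ =>
    Finset.single_le_sum (f := fun j => ‖D i j‖) (fun _ _ => norm_nonneg _) (Finset.mem_univ j)

lemma norm_conj_mul_le {ι : Type*} [Fintype ι] (D E : Matrix ι ι ℂ) {e : ℝ}
    (hE : ∀ i j, ‖E i j‖ ≤ e) (i j : ι) : ‖(Dᴴ * E * D) i j‖ ≤ entSum D ^ 2 * e := by
  have he : 0 ≤ e := (norm_nonneg _).trans (hE i j)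
  calc ‖(Dᴴ * E * D) i j‖ ≤ ∑ b, ∑ a, ‖D a i‖ * e * ‖D b j‖ := by
        rw [Matrix.mul_apply]
        refine (norm_sum_le _ _).trans (Finset.sum_le_sum fun b _ => ?_)
        rw [norm_mul, Matrix.mul_apply, ← Finset.sum_mul]
        gcongr
        refine (norm_sum_le _ _).trans (Finset.sum_le_sum fun a _ => ?_)
        rw [norm_mul, Matrix.conjTranspose_apply, norm_star]
        gcongr
        exact hE a b
    _ = (∑ a, ‖D a i‖) * (∑ b, ‖D b j‖) * e := by
        rw [Finset.sum_mul_sum, Finset.sum_comm, Finset.sum_mul]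
        refine Finset.sum_congr rfl fun a _ => ?_
        rw [Finset.sum_mul]
        exact Finset.sum_congr rfl fun b _ => by ring
    _ ≤ _ := by
        rw [sq]
        have := entSum_nonneg D
        gcongr
        · exact sum_col_le_entSum D i
        · exact sum_col_le_entSum D j

lemma exists_factor {ι : Type*} [Fintype ι] [DecidableEq ι] {M : Matrix ι ι ℂ}
    (hM : M.PosSemidef) : ∃ C : Matrix ι ι ℂ, Cᴴ * C = M := by
  refine ⟨CFC.sqrt M, ?_⟩
  rw [(Matrix.nonneg_iff_posSemidef.mp (CFC.sqrt_nonneg M)).1]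
  exact CFC.sqrt_mul_sqrt_self M hM.nonneg

lemma norm_det_factor {ι : Type*} [Fintype ι] [DecidableEq ι] {M C : Matrix ι ι ℂ}
    (h : Cᴴ * C = M) : ‖C.det‖ ^ 2 = M.det.re := by
  rw [← h, Matrix.det_mul, Matrix.det_conjTranspose, mul_comm, Complex.star_def, Complex.mul_conj']
  norm_cast

lemma rmul_rmul_inv {ι : Type*} [Fintype ι] [DecidableEq ι] {n : ℕ} {C : Matrix ι ι ℂ}
    (hC : C.det ≠ 0) (W : ι → Vec n) : rmul C (rmul C⁻¹ W) = W := by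
  rw [rmul_rmul, Matrix.nonsing_inv_mul _ (isUnit_iff_ne_zero.mpr hC), rmul_one]

lemma rmul_inv_rmul {ι : Type*} [Fintype ι] [DecidableEq ι] {n : ℕ} {C : Matrix ι ι ℂ}
    (hC : C.det ≠ 0) (W : ι → Vec n) : rmul C⁻¹ (rmul C W) = W := by
  rw [rmul_rmul, Matrix.mul_nonsing_inv _ (isUnit_iff_ne_zero.mpr hC), rmul_one]

lemma factor_inv {ι : Type*} [Fintype ι] [DecidableEq ι] {M C : Matrix ι ι ℂ}
    (h : Cᴴ * C = M) (hC : C.det ≠ 0) : C⁻¹ᴴ * M * C⁻¹ = 1 := by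
  have hu := isUnit_iff_ne_zero.mpr hC
  rw [← h, mul_assoc, mul_assoc, Matrix.mul_nonsing_inv _ hu, mul_one,
    ← Matrix.conjTranspose_mul, Matrix.mul_nonsing_inv _ hu, Matrix.conjTranspose_one]

lemma rmul_inv_mem_nearON {ι : Type*} [Fintype ι] [DecidableEq ι] {n : ℕ} {M C : Matrix ι ι ℂ}
    (h : Cᴴ * C = M) (hC : C.det ≠ 0) {e : ℝ} {X : ι → Vec n} (hX : X ∈ gramNear M n e) :
    rmul C⁻¹ X ∈ nearON ι n (entSum C⁻¹ ^ 2 * e) := by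
  intro i j
  have : Matrix.gram ℂ (rmul C⁻¹ X) - 1 = C⁻¹ᴴ * (Matrix.gram ℂ X - M) * C⁻¹ := by
    rw [gram_rmul, Matrix.mul_sub, Matrix.sub_mul, factor_inv h hC]
  rw [← Matrix.sub_apply, this]
  exact norm_conj_mul_le _ _ hX i j

lemma rmul_mem_gramNear {ι : Type*} [Fintype ι] [DecidableEq ι] {n : ℕ} {M C : Matrix ι ι ℂ}
    (h : Cᴴ * C = M) {e : ℝ} {W : ι → Vec n} (hW : W ∈ nearON ι n e) :
    rmul C W ∈ gramNear M n (entSum C ^ 2 * e) := by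
  intro i j
  have : Matrix.gram ℂ (rmul C W) - M = Cᴴ * (Matrix.gram ℂ W - 1) * C := by
    rw [gram_rmul, Matrix.mul_sub, Matrix.sub_mul, mul_one, h]
  rw [← Matrix.sub_apply, this]
  exact norm_conj_mul_le _ _ hW i j

/-! ### Volume of almost orthonormal families, after discarding bad sets of relative size `O(1/n)`
-/

lemma measure_le_two_mul_of_bad {α : Type*} [MeasurableSpace α] {μ : Measure α} {F G D : Set α}
    (hF : F ⊆ G ∪ D) {n : ℕ} {K : ℝ} (hK : n * μ D ≤ ENNReal.ofReal K * μ F) (hn : 2 * K ≤ n)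
    (hn0 : 0 < n) (hfin : μ F ≠ ⊤) : μ F ≤ 2 * μ G := by
  have h1 : n * μ F ≤ n * μ G + ENNReal.ofReal (n / 2) * μ F := by
    calc n * μ F ≤ n * (μ G + μ D) := by
          gcongr; exact (measure_mono hF).trans (measure_union_le _ _)
      _ ≤ n * μ G + ENNReal.ofReal (n / 2) * μ F := by
          rw [mul_add]
          refine add_le_add le_rfl (hK.trans (mul_le_mul_left ?_ _))
          exact ENNReal.ofReal_le_ofReal (by linarith)
  have h2 : (n : ENNReal) = ENNReal.ofReal (n / 2) + ENNReal.ofReal (n / 2) := by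
    rw [← ENNReal.ofReal_add (by positivity) (by positivity), add_halves, ENNReal.ofReal_natCast]
  have h3 : ENNReal.ofReal (n / 2) * μ F ≤ n * μ G := by
    have hf : ENNReal.ofReal (n / 2) * μ F ≠ ⊤ := ENNReal.mul_ne_top ENNReal.ofReal_ne_top hfin
    refine (ENNReal.add_le_add_iff_right hf).mp (le_trans (le_of_eq ?_) h1)
    rw [← add_mul, ← h2]
  have h4 : ENNReal.ofReal (n / 2) * μ F ≤ ENNReal.ofReal (n / 2) * (2 * μ G) := by
    refine h3.trans (le_of_eq ?_)
    rw [h2, add_mul, ← mul_assoc, mul_two, add_mul]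
  have hpos : (0 : ℝ) < n / 2 := by positivity
  exact (ENNReal.mul_le_mul_iff_right (ENNReal.ofReal_pos.mpr hpos).ne' ENNReal.ofReal_ne_top).mp h4

lemma volume_famBall_ne_top {ι : Type*} [Fintype ι] {n : ℕ} (X : ι → Vec n) {ε : ι → ℝ}
    (hε : ∀ j, 0 ≤ ε j) : volume (famBall X ε) ≠ ⊤ := by
  rw [volume_famBall X hε]
  exact ENNReal.mul_ne_top ENNReal.ofReal_ne_top (ENNReal.pow_ne_top (ballVol_ne_top n))

/-- In high dimension, a positive proportion of the product of unit balls consists of almost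
orthonormal families. -/
lemma eventually_ballVol_le_nearON (ι : Type*) [Fintype ι] [DecidableEq ι] {d : ℝ} (hd : 0 < d) :
    ∀ᶠ n : ℕ in atTop, ballVol n ^ Fintype.card ι ≤ 2 * volume (nearON ι n d) := by
  set r := (Fintype.card ι : ℝ) with hr
  -- The vectors of the unit ball with squared norm at most `x` have relative volume `x ^ n`, which
  -- is eventually below `1 / n`. The maximum with `0` covers `d > 1`.
  set x := max (1 - d) 0 with hx
  have hx0 : 0 ≤ x := le_max_right _ _
  have hx1 : x < 1 := max_lt (by linarith) one_pos
  have h0 := (tendsto_self_mul_const_pow_of_lt_one hx0 hx1).eventually (ge_mem_nhds one_pos)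
  filter_upwards [h0, eventually_gt_atTop 0, eventually_ge_atTop ⌈2 * (r + r ^ 2 * (1 / d) ^ 2)⌉₊]
    with n hn1 hn0 hn2
  have hvol : volume (famBall (0 : ι → Vec n) 1) = ballVol n ^ Fintype.card ι := by
    rw [volume_famBall (ε := 1) 0 (fun _ => zero_le_one)]; simp
  rw [← hvol]
  -- In the product of unit balls, a family fails to be almost orthonormal only if some vector is
  -- too short (`D1`) or two distinct vectors have a large inner product (`D2`).
  let D1 : Set (ι → Vec n) := ⋃ j, famBall 0 (Function.update 1 j √x)
  let D2 : Set (ι → Vec n) := ⋃ i, ⋃ j,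
    {ξ ∈ famBall (0 : ι → Vec n) 1 | i ≠ j ∧ d < ‖⟪ξ i, ξ j⟫_ℂ‖}
  refine measure_le_two_mul_of_bad (D := D1 ∪ D2) (n := n)
    (K := r + r ^ 2 * (1 / d) ^ 2) ?_ ?_ ?_ hn0 (volume_famBall_ne_top 0 fun _ => zero_le_one)
  · intro ξ hξ
    by_cases hN : ξ ∈ nearON ι n d
    · exact Or.inl hN
    right
    simp only [nearON, Set.mem_ofPred_eq, not_forall, not_le] at hN
    obtain ⟨i, j, hij⟩ := hN
    by_cases h : i = j
    · subst h
      left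
      rw [Set.mem_iUnion]
      refine ⟨i, fun k => ?_⟩
      by_cases hk : k = i
      · subst hk
        rw [Matrix.one_apply_eq, Matrix.gram_apply, inner_self_eq_norm_sq_to_K] at hij
        have hξk : ‖ξ k‖ ≤ 1 := by simpa using hξ k
        have h2 : ‖((‖ξ k‖ : ℂ) ^ 2 - 1)‖ = 1 - ‖ξ k‖ ^ 2 := by
          have : ((‖ξ k‖ : ℂ) ^ 2 - 1) = ((‖ξ k‖ ^ 2 - 1 : ℝ) : ℂ) := by push_cast; rfl
          rw [this, Complex.norm_real, Real.norm_eq_abs, abs_of_nonpos]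
          · ring
          · nlinarith [norm_nonneg (ξ k)]
        have h3 : d < 1 - ‖ξ k‖ ^ 2 := by rw [← h2]; exact hij
        simp only [Pi.zero_apply, zero_sub, norm_neg, Function.update_self]
        refine Real.le_sqrt_of_sq_le (le_trans ?_ (le_max_left _ _))
        linarith
      · simpa [hk] using hξ k
    · right
      rw [Set.mem_iUnion₂]
      refine ⟨i, j, hξ, h, ?_⟩
      rwa [Matrix.one_apply_ne h, sub_zero, Matrix.gram_apply] at hij
  · have hB1 : n * volume D1 ≤ ENNReal.ofReal r * volume (famBall (0 : ι → Vec n) 1) := by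
      calc n * volume D1
          ≤ n * ∑ j, volume (famBall (0 : ι → Vec n) (Function.update 1 j √x)) := by
            gcongr; exact measure_iUnion_fintype_le _ _
        _ = ∑ j : ι, ENNReal.ofReal (n * x ^ n) * ballVol n ^ Fintype.card ι := by
            rw [Finset.mul_sum]
            refine Finset.sum_congr rfl fun j _ => ?_
            rw [volume_famBall]
            · rw [← mul_assoc, ENNReal.ofReal_mul (by positivity), ENNReal.ofReal_natCast]
              congr 4
              have : ∀ k, Function.update (1 : ι → ℝ) j √x k ^ 2 =
                  Function.update (1 : ι → ℝ) j x k := by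
                intro k
                by_cases hk : k = j
                · subst hk; simp [Real.sq_sqrt hx0]
                · simp [hk]
              simp_rw [this]
              rw [Finset.prod_update_of_mem (Finset.mem_univ j)]
              simp
            · intro k
              by_cases hk : k = j
              · subst hk; simp
              · simp [hk]
        _ ≤ ∑ j : ι, 1 * ballVol n ^ Fintype.card ι := by
            gcongr
            rw [← ENNReal.ofReal_one]
            exact ENNReal.ofReal_le_ofReal hn1
        _ = _ := by
            rw [hvol, hr]; simp
    have hB2 : n * volume D2 ≤
        ENNReal.ofReal (r ^ 2 * (1 / d) ^ 2) * volume (famBall (0 : ι → Vec n) 1) := by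
      calc n * volume D2
          ≤ n * ∑ i, ∑ j, volume {ξ ∈ famBall (0 : ι → Vec n) 1 | i ≠ j ∧ d < ‖⟪ξ i, ξ j⟫_ℂ‖} := by
            gcongr
            refine (measure_iUnion_fintype_le _ _).trans (Finset.sum_le_sum fun i _ => ?_)
            exact measure_iUnion_fintype_le _ _
        _ ≤ ∑ i : ι, ∑ j : ι, ENNReal.ofReal ((1 / d) ^ 2) *
              volume (famBall (0 : ι → Vec n) 1) := by
            rw [Finset.mul_sum]
            refine Finset.sum_le_sum fun i _ => ?_
            rw [Finset.mul_sum]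
            refine Finset.sum_le_sum fun j _ => ?_
            by_cases hij : i = j
            · simp [hij]
            · have := volume_famBall_inner_large (n := n) (ρ := 1) j zero_le_one (R := 1) hd
                (fun ξ => ξ i) (measurable_pi_apply i)
                (fun ξ x => Function.update_of_ne hij _ _)
                (fun ξ hξ => by simpa using hξ i)
              simpa [hij] using this
        _ = _ := by
            rw [ENNReal.ofReal_mul (by positivity), hr]
            simp only [Finset.sum_const, Finset.card_univ, nsmul_eq_mul]
            rw [← Nat.cast_pow, ENNReal.ofReal_natCast]
            push_cast
            ring
    calc n * volume (D1 ∪ D2) ≤ n * (volume D1 + volume D2) := by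
          gcongr; exact measure_union_le _ _
      _ ≤ _ := by
          rw [mul_add, ENNReal.ofReal_add (by positivity) (by positivity), add_mul]
          exact add_le_add hB1 hB2
  · exact (Nat.le_ceil _).trans (by exact_mod_cast hn2)

/-- Only the diagonal of the Gram matrix is needed: it bounds the norms. -/
lemma volume_nearON_le (ι : Type*) [Fintype ι] [DecidableEq ι] (n : ℕ) {d : ℝ} (hd : 0 ≤ d) :
    volume (nearON ι n d) ≤
      ENNReal.ofReal (((1 + d) ^ Fintype.card ι) ^ n) * ballVol n ^ Fintype.card ι := by
  have h : nearON ι n d ⊆ famBall 0 (fun _ => √(1 + d)) := by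
    intro W hW j
    have h1 := hW j j
    rw [Matrix.one_apply_eq, Matrix.gram_apply, inner_self_eq_norm_sq_to_K] at h1
    have h2 : ((‖W j‖ : ℂ) ^ 2 - 1) = ((‖W j‖ ^ 2 - 1 : ℝ) : ℂ) := by push_cast; rfl
    change ‖((‖W j‖ : ℂ) ^ 2 - 1)‖ ≤ d at h1
    rw [h2, Complex.norm_real, Real.norm_eq_abs] at h1
    simp only [Pi.zero_apply, zero_sub, norm_neg]
    exact Real.le_sqrt_of_sq_le (by linarith [le_abs_self (‖W j‖ ^ 2 - 1)])
  refine (measure_mono h).trans (le_of_eq ?_)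
  rw [volume_famBall _ fun _ => Real.sqrt_nonneg _]
  simp [Real.sq_sqrt (show 0 ≤ 1 + d by linarith)]

/-- Most perturbations of a family of vectors are almost orthogonal to another family. -/
lemma volume_famBall_le_orthogonal {ι : Type*} [Fintype ι] [DecidableEq ι] {n : ℕ} {ρ : ι → ℝ}
    {P : ℝ} (hρ : ∀ j, 0 ≤ ρ j) (hP : ∀ j, ρ j ≤ P) {t R : ℝ} (ht : 0 < t) (Y : ι → Vec n)
    (hY : ∀ i, ‖Y i‖ ≤ R) (hn0 : 0 < n)
    (hn : 2 * ((Fintype.card ι) ^ 2 * (R * P / t) ^ 2) ≤ n) :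
    volume (famBall (0 : ι → Vec n) ρ) ≤
      2 * volume {ξ ∈ famBall (0 : ι → Vec n) ρ | ∀ i j, ‖⟪Y i, ξ j⟫_ℂ‖ ≤ t} := by
  refine measure_le_two_mul_of_bad
    (D := ⋃ i, ⋃ j, {ξ ∈ famBall (0 : ι → Vec n) ρ | t < ‖⟪Y i, ξ j⟫_ℂ‖}) (n := n)
    ?_ ?_ hn hn0 (volume_famBall_ne_top 0 hρ)
  · intro ξ hξ
    by_cases h : ∀ i j, ‖⟪Y i, ξ j⟫_ℂ‖ ≤ t
    · exact Or.inl ⟨hξ, h⟩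
    · right
      push Not at h
      obtain ⟨i, j, h⟩ := h
      exact Set.mem_iUnion₂.mpr ⟨i, j, hξ, h⟩
  · calc n * volume (⋃ i, ⋃ j, {ξ ∈ famBall (0 : ι → Vec n) ρ | t < ‖⟪Y i, ξ j⟫_ℂ‖})
        ≤ n * ∑ i, ∑ j, volume {ξ ∈ famBall (0 : ι → Vec n) ρ | t < ‖⟪Y i, ξ j⟫_ℂ‖} := by
          gcongr
          refine (measure_iUnion_fintype_le _ _).trans (Finset.sum_le_sum fun i _ => ?_)
          exact measure_iUnion_fintype_le _ _
      _ ≤ ∑ i : ι, ∑ j : ι, ENNReal.ofReal ((R * P / t) ^ 2) *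
            volume (famBall (0 : ι → Vec n) ρ) := by
          rw [Finset.mul_sum]
          refine Finset.sum_le_sum fun i _ => ?_
          rw [Finset.mul_sum]
          refine Finset.sum_le_sum fun j _ => ?_
          refine (volume_famBall_inner_large j (hρ j) (R := R) ht (fun _ => Y i)
            measurable_const (fun _ _ => rfl) (fun _ _ => hY i)).trans ?_
          have hR : 0 ≤ R := (norm_nonneg _).trans (hY i)
          have := hρ j
          have := hP j
          gcongr
      _ = _ := by
          rw [ENNReal.ofReal_mul (by positivity)]
          simp only [Finset.sum_const, Finset.card_univ, nsmul_eq_mul]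
          rw [← Nat.cast_pow, ENNReal.ofReal_natCast]
          push_cast
          ring

/-! ### Hitting probabilities of a Haar unitary -/

/-- The probability that a Haar unitary maps one family of vectors close to another one. -/
def hit {ι : Type*} {n : ℕ} (Y Z : ι → Vec n) (ε : ι → ℝ) : ENNReal :=
  unitaryHaar n {U | ∀ j, ‖uact U (Y j) - Z j‖ ≤ ε j}

lemma isClosed_hitRel {ι : Type*} {n : ℕ} (Y : ι → Vec n) (ε : ι → ℝ) :
    IsClosed {p : Matrix.unitaryGroup (Fin n) ℂ × (ι → Vec n) |
      ∀ j, ‖uact p.1 (Y j) - p.2 j‖ ≤ ε j} := by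
  simp only [Set.ofPred_forall]
  refine isClosed_iInter fun j => isClosed_le ?_ continuous_const
  have h : Continuous fun p : Matrix.unitaryGroup (Fin n) ℂ × (ι → Vec n) => uact p.1 (Y j) :=
    (continuous_uact (n := n)).comp
      (f := fun p : Matrix.unitaryGroup (Fin n) ℂ × (ι → Vec n) => (p.1, Y j))
      (continuous_fst.prodMk continuous_const)
  exact (h.sub ((continuous_apply j).comp continuous_snd)).norm

lemma norm_rmul_sub_le {ι : Type*} [Fintype ι] {n : ℕ} (C : Matrix ι ι ℂ) {W W' : ι → Vec n}
    {U : Matrix.unitaryGroup (Fin n) ℂ} {η : ℝ} (hη : ∀ i, ‖uact U (W' i) - W i‖ ≤ η) (j : ι) :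
    ‖uact U (rmul C W' j) - rmul C W j‖ ≤ entSum C * η := by
  have hη0 : 0 ≤ η := (norm_nonneg _).trans (hη j)
  have : uact U (rmul C W' j) - rmul C W j = ∑ i, C i j • (uact U (W' i) - W i) := by
    simp only [rmul_apply, map_sum, map_smul, smul_sub, Finset.sum_sub_distrib]
  rw [this]
  calc ‖∑ i, C i j • (uact U (W' i) - W i)‖ ≤ ∑ i, ‖C i j‖ * η := by
        refine (norm_sum_le _ _).trans (Finset.sum_le_sum fun i _ => ?_)
        rw [norm_smul]
        gcongr
        exact hη i
    _ = (∑ i, ‖C i j‖) * η := (Finset.sum_mul _ _ _).symm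
    _ ≤ _ := by gcongr; exact sum_col_le_entSum C j

/-- Left invariance of Haar measure allows the target to be rotated freely; the enlarged tolerance
absorbs the remaining displacement. -/
lemma hit_le_hit_of_uact {ι : Type*} {n : ℕ} (Y : ι → Vec n) {Z Z' : ι → Vec n} {ε ε' : ι → ℝ}
    (U : Matrix.unitaryGroup (Fin n) ℂ) (h : ∀ j, ‖uact U (Z' j) - Z j‖ ≤ ε' j - ε j) :
    hit Y Z ε ≤ hit Y Z' ε' := by
  have : hit Y Z' ε' = unitaryHaar n {W | ∀ j, ‖uact W (Y j) - uact U (Z' j)‖ ≤ ε' j} := by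
    rw [hit, ← measure_preimage_mul (unitaryHaar n) U⁻¹]
    congr 1
    ext W
    simp only [Set.mem_preimage, Set.mem_ofPred_eq]
    refine forall_congr' fun j => ?_
    rw [← norm_uact U, map_sub, uact_mul, uact_apply_inv]
  rw [this, hit]
  refine measure_mono fun W hW j => ?_
  have h1 : uact W (Y j) - uact U (Z' j) =
      (uact W (Y j) - Z j) - (uact U (Z' j) - Z j) := by abel
  rw [h1]
  refine (norm_sub_le _ _).trans ?_
  linarith [hW j, h j]

lemma measurableSet_rmul_nearON {ι : Type*} [Fintype ι] [DecidableEq ι] (n : ℕ)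
    {C : Matrix ι ι ℂ} (hC : C.det ≠ 0) (d : ℝ) :
    MeasurableSet (rmul C '' nearON ι n d) := by
  have : rmul C '' nearON ι n d = rmul C⁻¹ ⁻¹' nearON ι n d := by
    ext X
    constructor
    · rintro ⟨W, hW, rfl⟩
      simpa [rmul_inv_rmul hC] using hW
    · intro hX
      exact ⟨_, hX, rmul_rmul_inv hC X⟩
  rw [this]
  refine (measurableSet_nearON ι n d).preimage ?_
  exact (LinearMap.continuous_of_finiteDimensional (rmul (n := n) C⁻¹)).measurable

/-- Count pairs of a unitary and a target in `rmul C '' nearON ι n d`. Every such target is nearly a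
rotation of `rmul C W`, so its hitting probability at the enlarged tolerance is at least the given
one; for a fixed unitary the targets lie in a product of balls. -/
lemma hit_mul_volume_le {ι : Type*} [Fintype ι] [DecidableEq ι] {n : ℕ} (Y : ι → Vec n)
    {W : ι → Vec n} {C : Matrix ι ι ℂ} {d₀ d τ : ℝ} {ε : ι → ℝ}
    (hd₀ : Fintype.card ι * d₀ < 1) (hd : Fintype.card ι * d < 1) (hW : W ∈ nearON ι n d₀)
    (hε : ∀ j, 0 ≤ (1 + τ) * ε j)
    (hmove : ∀ j, entSum C * (Fintype.card ι * (d₀ + d)) ≤ τ * ε j) :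
    hit Y (rmul C W) ε * volume (rmul C '' nearON ι n d) ≤
      ENNReal.ofReal ((∏ j, ((1 + τ) * ε j) ^ 2) ^ n) * ballVol n ^ Fintype.card ι := by
  have hm := (isClosed_hitRel Y (fun j => (1 + τ) * ε j)).measurableSet
  have key := double_counting (μ := (volume : Measure (ι → Vec n))) (ν := unitaryHaar n)
    (R := Prod.swap ⁻¹' {p : Matrix.unitaryGroup (Fin n) ℂ × (ι → Vec n) |
      ∀ j, ‖uact p.1 (Y j) - p.2 j‖ ≤ (1 + τ) * ε j}) (measurable_swap hm)
    (A := rmul C '' nearON ι n d) (B := Set.univ) (x := hit Y (rmul C W) ε)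
    (y := ENNReal.ofReal ((∏ j, ((1 + τ) * ε j) ^ 2) ^ n) * ballVol n ^ Fintype.card ι)
    ?_ ?_ (fun _ _ _ => Set.mem_univ _)
  · simpa using key
  · rintro _ ⟨W', hW', rfl⟩
    obtain ⟨U, hU⟩ := exists_uact_nearON hd₀ hd hW hW'
    refine hit_le_hit_of_uact Y (ε' := fun j => (1 + τ) * ε j) U fun j => ?_
    exact (norm_rmul_sub_le C hU j).trans ((hmove j).trans (le_of_eq (by ring)))
  · intro U _
    rw [← volume_famBall (fun j => uact U (Y j)) hε]
    exact le_rfl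

/-- The reverse count. For a fixed unitary, at least half of the perturbations of the rotated `Y`
are almost orthogonal to it, and `hnoise` keeps these inside the set of targets. -/
lemma volume_famBall_le_hit {ι : Type*} [Fintype ι] [DecidableEq ι] {n : ℕ} (Y : ι → Vec n)
    {W : ι → Vec n} {C : Matrix ι ι ℂ} (hC : C.det ≠ 0) {d₀ d τ t R P : ℝ} {ε : ι → ℝ}
    (hd₀ : Fintype.card ι * d₀ < 1) (hd : Fintype.card ι * d < 1) (hW : W ∈ nearON ι n d₀)
    (hε : ∀ j, 0 ≤ ε j) (hP : ∀ j, ε j ≤ P)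
    (hmove : ∀ j, entSum C * (Fintype.card ι * (d₀ + d)) ≤ τ * ε j) (ht : 0 < t)
    (hY : ∀ i, ‖Y i‖ ≤ R) (hn0 : 0 < n)
    (hn : 2 * ((Fintype.card ι) ^ 2 * (R * P / t) ^ 2) ≤ n)
    (hnoise : ∀ Y' ξ : ι → Vec n, Matrix.gram ℂ Y' = Matrix.gram ℂ Y → ξ ∈ famBall 0 ε →
      (∀ i j, ‖⟪Y' i, ξ j⟫_ℂ‖ ≤ t) → Y' + ξ ∈ rmul C '' nearON ι n d) :
    ENNReal.ofReal ((∏ j, ε j ^ 2) ^ n) * ballVol n ^ Fintype.card ι ≤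
      2 * (hit Y (rmul C W) (fun j => (1 + τ) * ε j) * volume (rmul C '' nearON ι n d)) := by
  have hm : MeasurableSet {p : Matrix.unitaryGroup (Fin n) ℂ × (ι → Vec n) |
      (∀ j, ‖uact p.1 (Y j) - p.2 j‖ ≤ ε j) ∧ p.2 ∈ rmul C '' nearON ι n d} :=
    (isClosed_hitRel Y ε).measurableSet.inter
      (measurable_snd (measurableSet_rmul_nearON n hC d))
  have key := double_counting (ν := (volume : Measure (ι → Vec n))) (μ := unitaryHaar n) hm
    (B := rmul C '' nearON ι n d) (A := Set.univ) (y := hit Y (rmul C W) fun j => (1 + τ) * ε j)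
    (x := (ENNReal.ofReal ((∏ j, ε j ^ 2) ^ n) * ballVol n ^ Fintype.card ι) / 2)
    ?_ ?_ (fun _ _ h => h.2)
  · rw [measure_univ, mul_one, ENNReal.div_le_iff_le_mul (by simp) (by simp)] at key
    exact key.trans (le_of_eq (mul_comm _ _))
  · intro U _
    rw [ENNReal.div_le_iff_le_mul (by simp) (by simp), ← volume_famBall 0 hε, mul_comm]
    set Y' : ι → Vec n := fun j => uact U (Y j) with hY'
    refine (volume_famBall_le_orthogonal hε hP ht Y' (fun i => ?_) hn0 hn).trans ?_
    · rw [hY', norm_uact]; exact hY i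
    gcongr 2 * ?_
    refine le_trans (measure_mono fun ξ hξ => ?_)
      (le_of_eq (measure_preimage_add volume Y' _))
    refine ⟨fun j => ?_, hnoise Y' ξ ?_ hξ.1 hξ.2⟩
    · simpa [hY'] using hξ.1 j
    · ext i j
      rw [Matrix.gram_apply, Matrix.gram_apply, inner_uact]
  · rintro _ ⟨W', hW', rfl⟩
    obtain ⟨U, hU⟩ := exists_uact_nearON hd hd₀ hW' hW
    refine (measure_mono ?_).trans (hit_le_hit_of_uact Y (Z := rmul C W') U (ε := ε)
      fun j => ?_)
    · exact fun V hV => hV.1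
    · refine (norm_rmul_sub_le C hU j).trans ?_
      rw [add_comm d d₀]
      exact (hmove j).trans (le_of_eq (by ring))

lemma norm_gram_apply_le {ι : Type*} {n : ℕ} {Z : ι → Vec n} {R : ℝ} (hR : ∀ j, ‖Z j‖ ≤ R)
    (i j : ι) : ‖Matrix.gram ℂ Z i j‖ ≤ R ^ 2 := by
  rw [Matrix.gram_apply, sq]
  exact (norm_inner_le_norm _ _).trans
    (mul_le_mul (hR i) (hR j) (norm_nonneg _) ((norm_nonneg _).trans (hR i)))

/-- The diagonal of `Cᴴ * C` consists of the squared column norms of `C`. The bound does not involve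
the determinant, so it is uniform over bounded families. -/
lemma entSum_factor_le {ι : Type*} [Fintype ι] [DecidableEq ι] {M C : Matrix ι ι ℂ}
    (h : Cᴴ * C = M) {R : ℝ} (hR0 : 0 ≤ R) (hR : ∀ j, ‖M j j‖ ≤ R ^ 2) :
    entSum C ≤ (Fintype.card ι) ^ 2 * R := by
  have h1 : ∀ i j, ‖C i j‖ ≤ R := by
    intro i j
    refine abs_le_of_sq_le_sq' ?_ hR0 |>.2
    refine le_trans ?_ (hR j)
    have h2 : M j j = ((∑ i, ‖C i j‖ ^ 2 : ℝ) : ℂ) := by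
      rw [← h, Matrix.mul_apply]
      push_cast
      refine Finset.sum_congr rfl fun a _ => ?_
      rw [Matrix.conjTranspose_apply, Complex.star_def, Complex.conj_mul']
    rw [h2, Complex.norm_real, Real.norm_eq_abs]
    refine le_trans ?_ (le_abs_self _)
    exact Finset.single_le_sum (f := fun i => ‖C i j‖ ^ 2) (fun _ _ => by positivity)
      (Finset.mem_univ i)
  calc entSum C ≤ ∑ _i : ι, ∑ _j : ι, R :=
        Finset.sum_le_sum fun i _ => Finset.sum_le_sum fun j _ => h1 i j
    _ = _ := by simp; ring

/-- Upper bound for the probability that a Haar unitary maps one family of vectors close to another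
one, in terms of the Gram determinant of the latter. -/
lemma eventually_hit_le (ι : Type*) [Fintype ι] [DecidableEq ι] {τ : ℝ} (hτ : 0 < τ)
    {ε : ι → ℝ} (hε : ∀ j, 0 < ε j) {R : ℝ} (hR0 : 0 < R) :
    ∀ᶠ n : ℕ in atTop, ∀ Y Z : ι → Vec n, (∀ j, ‖Z j‖ ≤ R) → (Matrix.gram ℂ Z).det ≠ 0 →
      hit Y Z ε ≤ ENNReal.ofReal
        (2 * ((∏ j, ((1 + τ) * ε j) ^ 2) / (Matrix.gram ℂ Z).det.re) ^ n) := by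
  obtain ⟨e, he, hel⟩ : ∃ e : ℝ, 0 < e ∧ ∀ j, e ≤ ε j := by
    rcases isEmpty_or_nonempty ι with h | h
    · exact ⟨1, one_pos, fun j => h.elim j⟩
    · obtain ⟨j, hj⟩ := Finite.exists_min ε
      exact ⟨ε j, hε j, hj⟩
  set r := (Fintype.card ι : ℝ) with hr
  have hr0 : 0 ≤ r := by positivity
  -- The first bound permits orthonormalisation; the second keeps the displacement, at most `r ^ 2 *
  -- R * (r * d)`, within the extra tolerance `τ * e`.
  set d := min (1 / (r + 1)) (τ * e / (r ^ 3 * R + 1)) with hd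
  have hd0 : 0 < d := by positivity
  have hd1 : r * d < 1 := by
    have : d ≤ 1 / (r + 1) := min_le_left _ _
    rw [le_div_iff₀ (by positivity)] at this
    nlinarith
  have hd2 : r ^ 2 * R * (r * (0 + d)) ≤ τ * e := by
    have : d ≤ τ * e / (r ^ 3 * R + 1) := min_le_right _ _
    rw [le_div_iff₀ (by positivity)] at this
    nlinarith
  filter_upwards [eventually_ballVol_le_nearON ι hd0] with n hn Y Z hZ hdet
  have hpsd := Matrix.posSemidef_gram ℂ Z
  obtain ⟨C, hC⟩ := exists_factor hpsd
  have hCdet : C.det ≠ 0 := by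
    intro h
    apply hdet
    rw [← hC, Matrix.det_mul, h, mul_zero]
  -- Since `C` factors the Gram matrix of `Z` itself, the normalised family is exactly orthonormal,
  -- and no lower bound on the determinant is required.
  have hW : rmul C⁻¹ Z ∈ nearON ι n 0 := by
    have := rmul_inv_mem_nearON (n := n) hC hCdet (e := 0) (X := Z) (fun i j => by simp)
    simpa using this
  have key := hit_mul_volume_le Y (C := C) (d₀ := 0) (d := d) (τ := τ) (ε := ε) (by simp) hd1 hW
    (fun j => by have := hε j; positivity) (fun j => by
      have hC2 := entSum_factor_le hC hR0.le (fun j => norm_gram_apply_le hZ j j)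
      calc entSum C * (r * (0 + d)) ≤ r ^ 2 * R * (r * (0 + d)) := by
            have : 0 ≤ r * (0 + d) := by positivity
            gcongr
        _ ≤ τ * e := hd2
        _ ≤ _ := by gcongr; exact hel j)
  rw [rmul_rmul_inv hCdet, volume_image_rmul, norm_det_factor hC] at key
  set D := (Matrix.gram ℂ Z).det.re with hD
  have hDpos : 0 < D := by
    rw [hD, ← norm_det_factor hC]; positivity
  set B := ballVol n ^ Fintype.card ι with hB
  have hB0 : B ≠ 0 := pow_ne_zero _ (ballVol_ne_zero n)
  have hBt : B ≠ ⊤ := ENNReal.pow_ne_top (ballVol_ne_top n)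
  have h1 : hit Y Z ε * ENNReal.ofReal (D ^ n) * B ≤
      2 * ENNReal.ofReal ((∏ j, ((1 + τ) * ε j) ^ 2) ^ n) * B := by
    calc hit Y Z ε * ENNReal.ofReal (D ^ n) * B
        ≤ hit Y Z ε * ENNReal.ofReal (D ^ n) * (2 * volume (nearON ι n d)) := by gcongr
      _ = 2 * (hit Y Z ε * (ENNReal.ofReal (D ^ n) * volume (nearON ι n d))) := by ring
      _ ≤ _ := by rw [mul_assoc]; gcongr
  rw [ENNReal.mul_le_mul_iff_left hB0 hBt, ← ENNReal.le_div_iff_mul_le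
    (Or.inl (ENNReal.ofReal_pos.mpr (by positivity)).ne') (Or.inl ENNReal.ofReal_ne_top)] at h1
  refine h1.trans (le_of_eq ?_)
  rw [div_pow, ← mul_div_assoc, ENNReal.ofReal_div_of_pos (by positivity),
    ENNReal.ofReal_mul (by positivity)]
  simp

/-- Lower bound for the probability that a Haar unitary maps one family of vectors close to another
one with almost the same Gram matrix. -/
lemma eventually_le_hit {ι : Type*} [Fintype ι] [DecidableEq ι] {M : Matrix ι ι ℂ}
    (hM : M.PosDef) {τ : ℝ} (hτ : 0 < τ) {e : ι → ℝ} (he : ∀ j, 0 < e j) :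
    ∃ c₀ > 0, ∀ c, 0 < c → c < c₀ → ∃ δ > 0, ∀ᶠ n : ℕ in atTop, ∀ Y Z : ι → Vec n,
      Y ∈ gramNear M n δ → Z ∈ gramNear M n δ →
      ENNReal.ofReal (1 / 2 * ((∏ j, (c * e j) ^ 2) /
        (M.det.re * (1 + τ) ^ Fintype.card ι)) ^ n) ≤ hit Y Z fun j => (1 + τ) * (c * e j) := by
  obtain ⟨C, hC⟩ := exists_factor hM.posSemidef
  have hCdet : C.det ≠ 0 := by
    intro h
    apply hM.det_pos.ne'
    rw [← hC, Matrix.det_mul, h, mul_zero]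
  obtain ⟨e₁, he₁, hel⟩ : ∃ e₁ : ℝ, 0 < e₁ ∧ ∀ j, e₁ ≤ e j := by
    rcases isEmpty_or_nonempty ι with h | h
    · exact ⟨1, one_pos, fun j => h.elim j⟩
    · obtain ⟨j, hj⟩ := Finite.exists_min e
      exact ⟨e j, he j, hj⟩
  set E := 1 + ∑ j, e j with hE
  have hE0 : 0 < E := by
    have := Finset.sum_nonneg fun j (_ : j ∈ Finset.univ) => (he j).le
    linarith
  have heE : ∀ j, e j ≤ E := fun j => by
    have := Finset.single_le_sum (f := e) (fun j _ => (he j).le) (Finset.mem_univ j)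
    linarith
  set r := (Fintype.card ι : ℝ) with hr
  have hr0 : 0 ≤ r := by positivity
  set K := entSum C⁻¹ ^ 2 with hK
  have hK0 : 0 ≤ K := by positivity
  set L := entSum C with hL
  have hL0 : 0 ≤ L := entSum_nonneg C
  set Q := 1 + ∑ j, ‖M j j‖ with hQ
  have hQ0 : 1 ≤ Q := by
    have := Finset.sum_nonneg fun j (_ : j ∈ Finset.univ) => norm_nonneg (M j j)
    linarith
  -- a bound on `c` that absorbs all quadratic terms
  set c₀ := min (min 1 (1 / E)) (min (min (1 / (r * (4 * K * E ^ 2) + 1)) (τ / (4 * K * E ^ 2 + 1)))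
    (τ * e₁ / (L * (r * (5 * K * E ^ 2)) + 1))) with hc₀
  refine ⟨c₀, by positivity, fun c hc hcc => ?_⟩
  have hc1 : c ≤ 1 := hcc.le.trans ((min_le_left _ _).trans (min_le_left _ _))
  have hc2 : c ≤ 1 / E := hcc.le.trans ((min_le_left _ _).trans (min_le_right _ _))
  have hc3 : c ≤ 1 / (r * (4 * K * E ^ 2) + 1) :=
    hcc.le.trans ((min_le_right _ _).trans ((min_le_left _ _).trans (min_le_left _ _)))
  have hc4 : c ≤ τ / (4 * K * E ^ 2 + 1) :=
    hcc.le.trans ((min_le_right _ _).trans ((min_le_left _ _).trans (min_le_right _ _)))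
  have hc5 : c ≤ τ * e₁ / (L * (r * (5 * K * E ^ 2)) + 1) :=
    hcc.le.trans ((min_le_right _ _).trans (min_le_right _ _))
  rw [le_div_iff₀ (by positivity)] at hc2 hc3 hc4 hc5
  -- All Gram errors have size `θ`, quadratic in the radii `c * e j`, whereas the permitted
  -- displacement `τ * (c * e j)` is linear. This is why a small `c` suffices.
  set θ := c ^ 2 * E ^ 2 with hθ
  have hθ0 : 0 < θ := by positivity
  have hcc2 : c ^ 2 ≤ c := by nlinarith
  have hθ1 : θ ≤ 1 := by
    have : θ = (c * E) ^ 2 := by rw [hθ]; ring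
    rw [this]
    exact pow_le_one₀ (by positivity) hc2
  have hd : r * (K * (4 * θ)) < 1 := by
    have h : r * (K * (4 * θ)) ≤ c * (r * (4 * K * E ^ 2)) := by
      calc r * (K * (4 * θ)) = c ^ 2 * (r * (4 * K * E ^ 2)) := by rw [hθ]; ring
        _ ≤ _ := by gcongr
    linarith
  have hd₀ : r * (K * θ) < 1 := by
    refine lt_of_le_of_lt ?_ hd
    gcongr
    linarith
  have hdτ : K * (4 * θ) ≤ τ := by
    have h : K * (4 * θ) ≤ c * (4 * K * E ^ 2) := by
      calc K * (4 * θ) = c ^ 2 * (4 * K * E ^ 2) := by rw [hθ]; ring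
        _ ≤ _ := by gcongr
    linarith
  have hmove : ∀ j, L * (r * (K * θ + K * (4 * θ))) ≤ τ * (c * e j) := by
    intro j
    calc L * (r * (K * θ + K * (4 * θ))) = c * (c * (L * (r * (5 * K * E ^ 2)))) := by
          rw [hθ]; ring
      _ ≤ c * (τ * e₁) := by
          exact mul_le_mul_of_nonneg_left (by linarith) hc.le
      _ ≤ c * (τ * e j) := by gcongr; exact hel j
      _ = _ := by ring
  refine ⟨θ, hθ0, ?_⟩
  filter_upwards [eventually_gt_atTop 0, eventually_ge_atTop ⌈2 * (r ^ 2 * (Q * E / θ) ^ 2)⌉₊]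
    with n hn0 hn Y Z hY hZ
  have hYQ : ∀ i, ‖Y i‖ ≤ Q := by
    intro i
    have h1 := hY i i
    rw [Matrix.gram_apply, inner_self_eq_norm_sq_to_K] at h1
    have h2 : ‖((‖Y i‖ : ℂ)) ^ 2‖ = ‖Y i‖ ^ 2 := by simp
    have h3 : ‖((‖Y i‖ : ℂ)) ^ 2‖ ≤ θ + ‖M i i‖ := by
      have := norm_sub_norm_le ((‖Y i‖ : ℂ) ^ 2) (M i i)
      have h1' : ‖(‖Y i‖ : ℂ) ^ 2 - M i i‖ ≤ θ := h1
      linarith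
    have h4 := Finset.single_le_sum (f := fun j => ‖M j j‖) (fun j _ => norm_nonneg _)
      (Finset.mem_univ i)
    rw [h2] at h3
    have h5 : ‖M i i‖ ≤ ∑ j, ‖M j j‖ := h4
    nlinarith [norm_nonneg (Y i)]
  have key := volume_famBall_le_hit Y (W := rmul C⁻¹ Z) hCdet (d₀ := K * θ) (d := K * (4 * θ))
    (τ := τ) (t := θ) (R := Q) (P := E) (ε := fun j => c * e j) hd₀ hd
    (rmul_inv_mem_nearON hC hCdet hZ) (fun j => by have := he j; positivity)
    (fun j => by have := heE j; have := he j; nlinarith) hmove hθ0 hYQ hn0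
    ((Nat.le_ceil _).trans (Nat.cast_le.mpr hn)) ?_
  · rw [rmul_rmul_inv hCdet, volume_image_rmul, norm_det_factor hC] at key
    set H := hit Y Z fun j => (1 + τ) * (c * e j) with hH
    set D := M.det.re with hD
    have hDpos : 0 < D := by rw [hD, ← norm_det_factor hC]; positivity
    set B := ballVol n ^ Fintype.card ι with hB
    have hB0 : B ≠ 0 := pow_ne_zero _ (ballVol_ne_zero n)
    have hBt : B ≠ ⊤ := ENNReal.pow_ne_top (ballVol_ne_top n)
    have hvol : volume (nearON ι n (K * (4 * θ))) ≤
        ENNReal.ofReal (((1 + τ) ^ Fintype.card ι) ^ n) * B := by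
      refine (volume_nearON_le ι n (by positivity)).trans ?_
      gcongr
    have h1 : ENNReal.ofReal ((∏ j, (c * e j) ^ 2) ^ n) * B ≤
        (2 * H * ENNReal.ofReal ((D * (1 + τ) ^ Fintype.card ι) ^ n)) * B := by
      refine key.trans ?_
      calc 2 * (H * (ENNReal.ofReal (D ^ n) * volume (nearON ι n (K * (4 * θ)))))
          ≤ 2 * (H * (ENNReal.ofReal (D ^ n) *
            (ENNReal.ofReal (((1 + τ) ^ Fintype.card ι) ^ n) * B))) := by gcongr
        _ = _ := by
            rw [mul_pow, ENNReal.ofReal_mul (by positivity)]; ring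
    rw [ENNReal.mul_le_mul_iff_left hB0 hBt] at h1
    have h2 : ENNReal.ofReal ((∏ j, (c * e j) ^ 2) ^ n) ≤
        H * ENNReal.ofReal (2 * (D * (1 + τ) ^ Fintype.card ι) ^ n) := by
      refine h1.trans (le_of_eq ?_)
      rw [ENNReal.ofReal_mul (by positivity), ENNReal.ofReal_ofNat]; ring
    rw [← ENNReal.div_le_iff (ENNReal.ofReal_pos.mpr (by positivity)).ne' ENNReal.ofReal_ne_top,
      ← ENNReal.ofReal_div_of_pos (by positivity)] at h2
    refine le_trans (le_of_eq ?_) h2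
    congr 1
    rw [div_pow]
    field_simp
  · intro Y' ξ hY' hξ hYξ
    -- Four errors of size at most `θ`: that of `Y`, the two cross terms, which near-orthogonality
    -- makes small, and the Gram matrix of the noise.
    have hgr : Y' + ξ ∈ gramNear M n (4 * θ) := by
      intro i j
      have hξn : ∀ j, ‖ξ j‖ ≤ c * E := fun j => by
        have := hξ j
        simp only [Pi.zero_apply, zero_sub, norm_neg] at this
        exact this.trans (by gcongr; exact heE j)
      have h1 : Matrix.gram ℂ (Y' + ξ) i j - M i j = (Matrix.gram ℂ Y i j - M i j) +
          ⟪Y' i, ξ j⟫_ℂ + ⟪ξ i, Y' j⟫_ℂ + ⟪ξ i, ξ j⟫_ℂ := by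
        rw [← hY']
        simp only [Matrix.gram_apply, Pi.add_apply, inner_add_left, inner_add_right]
        ring
      have h2 : ‖⟪ξ i, ξ j⟫_ℂ‖ ≤ θ := by
        refine (norm_gram_apply_le hξn i j).trans (le_of_eq ?_)
        rw [hθ]; ring
      have h3 : ‖⟪ξ i, Y' j⟫_ℂ‖ ≤ θ := by rw [norm_inner_symm]; exact hYξ j i
      rw [h1]
      refine (norm_add_le _ _).trans ?_
      have h4 := norm_add₃_le (a := Matrix.gram ℂ Y i j - M i j) (b := ⟪Y' i, ξ j⟫_ℂ)
        (c := ⟪ξ i, Y' j⟫_ℂ)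
      linarith [hY i j, hYξ i j]
    exact ⟨_, rmul_inv_mem_nearON hC hCdet hgr, rmul_rmul_inv hCdet _⟩

/-! ### Volume of the families with Gram matrix near `q` -/

/-- Adding `η` times the identity gives an invertible factor `C` even when `q` is singular. After
applying `C⁻¹`, the Gram matrix is the identity minus a positive semidefinite matrix plus a small
error, so every vector has squared norm at most `1 + κ`. -/
lemma exists_volume_gramNear_le {ι : Type*} [Fintype ι] [DecidableEq ι] {q : Matrix ι ι ℂ}
    (hq : q.PosSemidef) {η κ : ℝ} (hη : 0 < η) (hκ : 0 < κ) :
    ∃ δ > 0, ∀ δ' ≤ δ, ∀ n : ℕ, volume (gramNear q n δ') ≤ ENNReal.ofReal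
      (((q + (η : ℂ) • (1 : Matrix ι ι ℂ)).det.re * (1 + κ) ^ Fintype.card ι) ^ n) *
        ballVol n ^ Fintype.card ι := by
  set M := q + (η : ℂ) • (1 : Matrix ι ι ℂ) with hMdef
  have hη1 : ((η : ℂ) • (1 : Matrix ι ι ℂ)).PosDef := by
    refine Matrix.PosDef.smul Matrix.PosDef.one ?_
    exact_mod_cast hη
  have hM : M.PosDef := Matrix.PosDef.posSemidef_add hq hη1
  obtain ⟨C, hC⟩ := exists_factor hM.posSemidef
  have hCdet : C.det ≠ 0 := by
    intro h
    apply hM.det_pos.ne'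
    rw [← hC, Matrix.det_mul, h, mul_zero]
  set K := entSum C⁻¹ ^ 2 with hK
  refine ⟨κ / (K + 1), by positivity, fun δ' hδ' n => ?_⟩
  have hsub : gramNear q n δ' ⊆ rmul C '' famBall 0 (fun _ => √(1 + κ)) := by
    intro X hX
    refine ⟨rmul C⁻¹ X, fun j => ?_, rmul_rmul_inv hCdet X⟩
    simp only [Pi.zero_apply, zero_sub, norm_neg]
    refine Real.le_sqrt_of_sq_le ?_
    have h1 : Matrix.gram ℂ (rmul C⁻¹ X) = 1 - C⁻¹ᴴ * ((η : ℂ) • (1 : Matrix ι ι ℂ)) * C⁻¹ +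
        C⁻¹ᴴ * (Matrix.gram ℂ X - q) * C⁻¹ := by
      have h0 : C⁻¹ᴴ * q * C⁻¹ + C⁻¹ᴴ * ((η : ℂ) • (1 : Matrix ι ι ℂ)) * C⁻¹ = 1 := by
        rw [← Matrix.add_mul, ← Matrix.mul_add]
        exact factor_inv hC hCdet
      rw [gram_rmul, Matrix.mul_sub, Matrix.sub_mul, ← sub_eq_of_eq_add h0.symm]
      abel
    have h2 := congrArg Complex.re (congrFun (congrFun h1 j) j)
    have h3 : (Matrix.gram ℂ (rmul C⁻¹ X) j j).re = ‖rmul C⁻¹ X j‖ ^ 2 := by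
      rw [Matrix.gram_apply, inner_self_eq_norm_sq_to_K]
      norm_cast
    rw [h3, Matrix.add_apply, Matrix.sub_apply, Matrix.one_apply_eq, Complex.add_re,
      Complex.sub_re, Complex.one_re] at h2
    have h4 : 0 ≤ ((C⁻¹ᴴ * ((η : ℂ) • (1 : Matrix ι ι ℂ)) * C⁻¹) j j).re := by
      have := (hη1.posSemidef.conjTranspose_mul_mul_same C⁻¹).diag_nonneg (i := j)
      exact (Complex.le_def.mp this).1
    have h5 : ((C⁻¹ᴴ * (Matrix.gram ℂ X - q) * C⁻¹) j j).re ≤ κ := by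
      refine (Complex.re_le_norm _).trans ((norm_conj_mul_le _ _ hX j j).trans ?_)
      calc K * δ' ≤ K * (κ / (K + 1)) := by gcongr
        _ ≤ κ := by
          rw [← mul_div_assoc, div_le_iff₀ (by positivity)]
          nlinarith
    linarith
  refine (measure_mono hsub).trans ?_
  rw [volume_image_rmul, norm_det_factor hC, volume_famBall _ fun _ => Real.sqrt_nonneg _,
    ← mul_assoc, ← ENNReal.ofReal_mul (pow_nonneg (by rw [← norm_det_factor hC]; positivity) _),
    ← mul_pow]
  simp [Real.sq_sqrt (show 0 ≤ 1 + κ by linarith)]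

lemma eventually_le_volume_gramNear {ι : Type*} [Fintype ι] [DecidableEq ι] {q : Matrix ι ι ℂ}
    (hq : q.PosSemidef) {δ : ℝ} (hδ : 0 < δ) :
    ∀ᶠ n : ℕ in atTop, ENNReal.ofReal (q.det.re ^ n) * ballVol n ^ Fintype.card ι ≤
      2 * volume (gramNear q n δ) := by
  obtain ⟨C, hC⟩ := exists_factor hq
  have hpos : 0 < δ / (entSum C ^ 2 + 1) := by positivity
  filter_upwards [eventually_ballVol_le_nearON ι hpos] with n hn
  have hsub : rmul C '' nearON ι n (δ / (entSum C ^ 2 + 1)) ⊆ gramNear q n δ := by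
    rintro _ ⟨W, hW, rfl⟩ i j
    refine (rmul_mem_gramNear hC hW i j).trans ?_
    rw [← mul_div_assoc, div_le_iff₀ (by positivity)]
    nlinarith
  calc ENNReal.ofReal (q.det.re ^ n) * ballVol n ^ Fintype.card ι
      ≤ ENNReal.ofReal (q.det.re ^ n) *
          (2 * volume (nearON ι n (δ / (entSum C ^ 2 + 1)))) := by gcongr
    _ = 2 * volume (rmul C '' nearON ι n (δ / (entSum C ^ 2 + 1))) := by
        rw [volume_image_rmul, norm_det_factor hC]; ring
    _ ≤ _ := by gcongr

/-! ### Grounded sets as rooted subtrees of the Cayley tree -/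

section Tree

variable {S : Type*} [DecidableEq S]

/-- The word length in the free group increases or decreases by one under left multiplication by a
generator, according to whether the generator cancels. -/
lemma toWord_cons_cases (x : S × Bool) (g : FreeGroup S) :
    (FreeGroup.mk [x] * g).toWord = x :: g.toWord ∨
      g.toWord = (x.1, !x.2) :: (FreeGroup.mk [x] * g).toWord := by
  have h : (FreeGroup.mk [x] * g).toWord = FreeGroup.reduce (x :: g.toWord) := by
    conv_lhs => rw [← FreeGroup.mk_toWord (x := g), FreeGroup.mul_mk, FreeGroup.toWord_mk]
    rfl
  rw [h, FreeGroup.reduce.cons, FreeGroup.reduce_toWord]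
  rcases hg : g.toWord with _ | ⟨y, w⟩
  · left; rfl
  · by_cases hxy : x.1 = y.1 ∧ x.2 = !y.2
    · right
      simp only [hxy, and_self, if_true]
      simp
    · left
      simp only [hxy, if_false]

lemma toWord_mk_tail {x : S × Bool} {w : List (S × Bool)} {h : FreeGroup S}
    (hh : h.toWord = x :: w) : (FreeGroup.mk w).toWord = w ∧
      h = FreeGroup.mk [x] * FreeGroup.mk w := by
  have h1 : h = FreeGroup.mk [x] * FreeGroup.mk w := by
    rw [← FreeGroup.mk_toWord (x := h), hh, FreeGroup.mul_mk]; rfl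
  refine ⟨?_, h1⟩
  rw [FreeGroup.toWord_mk]
  have : FreeGroup.IsReduced (x :: w) := hh ▸ FreeGroup.isReduced_toWord
  exact FreeGroup.IsReduced.reduce_eq (List.IsChain.tail this)

/-- A set of group elements that contains the identity and with each nontrivial element the one
obtained by deleting the first letter. -/
def SuffixClosed (F : Finset (FreeGroup S)) : Prop :=
  (1 : FreeGroup S) ∈ F ∧ ∀ (x : S × Bool) (g h : FreeGroup S), h ∈ F →
    h.toWord = x :: g.toWord → g ∈ F

lemma adj_cases {S : Type*} {g h : FreeGroup S} (hadj : (leftCayleyGraph S).Adj g h) :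
    ∃ x : S × Bool, h = FreeGroup.mk [x] * g := by
  rw [leftCayleyGraph, SimpleGraph.fromRel_adj] at hadj
  rcases hadj.2 with ⟨s, hs⟩ | ⟨s, hs⟩
  · exact ⟨(s, true), hs⟩
  · refine ⟨(s, false), ?_⟩
    have : FreeGroup.mk [(s, false)] = (FreeGroup.of s)⁻¹ := by
      simp [FreeGroup.of, FreeGroup.inv_mk, FreeGroup.invRev]
    rw [this, hs, inv_mul_cancel_left]

/-- The words with suffix `h` form a branch of the tree. A path in `F` from `h` to the identity must
leave it, and the only exit is the edge deleting the first letter of `h`. -/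
lemma IsGrounded.suffixClosed {F : Finset (FreeGroup S)} (hF : IsGrounded F) :
    SuffixClosed F := by
  refine ⟨hF.1, fun x g h hh hw => ?_⟩
  obtain ⟨p⟩ := hF.2.preconnected ⟨h, hh⟩ ⟨1, hF.1⟩
  obtain ⟨d, -, hd1, hd2⟩ := p.exists_boundary_dart {g' | h.toWord <:+ g'.1.toWord}
    (List.suffix_refl _) (by
      intro h1
      have h1' : h.toWord <:+ (1 : FreeGroup S).toWord := h1
      rw [FreeGroup.toWord_one, List.suffix_nil, hw] at h1'
      exact List.cons_ne_nil _ _ h1')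
  have hadj : (leftCayleyGraph S).Adj d.fst.1 d.snd.1 := d.adj
  obtain ⟨y, hy⟩ := adj_cases hadj
  have hd1' : h.toWord <:+ d.fst.1.toWord := hd1
  have hd2' : ¬ h.toWord <:+ d.snd.1.toWord := hd2
  rcases toWord_cons_cases y d.fst.1 with h1 | h1
  · rw [← hy] at h1
    exact (hd2' (h1 ▸ hd1'.trans (List.suffix_cons _ _))).elim
  · rw [← hy] at h1
    rw [h1, List.suffix_cons_iff] at hd1'
    rcases hd1' with h2 | h2
    · rw [hw] at h2
      have : g = d.snd.1 := FreeGroup.toWord_injective (List.cons_inj_right _ |>.mp (by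
        rw [h2, (List.cons.inj h2).1]))
      rw [this]
      exact d.snd.2
    · exact (hd2' h2).elim

/-- The farther end of the edge from `s⁻¹ * h` to `h`. -/
def farEnd (s : S) (h : FreeGroup S) : FreeGroup S :=
  if ((FreeGroup.of s)⁻¹ * h).norm < h.norm then h else (FreeGroup.of s)⁻¹ * h

lemma edge_cases (s : S) (h : FreeGroup S) :
    (h.toWord = (s, true) :: ((FreeGroup.of s)⁻¹ * h).toWord ∧ farEnd s h = h ∧
      h.norm = ((FreeGroup.of s)⁻¹ * h).norm + 1) ∨
    (((FreeGroup.of s)⁻¹ * h).toWord = (s, false) :: h.toWord ∧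
      farEnd s h = (FreeGroup.of s)⁻¹ * h ∧
      ((FreeGroup.of s)⁻¹ * h).norm = h.norm + 1) := by
  have := toWord_cons_cases (s, true) ((FreeGroup.of s)⁻¹ * h)
  have h1 : FreeGroup.mk [(s, true)] * ((FreeGroup.of s)⁻¹ * h) = h := mul_inv_cancel_left _ _
  rw [h1] at this
  rcases this with h2 | h2
  · left
    have h3 : h.norm = ((FreeGroup.of s)⁻¹ * h).norm + 1 := by
      simp only [FreeGroup.norm]; rw [h2]; rfl
    exact ⟨h2, if_pos (by omega), h3⟩
  · right
    have h3 : ((FreeGroup.of s)⁻¹ * h).norm = h.norm + 1 := by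
      simp only [FreeGroup.norm]; rw [h2]; rfl
    exact ⟨h2, if_neg (by omega), h3⟩

lemma mem_edge {F : Finset (FreeGroup S)} {s : S} {h : FreeGroup S} :
    h ∈ F ∩ (FreeGroup.of s • F) ↔ h ∈ F ∧ (FreeGroup.of s)⁻¹ * h ∈ F := by
  rw [Finset.mem_inter, ← Finset.inv_smul_mem_iff, smul_eq_mul]

/-- Each nontrivial element is the far end of exactly one edge, the one deleting its first letter.
An edge is encoded by its generator `s` and its head `h`, with tail `s⁻¹ * h`. -/
lemma prod_edges [Fintype S] {F : Finset (FreeGroup S)} (hF : SuffixClosed F) {M : Type*}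
    [CommMonoid M] (β : FreeGroup S → M) :
    ∏ h ∈ F, β h = β 1 * ∏ s : S, ∏ h ∈ F ∩ (FreeGroup.of s • F), β (farEnd s h) := by
  rw [← Finset.mul_prod_erase F β hF.1, Finset.prod_sigma']
  congr 1
  symm
  refine Finset.prod_bij (fun p _ => farEnd p.1 p.2) ?_ ?_ ?_ (fun _ _ => rfl)
  · rintro ⟨s, h⟩ hp
    rw [Finset.mem_sigma, mem_edge] at hp
    rw [Finset.mem_erase]
    rcases edge_cases s h with ⟨h1, h2, -⟩ | ⟨h1, h2, -⟩
    · simp only [h2]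
      exact ⟨fun h3 => by rw [h3, FreeGroup.toWord_one] at h1; exact List.cons_ne_nil _ _ h1.symm,
        hp.2.1⟩
    · simp only [h2]
      exact ⟨fun h3 => by rw [h3, FreeGroup.toWord_one] at h1; exact List.cons_ne_nil _ _ h1.symm,
        hp.2.2⟩
  · rintro ⟨s, h⟩ - ⟨s', h'⟩ - heq
    simp only at heq
    rcases edge_cases s h with ⟨h1, h2, -⟩ | ⟨h1, h2, -⟩ <;>
    rcases edge_cases s' h' with ⟨h1', h2', -⟩ | ⟨h1', h2', -⟩ <;>
    rw [h2, h2'] at heq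
    · rw [heq, h1'] at h1
      have := (List.cons.inj h1).1
      simp only [Prod.mk.injEq, and_true] at this
      rw [this, heq]
    · rw [heq, h1'] at h1
      have := (List.cons.inj h1).1
      simp at this
    · rw [heq, h1'] at h1
      have := (List.cons.inj h1).1
      simp at this
    · have h3 := h1
      rw [heq, h1'] at h3
      have := (List.cons.inj h3).1
      simp only [Prod.mk.injEq, and_true] at this
      subst this
      rw [mul_left_cancel heq]
  · intro c hc
    obtain ⟨hc1, hcF⟩ := Finset.mem_erase.mp hc
    rcases hw : c.toWord with _ | ⟨⟨s, b⟩, w⟩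
    · exact (hc1 (FreeGroup.toWord_eq_nil_iff.mp hw)).elim
    obtain ⟨hw1, hw2⟩ := toWord_mk_tail hw
    have hmem : FreeGroup.mk w ∈ F := hF.2 (s, b) _ c hcF (by rw [hw, hw1])
    cases b
    · have hc2 : (FreeGroup.of s)⁻¹ * FreeGroup.mk w = c := by
        rw [hw2]
        congr 1
      refine ⟨⟨s, FreeGroup.mk w⟩, ?_, ?_⟩
      · rw [Finset.mem_sigma, mem_edge, hc2]
        exact ⟨Finset.mem_univ _, hmem, hcF⟩
      · rcases edge_cases s (FreeGroup.mk w) with ⟨h1, -, -⟩ | ⟨-, h2, -⟩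
        · rw [hc2, hw, hw1] at h1
          have := congrArg List.length h1
          simp at this
          omega
        · rw [h2, hc2]
    · have hc2 : (FreeGroup.of s)⁻¹ * c = FreeGroup.mk w := by
        rw [hw2]
        exact inv_mul_cancel_left _ _
      refine ⟨⟨s, c⟩, ?_, ?_⟩
      · rw [Finset.mem_sigma, mem_edge, hc2]
        exact ⟨Finset.mem_univ _, hcF, hmem⟩
      · rcases edge_cases s c with ⟨-, h2, -⟩ | ⟨h1, -, -⟩
        · exact h2
        · rw [hc2, hw, hw1] at h1
          have := congrArg List.length h1
          simp at this
          omega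

/-- A longest word is a leaf. -/
lemma SuffixClosed.erase {F : Finset (FreeGroup S)} (hF : SuffixClosed F) {h : FreeGroup S}
    (h1 : h ≠ 1) (hmax : ∀ g ∈ F, g.norm ≤ h.norm) : SuffixClosed (F.erase h) := by
  refine ⟨Finset.mem_erase.mpr ⟨h1.symm, hF.1⟩, fun x g g' hg' hw => ?_⟩
  rw [Finset.mem_erase] at hg' ⊢
  refine ⟨fun hgh => ?_, hF.2 x g g' hg'.2 hw⟩
  have h2 := hmax g' hg'.2
  have h3 : g'.norm = g.norm + 1 := by simp only [FreeGroup.norm]; rw [hw]; rfl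
  rw [hgh] at h3
  omega

end Tree

/-! ### Restrictions of `q` to edges -/

section Edges

variable {S : Type*} [DecidableEq S] {F : Finset (FreeGroup S)} {k : ℕ}

/-- The index of the head of an edge. -/
def headIdx (F : Finset (FreeGroup S)) (k : ℕ) (s : S)
    (p : (F ∩ (FreeGroup.of s • F) : Finset (FreeGroup S)) × Fin k) : F × Fin k :=
  (⟨p.1.1, (mem_edge.mp p.1.2).1⟩, p.2)

/-- The index of the tail of an edge. -/
def tailIdx (F : Finset (FreeGroup S)) (k : ℕ) (s : S)
    (p : (F ∩ (FreeGroup.of s • F) : Finset (FreeGroup S)) × Fin k) : F × Fin k :=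
  (⟨(FreeGroup.of s)⁻¹ * p.1.1, (mem_edge.mp p.1.2).2⟩, p.2)

lemma headIdx_injective (s : S) : Function.Injective (headIdx F k s) := by
  rintro ⟨⟨a, ha⟩, i⟩ ⟨⟨b, hb⟩, j⟩ h
  simp only [headIdx, Prod.mk.injEq, Subtype.mk.injEq] at h
  obtain ⟨rfl, rfl⟩ := h
  rfl

lemma tailIdx_injective (s : S) : Function.Injective (tailIdx F k s) := by
  rintro ⟨⟨a, ha⟩, i⟩ ⟨⟨b, hb⟩, j⟩ h
  simp only [tailIdx, Prod.mk.injEq, Subtype.mk.injEq, mul_right_inj] at h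
  obtain ⟨rfl, rfl⟩ := h
  rfl

/-- Left translation by `s` does not change `g⁻¹ * h`. Heads and tails therefore prescribe the same
Gram matrix, as is needed for a unitary to carry one to the other. -/
lemma submatrix_tailIdx {q : BlockMatrix F k} (hq : q ∈ partialPD F k) (s : S) :
    q.submatrix (tailIdx F k s) (tailIdx F k s) = q.submatrix (headIdx F k s) (headIdx F k s) := by
  ext ⟨a, i⟩ ⟨b, j⟩
  have := hq.2.2 ⟨(FreeGroup.of s)⁻¹ * a.1, (mem_edge.mp a.2).2⟩
    ⟨(FreeGroup.of s)⁻¹ * b.1, (mem_edge.mp b.2).2⟩ ⟨a.1, (mem_edge.mp a.2).1⟩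
    ⟨b.1, (mem_edge.mp b.2).1⟩ (by group)
  exact congrFun (congrFun this i) j

lemma blockSubmatrix_mem_partialPD {S : Type*} {k : ℕ} {E F : Finset (FreeGroup S)}
    (hE : E ⊆ F) {q : BlockMatrix F k} (hq : q ∈ partialPD F k) :
    blockSubmatrix hE q ∈ partialPD E k :=
  ⟨hq.1.submatrix _, fun g => hq.2.1 ⟨g, hE g.2⟩, fun g₁ h₁ g₂ h₂ h =>
    hq.2.2 ⟨g₁, hE g₁.2⟩ ⟨h₁, hE h₁.2⟩ ⟨g₂, hE g₂.2⟩ ⟨h₂, hE h₂.2⟩ h⟩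

/-- A singular partial positive definite function is singular on a smaller grounded set on which
all its restrictions to the sets of edges are nonsingular. -/
lemma exists_minimal_singular (hF : SuffixClosed F) {q : BlockMatrix F k}
    (hq : q ∈ partialPD F k) (hdet : q.det = 0) :
    ∃ (E : Finset (FreeGroup S)) (hE : E ⊆ F), SuffixClosed E ∧ (blockSubmatrix hE q).det = 0 ∧
      ∀ s : S, ((blockSubmatrix hE q).submatrix (headIdx E k s) (headIdx E k s)).det ≠ 0 := by
  induction hn : F.card using Nat.strong_induction_on generalizing F with
  | _ n ih =>
  -- Prune a longest word `h`. If the pruned matrix is nonsingular, so is every edge restriction: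
  -- for each `s` the element `h` is missing from the heads or from the tails, and the two give
  -- equal matrices.
  obtain ⟨h, hhF, hmax⟩ := F.exists_max_image FreeGroup.norm ⟨1, hF.1⟩
  have h1 : h ≠ 1 := by
    rintro rfl
    have hall : ∀ g ∈ F, g = 1 := fun g hg => by
      have := hmax g hg
      rw [FreeGroup.norm_one, Nat.le_zero, FreeGroup.norm_eq_zero] at this
      exact this
    have : q = 1 := by
      ext ⟨⟨a, ha⟩, i⟩ ⟨⟨b, hb⟩, j⟩
      obtain rfl := hall a ha
      obtain rfl := hall b hb
      have := congrFun (congrFun (hq.2.1 ⟨1, ha⟩) i) j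
      refine Eq.trans this ?_
      simp [Matrix.one_apply]
    rw [this, Matrix.det_one] at hdet
    exact one_ne_zero hdet
  have hsub : F.erase h ⊆ F := Finset.erase_subset _ _
  by_cases hd : (blockSubmatrix hsub q).det = 0
  · obtain ⟨E, hE, h2, h3, h4⟩ := ih _ (hn ▸ Finset.card_erase_lt_of_mem hhF) (hF.erase h1 hmax)
      (blockSubmatrix_mem_partialPD hsub hq) hd rfl
    exact ⟨E, hE.trans hsub, h2, h3, h4⟩
  · refine ⟨F, subset_rfl, hF, hdet, fun s => ?_⟩
    have hpd : (blockSubmatrix hsub q).PosDef :=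
      (blockSubmatrix_mem_partialPD hsub hq).1.posDef_iff_det_ne_zero.mpr hd
    change (q.submatrix (headIdx F k s) (headIdx F k s)).det ≠ 0
    have key : ∀ f : (F ∩ (FreeGroup.of s • F) : Finset (FreeGroup S)) × Fin k → F × Fin k,
        Function.Injective f → (∀ p, (f p).1.1 ≠ h) → (q.submatrix f f).det ≠ 0 := by
      intro f hf hfh
      have : q.submatrix f f = (blockSubmatrix hsub q).submatrix
          (fun p => (⟨(f p).1.1, Finset.mem_erase.mpr ⟨hfh p, (f p).1.2⟩⟩, (f p).2))
          (fun p => (⟨(f p).1.1, Finset.mem_erase.mpr ⟨hfh p, (f p).1.2⟩⟩, (f p).2)) := rfl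
      rw [this]
      refine (hpd.submatrix fun a b hab => hf ?_).det_pos.ne'
      simp only [Prod.mk.injEq, Subtype.mk.injEq] at hab
      exact Prod.ext (Subtype.ext hab.1) hab.2
    by_cases hs : (FreeGroup.of s)⁻¹ * h ∈ F
    · rw [← submatrix_tailIdx hq]
      refine key _ (tailIdx_injective s) fun p hp => ?_
      simp only [tailIdx] at hp
      have e1 : h.toWord = (s, true) :: ((FreeGroup.of s)⁻¹ * h).toWord := by
        rcases edge_cases s h with h2 | h2
        · exact h2.1
        · have := hmax _ hs; omega
      rcases edge_cases s p.1.1 with h2 | h2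
      · have := hmax _ (mem_edge.mp p.1.2).1
        rw [hp] at h2
        omega
      · rw [hp, e1] at h2
        simp at h2
    · refine key _ (headIdx_injective s) fun p hp => hs ?_
      rw [← hp]
      exact (mem_edge.mp p.1.2).2

end Edges

/-! ### The orbit family and its Gram matrix -/

section Orbit

variable {S : Type*} {n k : ℕ}

/-- The image of the `i`-th column of `V` under a group element. -/
def orbitVec (V : Matrix (Fin n) (Fin k) ℂ) (u : S → Matrix.unitaryGroup (Fin n) ℂ)
    (g : FreeGroup S) (i : Fin k) : Vec n :=
  uact (freeRep u g) (WithLp.toLp 2 fun a => V a i)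

lemma orbitVec_one (V : Matrix (Fin n) (Fin k) ℂ) (u : S → Matrix.unitaryGroup (Fin n) ℂ)
    (i : Fin k) : orbitVec V u 1 i = WithLp.toLp 2 fun a => V a i := by
  rw [orbitVec, map_one, uact_one]

lemma uact_orbitVec (V : Matrix (Fin n) (Fin k) ℂ) (u : S → Matrix.unitaryGroup (Fin n) ℂ)
    (s : S) (g : FreeGroup S) (i : Fin k) :
    uact (u s) (orbitVec V u g i) = orbitVec V u (FreeGroup.of s * g) i := by
  rw [orbitVec, orbitVec, map_mul, uact_mul]
  simp [freeRep]

/-- The family of vectors `π(g) V eᵢ`, for `g ∈ F`. -/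
def orbitFam (V : Matrix (Fin n) (Fin k) ℂ) (F : Finset (FreeGroup S))
    (u : S → Matrix.unitaryGroup (Fin n) ℂ) : F × Fin k → Vec n :=
  fun p => orbitVec V u p.1 p.2

lemma gramMatrix_eq_gram (V : Matrix (Fin n) (Fin k) ℂ) (F : Finset (FreeGroup S))
    (u : S → Matrix.unitaryGroup (Fin n) ℂ) :
    gramMatrix V F u = Matrix.gram ℂ (orbitFam V F u) := by
  ext ⟨g, i⟩ ⟨h, j⟩
  have h1 : (freeRep u ((g : FreeGroup S)⁻¹ * h) : Matrix (Fin n) (Fin n) ℂ) =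
      (freeRep u g : Matrix (Fin n) (Fin n) ℂ)ᴴ * (freeRep u h : Matrix (Fin n) (Fin n) ℂ) := by
    rw [map_mul, map_inv]; rfl
  have h2 : compress V u ((g : FreeGroup S)⁻¹ * h) =
      ((freeRep u g : Matrix (Fin n) (Fin n) ℂ) * V)ᴴ *
        ((freeRep u h : Matrix (Fin n) (Fin n) ℂ) * V) := by
    rw [compress, h1, Matrix.conjTranspose_mul]; simp only [Matrix.mul_assoc]
  change compress V u _ i j = _
  rw [h2, Matrix.gram_apply, Matrix.mul_apply, PiLp.inner_apply]
  refine Finset.sum_congr rfl fun a _ => ?_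
  rw [Matrix.conjTranspose_apply, RCLike.inner_apply, mul_comm]
  rfl

lemma gram_column (V : Matrix (Fin n) (Fin k) ℂ) :
    Matrix.gram ℂ (fun i => (WithLp.toLp 2 fun a => V a i : Vec n)) = Vᴴ * V := by
  ext i j
  rw [Matrix.gram_apply, Matrix.mul_apply, PiLp.inner_apply]
  refine Finset.sum_congr rfl fun a _ => ?_
  rw [Matrix.conjTranspose_apply, RCLike.inner_apply, mul_comm]
  rfl

lemma norm_orbitVec {V : Matrix (Fin n) (Fin k) ℂ} (hV : Vᴴ * V = 1)
    (u : S → Matrix.unitaryGroup (Fin n) ℂ) (g : FreeGroup S) (i : Fin k) :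
    ‖orbitVec V u g i‖ = 1 := by
  rw [orbitVec, norm_uact]
  have h := congrFun (congrFun (gram_column V) i) i
  rw [hV, Matrix.gram_apply, inner_self_eq_norm_sq_to_K, Matrix.one_apply_eq] at h
  have h2 : ‖(WithLp.toLp 2 fun a => V a i : Vec n)‖ ^ 2 = 1 := by
    have h' : ((‖(WithLp.toLp 2 fun a => V a i : Vec n)‖ : ℝ) : ℂ) ^ 2 = 1 := h
    exact_mod_cast h'
  exact (pow_eq_one_iff_of_nonneg (norm_nonneg _) two_ne_zero).mp h2

lemma continuous_freeRep (g : FreeGroup S) :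
    Continuous fun u : S → Matrix.unitaryGroup (Fin n) ℂ => freeRep u g := by
  induction g using FreeGroup.induction_on with
  | C1 => simp only [map_one]; exact continuous_const
  | of s => simpa [freeRep] using continuous_apply s
  | inv_of s _ =>
    have : Continuous fun u : S → Matrix.unitaryGroup (Fin n) ℂ => (u s)⁻¹ :=
      continuous_inv.comp (continuous_apply s)
    simpa [freeRep] using this
  | mul x y hx hy => simp only [map_mul]; exact hx.mul hy

lemma continuous_orbitFam (V : Matrix (Fin n) (Fin k) ℂ) (F : Finset (FreeGroup S)) :
    Continuous fun u : S → Matrix.unitaryGroup (Fin n) ℂ => orbitFam V F u := by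
  refine continuous_pi fun p => ?_
  exact (continuous_uact (n := n)).comp
    (f := fun u => (freeRep u p.1.1, (WithLp.toLp 2 fun a => V a p.2 : Vec n)))
    ((continuous_freeRep p.1.1).prodMk continuous_const)

lemma continuous_gramMatrix (V : Matrix (Fin n) (Fin k) ℂ) (F : Finset (FreeGroup S)) :
    Continuous fun u : S → Matrix.unitaryGroup (Fin n) ℂ => gramMatrix V F u := by
  simp_rw [gramMatrix_eq_gram]
  refine continuous_matrix fun i j => ?_
  simp only [Matrix.gram_apply]
  have h := continuous_orbitFam V F
  exact ((continuous_apply i).comp h).inner ((continuous_apply j).comp h)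

lemma gramMatrix_mem_partialPD {V : Matrix (Fin n) (Fin k) ℂ} (hV : Vᴴ * V = 1)
    (F : Finset (FreeGroup S)) (u : S → Matrix.unitaryGroup (Fin n) ℂ) :
    gramMatrix V F u ∈ partialPD F k := by
  refine ⟨gramMatrix_eq_gram V F u ▸ Matrix.posSemidef_gram ℂ _, fun g => ?_,
    fun g₁ h₁ g₂ h₂ h => ?_⟩
  · have h1 : compress V u 1 = 1 := by
      rw [compress, map_one, Matrix.UnitaryGroup.one_val, Matrix.mul_one, hV]
    ext i j
    change compress V u ((g : FreeGroup S)⁻¹ * g) i j = _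
    rw [inv_mul_cancel, h1]
  · ext i j
    change compress V u _ i j = compress V u _ i j
    rw [h]

end Orbit

/-! ### Double counting between generators and families -/

section Core

variable {S : Type*} [DecidableEq S] {n k : ℕ} {F : Finset (FreeGroup S)}

lemma generatorLaw_edges {S : Type*} [Fintype S] {n : ℕ} {ι : S → Type*}
    (Y Z : (s : S) → ι s → Vec n) (ε : (s : S) → ι s → ℝ) :
    generatorLaw S n {u | ∀ s p, ‖uact (u s) (Y s p) - Z s p‖ ≤ ε s p} =
      ∏ s, hit (Y s) (Z s) (ε s) := by
  simp only [hit]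
  rw [← Measure.pi_pi]
  congr 1
  ext u
  simp

/-- The radius at a group element: it grows geometrically with the word length. -/
def radius (c τ : ℝ) (g : FreeGroup S) : ℝ := c * τ⁻¹ ^ g.norm

lemma radius_pos {S : Type*} [DecidableEq S] {c τ : ℝ} (hc : 0 < c) (hτ : 0 < τ)
    (g : FreeGroup S) : 0 < radius c τ g := by
  unfold radius; positivity

lemma radius_succ {S : Type*} [DecidableEq S] {c τ : ℝ} (hτ : 0 < τ) {g h : FreeGroup S}
    (hgh : h.norm = g.norm + 1) :
    radius c τ g = τ * radius c τ h := by
  rw [radius, radius, hgh, pow_succ]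
  field_simp

/-- The radius of an edge. -/
def edgeRadius (c τ : ℝ) (F : Finset (FreeGroup S)) (k : ℕ) (s : S)
    (p : (F ∩ (FreeGroup.of s • F) : Finset (FreeGroup S)) × Fin k) : ℝ :=
  radius c τ (farEnd s p.1.1)

/-- The near end of an edge has `τ` times the radius of the far end, so the two errors add up to `1
+ τ` far-end radii. -/
lemma edge_of_close (V : Matrix (Fin n) (Fin k) ℂ) {u : S → Matrix.unitaryGroup (Fin n) ℂ}
    {c τ : ℝ} (hτ : 0 < τ) {X : F × Fin k → Vec n}
    (hX : ∀ p, ‖orbitFam V F u p - X p‖ ≤ radius c τ p.1.1) (s : S)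
    (p : (F ∩ (FreeGroup.of s • F) : Finset (FreeGroup S)) × Fin k) :
    ‖uact (u s) (X (tailIdx F k s p)) - X (headIdx F k s p)‖ ≤
      (1 + τ) * edgeRadius c τ F k s p := by
  have h1 := hX (tailIdx F k s p)
  have h2 := hX (headIdx F k s p)
  have h3 : uact (u s) (orbitFam V F u (tailIdx F k s p)) = orbitFam V F u (headIdx F k s p) := by
    simp only [orbitFam, tailIdx, headIdx, uact_orbitVec, mul_inv_cancel_left]
  have h4 : uact (u s) (X (tailIdx F k s p)) - X (headIdx F k s p) =
      (orbitFam V F u (headIdx F k s p) - X (headIdx F k s p)) -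
        uact (u s) (orbitFam V F u (tailIdx F k s p) - X (tailIdx F k s p)) := by
    rw [map_sub, h3]; abel
  rw [h4]
  refine (norm_sub_le _ _).trans ?_
  rw [norm_uact]
  simp only [headIdx, tailIdx] at h1 h2 ⊢
  rcases edge_cases s p.1.1 with ⟨-, e1, e2⟩ | ⟨-, e1, e2⟩
  · rw [edgeRadius, e1]
    rw [radius_succ hτ e2] at h1
    linarith
  · rw [edgeRadius, e1]
    rw [radius_succ hτ e2] at h2
    linarith

/-- Errors accumulate along the path from the identity, but the radii grow by the factor `τ⁻¹`, so
the inherited error is at most `(1 + 2 * τ) * τ ≤ 2 * τ` radii; this is where `τ ≤ 1 / 2` enters. -/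
lemma close_of_edge (hF : SuffixClosed F) (V : Matrix (Fin n) (Fin k) ℂ)
    {u : S → Matrix.unitaryGroup (Fin n) ℂ} {c τ : ℝ} (hc : 0 < c) (hτ : 0 < τ) (hτ2 : τ ≤ 1 / 2)
    {X : F × Fin k → Vec n}
    (h1 : ∀ i, ‖(WithLp.toLp 2 fun a => V a i : Vec n) - X (⟨1, hF.1⟩, i)‖ ≤
      radius c τ (1 : FreeGroup S))
    (hX : ∀ s p, ‖uact (u s) (X (tailIdx F k s p)) - X (headIdx F k s p)‖ ≤
      edgeRadius c τ F k s p) (p : F × Fin k) :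
    ‖orbitFam V F u p - X p‖ ≤ (1 + 2 * τ) * radius c τ p.1.1 := by
  obtain ⟨⟨g, hg⟩, i⟩ := p
  induction hN : g.norm generalizing g with
  | zero =>
    obtain rfl := FreeGroup.norm_eq_zero.mp hN
    have := h1 i
    rw [orbitFam, orbitVec_one]
    have hr := radius_pos hc hτ (1 : FreeGroup S)
    refine this.trans ?_
    simp only
    nlinarith
  | succ N ih =>
    rcases hw : g.toWord with _ | ⟨⟨s, b⟩, w⟩
    · rw [FreeGroup.norm, hw] at hN; simp at hN
    obtain ⟨hw1, hw2⟩ := toWord_mk_tail hw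
    have hmem : FreeGroup.mk w ∈ F := hF.2 (s, b) _ g hg (by rw [hw, hw1])
    have hnorm : g.norm = (FreeGroup.mk w).norm + 1 := by
      simp only [FreeGroup.norm, hw, hw1, List.length_cons]
    have hI := ih (FreeGroup.mk w) hmem (by omega)
    simp only at hI ⊢
    rw [radius_succ hτ hnorm] at hI
    have hr := radius_pos hc hτ g
    suffices h : ‖orbitFam V F u (⟨g, hg⟩, i) - X (⟨g, hg⟩, i)‖ ≤
        ‖orbitFam V F u (⟨FreeGroup.mk w, hmem⟩, i) - X (⟨FreeGroup.mk w, hmem⟩, i)‖ +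
          radius c τ g by
      refine h.trans ?_
      have : (1 + 2 * τ) * (τ * radius c τ g) ≤ 2 * τ * radius c τ g := by nlinarith [mul_pos hτ hr]
      linarith
    cases b
    · have hc2 : (FreeGroup.of s)⁻¹ * FreeGroup.mk w = g := by
        rw [hw2]
        congr 1
      have hE : FreeGroup.mk w ∈ F ∩ (FreeGroup.of s • F) := by
        rw [mem_edge, hc2]; exact ⟨hmem, hg⟩
      have h2 := hX s (⟨FreeGroup.mk w, hE⟩, i)
      have ht : tailIdx F k s (⟨FreeGroup.mk w, hE⟩, i) = (⟨g, hg⟩, i) := by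
        simp only [tailIdx, hc2]
      have hh : headIdx F k s (⟨FreeGroup.mk w, hE⟩, i) = (⟨FreeGroup.mk w, hmem⟩, i) := rfl
      have hfar : edgeRadius c τ F k s (⟨FreeGroup.mk w, hE⟩, i) = radius c τ g := by
        rw [edgeRadius]
        rcases edge_cases s (FreeGroup.mk w) with ⟨-, -, e3⟩ | ⟨-, e2, -⟩
        · rw [hc2] at e3; omega
        · simp only [e2, hc2]
      rw [ht, hh, hfar] at h2
      have h3 : uact (u s) (orbitFam V F u (⟨g, hg⟩, i)) =
          orbitFam V F u (⟨FreeGroup.mk w, hmem⟩, i) := by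
        simp only [orbitFam, uact_orbitVec]
        rw [← hc2, mul_inv_cancel_left]
      rw [← norm_uact (u s), map_sub, h3]
      have h4 : orbitFam V F u (⟨FreeGroup.mk w, hmem⟩, i) - uact (u s) (X (⟨g, hg⟩, i)) =
          (orbitFam V F u (⟨FreeGroup.mk w, hmem⟩, i) - X (⟨FreeGroup.mk w, hmem⟩, i)) -
          (uact (u s) (X (⟨g, hg⟩, i)) - X (⟨FreeGroup.mk w, hmem⟩, i)) := by abel
      rw [h4]
      exact (norm_sub_le _ _).trans (by linarith)
    · have hc2 : (FreeGroup.of s)⁻¹ * g = FreeGroup.mk w := by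
        rw [hw2]
        exact inv_mul_cancel_left _ _
      have hE : g ∈ F ∩ (FreeGroup.of s • F) := by
        rw [mem_edge, hc2]; exact ⟨hg, hmem⟩
      have h2 := hX s (⟨g, hE⟩, i)
      have ht : tailIdx F k s (⟨g, hE⟩, i) = (⟨FreeGroup.mk w, hmem⟩, i) := by
        simp only [tailIdx, hc2]
      have hh : headIdx F k s (⟨g, hE⟩, i) = (⟨g, hg⟩, i) := rfl
      have hfar : edgeRadius c τ F k s (⟨g, hE⟩, i) = radius c τ g := by
        rw [edgeRadius]
        rcases edge_cases s g with ⟨-, e2, -⟩ | ⟨-, -, e3⟩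
        · simp only [e2]
        · rw [hc2] at e3; omega
      rw [ht, hh, hfar] at h2
      have h3 : uact (u s) (orbitFam V F u (⟨FreeGroup.mk w, hmem⟩, i)) =
          orbitFam V F u (⟨g, hg⟩, i) := by
        simp only [orbitFam, uact_orbitVec]
        rw [← hc2, mul_inv_cancel_left]
      have h4 : orbitFam V F u (⟨g, hg⟩, i) - X (⟨g, hg⟩, i) =
          uact (u s) (orbitFam V F u (⟨FreeGroup.mk w, hmem⟩, i) - X (⟨FreeGroup.mk w, hmem⟩, i)) +
          (uact (u s) (X (⟨FreeGroup.mk w, hmem⟩, i)) - X (⟨g, hg⟩, i)) := by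
        rw [map_sub, h3]; abel
      rw [h4]
      refine (norm_add_le _ _).trans ?_
      rw [norm_uact]
      linarith

/-- The columns of a matrix as vectors. -/
def colVec (V : Matrix (Fin n) (Fin k) ℂ) (i : Fin k) : Vec n := WithLp.toLp 2 fun a => V a i

/-- The block at the identity of a family. -/
def baseFam {ι : Type*} (h : ι) (X : ι × Fin k → Vec n) (i : Fin k) : Vec n := X (h, i)

lemma measurePreserving_family {ι : Type*} [Fintype ι] (U : Matrix.unitaryGroup (Fin n) ℂ) :
    MeasurePreserving (fun (X : ι → Vec n) p => uact U (X p)) volume volume :=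
  volume_preserving_pi fun _ => measurePreserving_isometry (uact U)

lemma gramNear_uact {ι : Type*} (q : Matrix ι ι ℂ) (δ : ℝ) (U : Matrix.unitaryGroup (Fin n) ℂ)
    (X : ι → Vec n) : (fun p => uact U (X p)) ∈ gramNear q n δ ↔ X ∈ gramNear q n δ := by
  simp only [gramNear, Matrix.gram_apply, Set.mem_ofPred_eq, inner_uact]

/-- The families with Gram matrix close to `q` and with base close to given vectors. -/
def pinned {ι : Type*} (q : Matrix (ι × Fin k) (ι × Fin k) ℂ) (δ : ℝ) (h : ι) (Y : Fin k → Vec n)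
    (ρ : Fin k → ℝ) : Set (ι × Fin k → Vec n) :=
  {X ∈ gramNear q n δ | ∀ i, ‖Y i - baseFam h X i‖ ≤ ρ i}

lemma isClosed_pinned {ι : Type*} [Fintype ι] (q : Matrix (ι × Fin k) (ι × Fin k) ℂ) (δ : ℝ) (h : ι)
    (Y : Fin k → Vec n) (ρ : Fin k → ℝ) : IsClosed (pinned q δ h Y ρ) := by
  refine (isClosed_gramNear q n δ).inter ?_
  change IsClosed {X : ι × Fin k → Vec n | ∀ i, ‖Y i - X (h, i)‖ ≤ ρ i}
  simp only [Set.ofPred_forall]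
  refine isClosed_iInter fun i => isClosed_le ?_ continuous_const
  exact (continuous_const.sub (continuous_apply _)).norm

lemma isClosed_pinnedRel {ι : Type*} [Fintype ι] (q : Matrix (ι × Fin k) (ι × Fin k) ℂ) (δ : ℝ)
    (h : ι) (Y : Fin k → Vec n) (ρ : Fin k → ℝ) :
    IsClosed {p : Matrix.unitaryGroup (Fin n) ℂ × (ι × Fin k → Vec n) |
      p.2 ∈ pinned q δ h (fun i => uact p.1 (Y i)) ρ} := by
  refine ((isClosed_gramNear q n δ).preimage continuous_snd).inter ?_
  have hb : Continuous fun p : Matrix.unitaryGroup (Fin n) ℂ × (ι × Fin k → Vec n) =>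
      (p.1, baseFam h p.2) :=
    continuous_fst.prodMk (continuous_pi fun i => (continuous_apply (h, i)).comp continuous_snd)
  exact (isClosed_hitRel Y ρ).preimage hb

lemma volume_pinned_uact {ι : Type*} [Fintype ι] (q : Matrix (ι × Fin k) (ι × Fin k) ℂ) (δ : ℝ)
    (h : ι) (Y : Fin k → Vec n) (ρ : Fin k → ℝ) (U : Matrix.unitaryGroup (Fin n) ℂ) :
    volume (pinned q δ h (fun i => uact U (Y i)) ρ) = volume (pinned q δ h Y ρ) := by
  rw [← (measurePreserving_family U).measure_preimage
    (isClosed_pinned q δ h _ ρ).measurableSet.nullMeasurableSet]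
  congr 1
  ext X
  simp only [pinned, Set.mem_preimage, Set.mem_sep_iff, gramNear_uact, baseFam, ← map_sub,
    norm_uact]

/-- Average over a Haar rotation of `Y`: pinned sets have a volume invariant under rotation, while
the rotations that pin a fixed `X` have probability `hit Y (baseFam h X) ρ`. The same averaging
gives `le_volume_pinned`. -/
lemma volume_pinned_le {ι : Type*} [Fintype ι] {q : Matrix (ι × Fin k) (ι × Fin k) ℂ} {δ : ℝ}
    {h : ι} {Y : Fin k → Vec n} {ρ : Fin k → ℝ} {H : ENNReal}
    (hH : ∀ X ∈ gramNear q n δ, hit Y (baseFam h X) ρ ≤ H) :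
    volume (pinned q δ h Y ρ) ≤ H * volume (gramNear q n δ) := by
  have := double_counting (μ := unitaryHaar n) (ν := (volume : Measure (ι × Fin k → Vec n)))
    (isClosed_pinnedRel q δ h Y ρ).measurableSet (A := Set.univ) (B := gramNear q n δ)
    (x := volume (pinned q δ h Y ρ)) (y := H)
    (fun U _ => (volume_pinned_uact q δ h Y ρ U).ge)
    (fun X hX => (measure_mono fun U hU => hU.2).trans (hH X hX)) (fun _ _ h => h.1)
  simpa using this

lemma le_volume_pinned {ι : Type*} [Fintype ι] {q : Matrix (ι × Fin k) (ι × Fin k) ℂ} {δ : ℝ}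
    {h : ι} {Y : Fin k → Vec n} {ρ : Fin k → ℝ} {H : ENNReal}
    (hH : ∀ X ∈ gramNear q n δ, H ≤ hit Y (baseFam h X) ρ) :
    H * volume (gramNear q n δ) ≤ volume (pinned q δ h Y ρ) := by
  have := double_counting (ν := unitaryHaar n) (μ := (volume : Measure (ι × Fin k → Vec n)))
    (measurable_swap (isClosed_pinnedRel q δ h Y ρ).measurableSet)
    (B := Set.univ) (A := gramNear q n δ)
    (y := volume (pinned q δ h Y ρ)) (x := H)
    (fun X hX => (hH X hX).trans (measure_mono fun U hU => ⟨hX, hU⟩))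
    (fun U _ => (volume_pinned_uact q δ h Y ρ U).le) (fun _ _ _ => Set.mem_univ _)
  simpa using this

lemma isClosed_edgeRel (ε : (s : S) →
      (F ∩ (FreeGroup.of s • F) : Finset (FreeGroup S)) × Fin k → ℝ) :
    IsClosed {p : (S → Matrix.unitaryGroup (Fin n) ℂ) × (F × Fin k → Vec n) |
      ∀ s j, ‖uact (p.1 s) (p.2 (tailIdx F k s j)) - p.2 (headIdx F k s j)‖ ≤ ε s j} := by
  simp only [Set.ofPred_forall]
  refine isClosed_iInter fun s => isClosed_iInter fun j => isClosed_le ?_ continuous_const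
  have h : Continuous fun p : (S → Matrix.unitaryGroup (Fin n) ℂ) × (F × Fin k → Vec n) =>
      uact (p.1 s) (p.2 (tailIdx F k s j)) :=
    (continuous_uact (n := n)).comp
      (f := fun p : (S → Matrix.unitaryGroup (Fin n) ℂ) × (F × Fin k → Vec n) =>
        (p.1 s, p.2 (tailIdx F k s j)))
      (by fun_prop)
  fun_prop

lemma isClosed_closeRel {S : Type*} {F : Finset (FreeGroup S)} (V : Matrix (Fin n) (Fin k) ℂ)
    (ε : F × Fin k → ℝ) :
    IsClosed {p : (S → Matrix.unitaryGroup (Fin n) ℂ) × (F × Fin k → Vec n) |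
      p.2 ∈ famBall (orbitFam V F p.1) ε} := by
  change IsClosed {p : (S → Matrix.unitaryGroup (Fin n) ℂ) × (F × Fin k → Vec n) |
    ∀ j, ‖orbitFam V F p.1 j - p.2 j‖ ≤ ε j}
  simp only [Set.ofPred_forall]
  refine isClosed_iInter fun j => isClosed_le ?_ continuous_const
  have := continuous_orbitFam V F
  fun_prop

/-- Upper bound for the probability of an event on which the Gram matrix of the orbit is close to
`q`. -/
lemma volume_mul_law_le [Fintype S] (hF : SuffixClosed F) (V : Matrix (Fin n) (Fin k) ℂ)
    {q : BlockMatrix F k}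
    {c τ δ : ℝ} (hτ : 0 < τ) {H : S → ENNReal} {H₁ : ENNReal}
    (hH : ∀ X ∈ gramNear q n δ, ∀ s, hit (X ∘ tailIdx F k s) (X ∘ headIdx F k s)
      (fun p => (1 + τ) * edgeRadius c τ F k s p) ≤ H s)
    (hH₁ : ∀ X ∈ gramNear q n δ, hit (colVec V) (baseFam ⟨1, hF.1⟩ X)
      (fun _ => radius c τ (1 : FreeGroup S)) ≤ H₁)
    {A : Set (S → Matrix.unitaryGroup (Fin n) ℂ)} {v : ENNReal}
    (hA : ∀ u ∈ A, ∀ X ∈ famBall (orbitFam V F u) (fun p => radius c τ p.1.1),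
      X ∈ gramNear q n δ)
    (hv : ∀ u, v ≤ volume (famBall (orbitFam V F u) (fun p => radius c τ p.1.1))) :
    v * generatorLaw S n A ≤ (∏ s, H s) * (H₁ * volume (gramNear q n δ)) := by
  -- For `u ∈ A` the section is the whole product of balls. For fixed `X` closeness to the orbit
  -- forces the edge conditions, and it also pins `X` at the identity.
  have key := double_counting (μ := generatorLaw S n)
    (ν := (volume : Measure (F × Fin k → Vec n)))
    (R := {p | p.2 ∈ famBall (orbitFam V F p.1) (fun p => radius c τ p.1.1)} ∩
      {p | p.2 ∈ gramNear q n δ})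
    ((isClosed_closeRel V _).measurableSet.inter
      ((isClosed_gramNear q n δ).preimage continuous_snd).measurableSet)
    (A := A) (B := pinned q δ ⟨1, hF.1⟩ (colVec V) (fun _ => radius c τ (1 : FreeGroup S)))
    (x := v) (y := ∏ s, H s) ?_ ?_ ?_
  · exact key.trans (mul_le_mul_right (volume_pinned_le hH₁) _)
  · exact fun u hu => (hv u).trans (measure_mono fun X hX => ⟨hX, hA u hu X hX⟩)
  · intro X hX
    refine le_trans (measure_mono fun u hu => ?_) ((generatorLaw_edges
      (fun s => X ∘ tailIdx F k s) (fun s => X ∘ headIdx F k s)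
      (fun s p => (1 + τ) * edgeRadius c τ F k s p)).le.trans
        (Finset.prod_le_prod' fun s _ => hH X hX.1 s))
    exact fun s p => edge_of_close V hτ hu.1 s p
  · rintro u X ⟨h1, h2⟩
    refine ⟨h2, fun i => ?_⟩
    have := h1 (⟨1, hF.1⟩, i)
    rwa [orbitFam, orbitVec_one] at this

/-- Lower bound for the probability of an event that occurs when the orbit is close to a family with
Gram matrix close to `q`. -/
lemma le_volume_mul_law [Fintype S] (hF : SuffixClosed F) (V : Matrix (Fin n) (Fin k) ℂ)
    {q : BlockMatrix F k}
    {c τ δ : ℝ} (hc : 0 < c) (hτ : 0 < τ) (hτ2 : τ ≤ 1 / 2) {H : S → ENNReal} {H₁ : ENNReal}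
    (hH : ∀ X ∈ gramNear q n δ, ∀ s, H s ≤ hit (X ∘ tailIdx F k s) (X ∘ headIdx F k s)
      (edgeRadius c τ F k s))
    (hH₁ : ∀ X ∈ gramNear q n δ, H₁ ≤ hit (colVec V) (baseFam ⟨1, hF.1⟩ X)
      (fun _ => radius c τ (1 : FreeGroup S)))
    {A : Set (S → Matrix.unitaryGroup (Fin n) ℂ)} {v : ENNReal}
    (hA : ∀ u, ∀ X ∈ gramNear q n δ,
      X ∈ famBall (orbitFam V F u) (fun p => (1 + 2 * τ) * radius c τ p.1.1) → u ∈ A)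
    (hv : ∀ u, volume (famBall (orbitFam V F u)
      (fun p => (1 + 2 * τ) * radius c τ p.1.1)) ≤ v) :
    (∏ s, H s) * (H₁ * volume (gramNear q n δ)) ≤ v * generatorLaw S n A := by
  have hclosed := isClosed_pinned (n := n) q δ (⟨1, hF.1⟩ : F) (colVec V)
    (fun _ => radius c τ (1 : FreeGroup S))
  -- The relation now consists of the edge conditions on pinned families; `close_of_edge` places its
  -- sections over `u` in slightly enlarged balls.
  have key := double_counting (ν := generatorLaw S n)
    (μ := (volume : Measure (F × Fin k → Vec n)))
    (measurable_swap ((isClosed_edgeRel (n := n) (F := F) (k := k)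
      (edgeRadius c τ F k)).inter (hclosed.preimage continuous_snd)).measurableSet)
    (B := A) (A := pinned q δ ⟨1, hF.1⟩ (colVec V) (fun _ => radius c τ (1 : FreeGroup S)))
    (y := v) (x := ∏ s, H s) ?_ ?_ ?_
  · exact (mul_le_mul_right (le_volume_pinned hH₁) _).trans key
  · intro X hX
    refine (Finset.prod_le_prod' fun s _ => hH X hX.1 s).trans ?_
    rw [← generatorLaw_edges]
    exact measure_mono fun u hu => ⟨hu, hX⟩
  · refine fun u _ => (measure_mono fun X hX => ?_).trans (hv u)
    exact close_of_edge hF V hc hτ hτ2 hX.2.2 hX.1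
  · exact fun X u hX => hA u X hX.2.1 (close_of_edge hF V hc hτ hτ2 hX.2.2 hX.1)

end Core

lemma exists_det_close {ι : Type*} [Fintype ι] [DecidableEq ι] (M : Matrix ι ι ℂ) {e : ℝ}
    (he : 0 < e) : ∃ δ > 0, ∀ M' : Matrix ι ι ℂ, (∀ i j, ‖M' i j - M i j‖ ≤ δ) →
      |M'.det.re - M.det.re| < e := by
  have hc : Continuous fun M' : ι → ι → ℂ => (Matrix.det (Matrix.of M')).re :=
    Complex.continuous_re.comp (Continuous.matrix_det continuous_id)
  obtain ⟨δ, hδ, h⟩ := Metric.continuous_iff.mp hc (fun i j => M i j) e he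
  refine ⟨δ / 2, by positivity, fun M' hM' => ?_⟩
  have := h (fun i j => M' i j) (by
    refine lt_of_le_of_lt ?_ (half_lt_self hδ)
    refine (dist_pi_le_iff (by positivity)).mpr fun i => (dist_pi_le_iff (by positivity)).mpr
      fun j => ?_
    rw [dist_eq_norm]
    exact hM' i j)
  rwa [Real.dist_eq] at this

lemma norm_gram_sub_gram_le {ι : Type*} {n : ℕ} {X Y : ι → Vec n} {P : ℝ} (hP : P ≤ 1)
    (hY : ∀ i, ‖Y i‖ = 1) (h : ∀ i, ‖Y i - X i‖ ≤ P) (i j : ι) :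
    ‖Matrix.gram ℂ X i j - Matrix.gram ℂ Y i j‖ ≤ 3 * P := by
  have hP0 : 0 ≤ P := (norm_nonneg _).trans (h i)
  have h1 : Matrix.gram ℂ X i j - Matrix.gram ℂ Y i j =
      ⟪Y i - X i, Y j - X j⟫_ℂ - ⟪Y i - X i, Y j⟫_ℂ - ⟪Y i, Y j - X j⟫_ℂ := by
    simp only [Matrix.gram_apply, inner_sub_left, inner_sub_right]; ring
  have h2 : ‖⟪Y i - X i, Y j - X j⟫_ℂ‖ ≤ P * P :=
    (norm_inner_le_norm _ _).trans (mul_le_mul (h i) (h j) (norm_nonneg _) hP0)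
  have h3 : ‖⟪Y i - X i, Y j⟫_ℂ‖ ≤ P := by
    refine (norm_inner_le_norm _ _).trans ?_
    rw [hY, mul_one]; exact h i
  have h4 : ‖⟪Y i, Y j - X j⟫_ℂ‖ ≤ P := by
    refine (norm_inner_le_norm _ _).trans ?_
    rw [hY, one_mul]; exact h j
  rw [h1]
  refine (norm_sub_le _ _).trans ?_
  have := norm_sub_le (⟪Y i - X i, Y j - X j⟫_ℂ) (⟪Y i - X i, Y j⟫_ℂ)
  nlinarith

/-- Absorbs the bounded factors left by the hitting and volume estimates. -/
lemma eventually_const_mul_pow_le (K : ℝ) {x y : ℝ} (hx : 0 ≤ x) (hxy : x < y) :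
    ∀ᶠ n : ℕ in atTop, K * x ^ n ≤ y ^ n := by
  have hy : 0 < y := hx.trans_lt hxy
  have h := (tendsto_pow_atTop_nhds_zero_of_lt_one (div_nonneg hx hy.le)
    ((div_lt_one hy).mpr hxy)).const_mul K
  rw [mul_zero] at h
  filter_upwards [h.eventually (ge_mem_nhds one_pos)] with n hn
  rw [div_pow, ← mul_div_assoc, div_le_one (by positivity)] at hn
  exact hn

/-! ### Exponential upper and lower bounds for neighbourhoods of `q` -/

section Bounds

variable {S : Type*} [Fintype S] [DecidableEq S] {k : ℕ} {F : Finset (FreeGroup S)}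

lemma radius_le {S : Type*} [DecidableEq S] {F : Finset (FreeGroup S)} {c τ : ℝ} (hc : 0 < c)
    (hτ : 0 < τ) (hτ1 : τ ≤ 1) {g : FreeGroup S} (hg : g ∈ F) :
    radius c τ g ≤ c * τ⁻¹ ^ (∑ h ∈ F, h.norm) := by
  unfold radius
  gcongr
  · exact (one_le_inv₀ hτ).mpr hτ1
  · exact Finset.single_le_sum (f := fun h : FreeGroup S => h.norm) (fun _ _ => Nat.zero_le _) hg

lemma radius_mul {S : Type*} [DecidableEq S] (c c' τ : ℝ) (g : FreeGroup S) :
    radius (c * c') τ g = c * radius c' τ g := by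
  unfold radius; ring

/-- This is the cancellation of radii between balls around the orbit and the hitting probabilities
of the base and the edges. -/
lemma prod_radius (hF : SuffixClosed F) (c τ : ℝ) :
    ∏ p : F × Fin k, radius c τ p.1.1 ^ 2 = (∏ _i : Fin k, radius c τ (1 : FreeGroup S) ^ 2) *
      ∏ s, ∏ p, edgeRadius c τ F k s p ^ 2 := by
  have h1 : ∀ E : Finset (FreeGroup S), ∀ β : FreeGroup S → ℝ,
      ∏ p : E × Fin k, β p.1.1 = ∏ h ∈ E, β h ^ k := by
    intro E β
    rw [Fintype.prod_prod_type, ← Finset.prod_coe_sort E]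
    simp
  simp only [edgeRadius]
  rw [h1 F (fun h => radius c τ h ^ 2), prod_edges hF]
  congr 1
  · simp
  · exact Finset.prod_congr rfl fun s _ =>
      (h1 _ (fun h => radius c τ (farEnd s h) ^ 2)).symm

set_option maxHeartbeats 800000 in
/-- The upper bound of large deviations type at a possibly singular point with nonsingular
restrictions to the sets of edges. -/
lemma exists_eventually_law_le (hF : SuffixClosed F) {q : BlockMatrix F k}
    (hq : q ∈ partialPD F k)
    (hdet : ∀ s : S, (q.submatrix (headIdx F k s) (headIdx F k s)).det ≠ 0)
    {y : ℝ} (hy : q.det.re <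
      y * ∏ s : S, (q.submatrix (headIdx F k s) (headIdx F k s)).det.re)
    (V : (n : ℕ) → Matrix (Fin n) (Fin k) ℂ) (hV : ∀ n, k ≤ n → (V n)ᴴ * V n = 1) :
    ∃ δ > 0, ∀ᶠ n : ℕ in atTop, generatorLaw S n
      {u | ∀ i j, ‖gramMatrix (V n) F u i j - q i j‖ < δ} ≤ ENNReal.ofReal (y ^ n) := by
  have hqd : ∀ p, q p p = 1 := by
    rintro ⟨g, i⟩
    have := congrFun (congrFun (hq.2.1 g) i) i
    rwa [Matrix.one_apply_eq] at this
  set d : S → ℝ := fun s => (q.submatrix (headIdx F k s) (headIdx F k s)).det.re with hd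
  have hd0 : ∀ s, 0 < d s := fun s => by
    have h1 := ((hq.1.submatrix (headIdx F k s)).posDef_iff_det_ne_zero.mpr (hdet s)).det_pos
    exact (Complex.lt_def.mp h1).1
  have hD0 : 0 < ∏ s, d s := Finset.prod_pos fun s _ => hd0 s
  set r : S → ℕ := fun s =>
    Fintype.card ((F ∩ (FreeGroup.of s • F) : Finset (FreeGroup S)) × Fin k) with hr
  set m := Fintype.card (F × Fin k) with hm
  -- The losses of `1 + τ`: four per edge vector, from the square of the tolerance `(1 + τ) * ((1 +
  -- τ) * ε)`, and one per edge determinant; two per base vector and one for the base determinant;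
  -- `m` from the volume of `gramNear`.
  set N : ℕ := (∑ s, (4 * r s + 1)) + (2 * k + 1) + m with hN
  -- At `τ = 0` this is `hy`. The same `τ` serves as ratio of radii, as tolerance and as
  -- regularisation of `q`.
  obtain ⟨τ, hτ0, hτ1, hτ⟩ : ∃ τ : ℝ, 0 < τ ∧ τ ≤ 1 ∧
      (1 + τ) ^ N * (q + (τ : ℂ) • (1 : BlockMatrix F k)).det.re < y * ∏ s, d s := by
    have hc : Continuous fun τ : ℝ =>
        (1 + τ) ^ N * (q + (τ : ℂ) • (1 : BlockMatrix F k)).det.re := by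
      refine Continuous.mul (by fun_prop) (Complex.continuous_re.comp (Continuous.matrix_det ?_))
      exact continuous_const.add (Complex.continuous_ofReal.smul continuous_const)
    have h0 := hc.tendsto 0
    simp only [add_zero, one_pow, one_mul, Complex.ofReal_zero, zero_smul] at h0
    have h1 := (h0.eventually (gt_mem_nhds hy)).filter_mono
      (nhdsWithin_le_nhds (s := Set.Ioi 0))
    obtain ⟨τ, h2, h3⟩ := (h1.and (Ioc_mem_nhdsGT one_pos)).exists
    exact ⟨τ, h3.1, h3.2, h2⟩
  obtain ⟨δ₁, hδ₁, hvol⟩ := exists_volume_gramNear_le hq.1 hτ0 hτ0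
  have hdc : ∀ s, ∃ δ > 0, ∀ M' : Matrix
      ((F ∩ (FreeGroup.of s • F) : Finset (FreeGroup S)) × Fin k)
      ((F ∩ (FreeGroup.of s • F) : Finset (FreeGroup S)) × Fin k) ℂ, (∀ i j, ‖M' i j -
      (q.submatrix (headIdx F k s) (headIdx F k s)) i j‖ ≤ δ) → d s / (1 + τ) < M'.det.re := by
    intro s
    have hlt : d s / (1 + τ) < d s := div_lt_self (hd0 s) (by linarith)
    obtain ⟨δ, hδ, h⟩ := exists_det_close (q.submatrix (headIdx F k s) (headIdx F k s))
      (sub_pos.mpr hlt)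
    exact ⟨δ, hδ, fun M' hM' => by linarith [(abs_lt.mp (h M' hM')).1]⟩
  choose δ₂ hδ₂ hdet₂ using hdc
  clear_value d
  obtain ⟨δ₃, hδ₃, hdet₃⟩ : ∃ δ > 0, ∀ M' : Matrix (Fin k) (Fin k) ℂ,
      (∀ i j, ‖M' i j - (1 : Matrix (Fin k) (Fin k) ℂ) i j‖ ≤ δ) → 1 / (1 + τ) < M'.det.re := by
    have hlt : 1 / (1 + τ) < 1 := div_lt_self one_pos (by linarith)
    obtain ⟨δ, hδ, h⟩ := exists_det_close (1 : Matrix (Fin k) (Fin k) ℂ) (sub_pos.mpr hlt)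
    refine ⟨δ, hδ, fun M' hM' => ?_⟩
    have := (abs_lt.mp (h M' hM')).1
    rw [Matrix.det_one, Complex.one_re] at this
    linarith
  obtain ⟨δ₄, hδ₄, hδ₄'⟩ : ∃ δ > 0, ∀ s, δ ≤ δ₂ s := by
    rcases isEmpty_or_nonempty S with h | h
    · exact ⟨1, one_pos, fun s => h.elim s⟩
    · obtain ⟨s, hs⟩ := Finite.exists_min δ₂
      exact ⟨δ₂ s, hδ₂ s, hs⟩
  set δ := min (min δ₁ δ₃) (min δ₄ 1) with hδ
  have hδ0 : 0 < δ := by positivity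
  have hδle1 : δ ≤ δ₁ := (min_le_left _ _).trans (min_le_left _ _)
  have hδle3 : δ ≤ δ₃ := (min_le_left _ _).trans (min_le_right _ _)
  have hδle4 : δ ≤ δ₄ := (min_le_right _ _).trans (min_le_left _ _)
  have hδle5 : δ ≤ 1 := (min_le_right _ _).trans (min_le_right _ _)
  clear_value δ
  set T := τ⁻¹ ^ (∑ h ∈ F, h.norm) with hT
  have hT0 : 0 < T := by positivity
  -- All radii are at most `c * T`, so passing from the orbit to `X` changes the Gram matrix by at
  -- most `3 * (c * T) ≤ δ / 2`.
  set c := min (1 / T) (δ / 6 / T) with hc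
  have hc0 : 0 < c := by positivity
  have hcT1 : c * T ≤ 1 := by
    rw [← le_div_iff₀ hT0]; exact min_le_left _ _
  have hcT2 : c * T ≤ δ / 6 := by
    rw [← le_div_iff₀ hT0]; exact min_le_right _ _
  have hrad_le : ∀ p : F × Fin k, radius c τ p.1.1 ≤ c * T := fun p =>
    radius_le hc0 hτ0 hτ1 p.1.2
  clear_value T c
  refine ⟨δ / 2, by positivity, ?_⟩
  have hhit : ∀ᶠ n : ℕ in atTop, ∀ s, ∀ Y Z :
      (F ∩ (FreeGroup.of s • F) : Finset (FreeGroup S)) × Fin k → Vec n,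
      (∀ j, ‖Z j‖ ≤ 2) → (Matrix.gram ℂ Z).det ≠ 0 →
      hit Y Z (fun p => (1 + τ) * edgeRadius c τ F k s p) ≤ ENNReal.ofReal
        (2 * ((∏ j, ((1 + τ) * ((1 + τ) * edgeRadius c τ F k s j)) ^ 2) /
          (Matrix.gram ℂ Z).det.re) ^ n) :=
    eventually_all.mpr fun s => eventually_hit_le _ hτ0
      (fun p => by have := radius_pos hc0 hτ0 (farEnd s p.1.1); unfold edgeRadius; positivity)
      two_pos
  have hhit₁ := eventually_hit_le (Fin k) hτ0 (ε := fun _ => radius c τ (1 : FreeGroup S))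
    (fun _ => radius_pos hc0 hτ0 _) (R := 2) two_pos
  set base := (1 + τ) ^ N * (q + (τ : ℂ) • (1 : BlockMatrix F k)).det.re / ∏ s, d s with hbase
  have hηdet : 0 < (q + (τ : ℂ) • (1 : BlockMatrix F k)).det.re := by
    have hη1 : ((τ : ℂ) • (1 : BlockMatrix F k)).PosDef := by
      refine Matrix.PosDef.smul Matrix.PosDef.one ?_
      exact_mod_cast hτ0
    exact (Complex.lt_def.mp (Matrix.PosDef.posSemidef_add hq.1 hη1).det_pos).1
  have hbase0 : 0 ≤ base :=
    div_nonneg (mul_nonneg (pow_nonneg (by linarith) _) hηdet.le) hD0.le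
  have hbasey : base < y := by rw [hbase, div_lt_iff₀ hD0]; exact hτ
  clear_value base
  filter_upwards [hhit, hhit₁, eventually_const_mul_pow_le (2 ^ Fintype.card S * 2) hbase0 hbasey,
    eventually_ge_atTop k] with n hn hn₁ hfin hkn
  have hXn : ∀ X ∈ gramNear q n δ, ∀ p, ‖X p‖ ≤ 2 := by
    intro X hX p
    have h1 := hX p p
    rw [Matrix.gram_apply, inner_self_eq_norm_sq_to_K, hqd] at h1
    have h2 : ((‖X p‖ : ℂ) ^ 2 - 1) = ((‖X p‖ ^ 2 - 1 : ℝ) : ℂ) := by push_cast; rfl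
    change ‖((‖X p‖ : ℂ) ^ 2 - 1)‖ ≤ δ at h1
    rw [h2, Complex.norm_real, Real.norm_eq_abs] at h1
    have := (abs_le.mp h1).2
    nlinarith [norm_nonneg (X p)]
  set A : S → ℝ := fun s => (1 + τ) ^ (4 * r s + 1) *
    (∏ j, edgeRadius c τ F k s j ^ 2) / d s with hA
  set A₁ : ℝ := (1 + τ) ^ (2 * k + 1) * ∏ _i : Fin k, radius c τ (1 : FreeGroup S) ^ 2 with hA₁
  clear_value A A₁
  have hA0 : ∀ s, 0 ≤ A s := fun s => by
    rw [hA]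
    have := hd0 s
    have : 0 ≤ ∏ j, edgeRadius c τ F k s j ^ 2 := Finset.prod_nonneg fun _ _ => by positivity
    positivity
  have hA₁0 : 0 ≤ A₁ := by
    rw [hA₁]
    have : 0 ≤ ∏ _i : Fin k, radius c τ (1 : FreeGroup S) ^ 2 :=
      Finset.prod_nonneg fun _ _ => by positivity
    positivity
  have key := volume_mul_law_le (n := n) hF (V n) (q := q) (c := c) (τ := τ) (δ := δ) hτ0
    (H := fun s => ENNReal.ofReal (2 * A s ^ n)) (H₁ := ENNReal.ofReal (2 * A₁ ^ n))
    (A := {u | ∀ i j, ‖gramMatrix (V n) F u i j - q i j‖ < δ / 2})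
    (v := ENNReal.ofReal ((∏ p : F × Fin k, radius c τ p.1.1 ^ 2) ^ n) * ballVol n ^ m)
    ?_ ?_ ?_ ?_
  · set Rt := ∏ p : F × Fin k, radius c τ p.1.1 ^ 2 with hRt
    have hRt0 : 0 < Rt := Finset.prod_pos fun p _ => by
      have := radius_pos hc0 hτ0 p.1.1; positivity
    set B := ballVol n ^ m with hB
    have hB0 : B ≠ 0 := pow_ne_zero _ (ballVol_ne_zero n)
    have hBt : B ≠ ⊤ := ENNReal.pow_ne_top (ballVol_ne_top n)
    set Pr := generatorLaw S n {u | ∀ i j, ‖gramMatrix (V n) F u i j - q i j‖ < δ / 2} with hPr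
    set G := (q + (τ : ℂ) • (1 : BlockMatrix F k)).det.re * (1 + τ) ^ m with hG
    have h1 : ENNReal.ofReal (Rt ^ n) * Pr * B ≤
        ENNReal.ofReal ((2 ^ Fintype.card S * 2) * (base * Rt) ^ n) * B := by
      calc ENNReal.ofReal (Rt ^ n) * Pr * B = ENNReal.ofReal (Rt ^ n) * B * Pr := by ring
        _ ≤ _ := key
        _ ≤ (∏ s, ENNReal.ofReal (2 * A s ^ n)) * (ENNReal.ofReal (2 * A₁ ^ n) *
              (ENNReal.ofReal (G ^ n) * B)) := by gcongr; exact hvol δ hδle1 n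
        _ = ENNReal.ofReal ((∏ s, 2 * A s ^ n) * (2 * A₁ ^ n) * G ^ n) * B := by
            rw [← ENNReal.ofReal_prod_of_nonneg (fun s _ => by have := hA0 s; positivity),
              ENNReal.ofReal_mul (mul_nonneg (Finset.prod_nonneg fun s _ => by
                have := hA0 s; positivity) (by positivity)),
              ENNReal.ofReal_mul (Finset.prod_nonneg fun s _ => by have := hA0 s; positivity)]
            ring
        _ = _ := by
            congr 2
            rw [Finset.prod_mul_distrib, Finset.prod_const, Finset.card_univ, Finset.prod_pow]
            have h2 : (∏ s, A s) * A₁ * G = base * Rt := by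
              rw [hRt, prod_radius hF, hbase, hA, hA₁, hG, hN]
              simp only [Finset.prod_div_distrib, Finset.prod_mul_distrib]
              rw [Finset.prod_pow_eq_pow_sum]
              field_simp
              rw [pow_add, pow_add]
              ring
            rw [← h2]
            ring
    rw [ENNReal.mul_le_mul_iff_left hB0 hBt, mul_pow, ← mul_assoc,
      ENNReal.ofReal_mul (by positivity), mul_comm,
      ENNReal.mul_le_mul_iff_left (ENNReal.ofReal_pos.mpr (by positivity)).ne'
        ENNReal.ofReal_ne_top] at h1
    exact h1.trans (ENNReal.ofReal_le_ofReal hfin)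
  · intro X hX s
    have hdX := hdet₂ s (Matrix.gram ℂ (X ∘ headIdx F k s)) (fun i j =>
      (hX _ _).trans (hδle4.trans (hδ₄' s)))
    have hdpos : 0 < d s / (1 + τ) := by have := hd0 s; positivity
    refine (hn s _ _ (fun j => hXn X hX _) (fun h0 => ?_)).trans (ENNReal.ofReal_le_ofReal ?_)
    · replace hdX := hdX.trans_eq ((congrArg Complex.re h0).trans Complex.zero_re)
      linarith
    · have h3 : ∏ j, ((1 + τ) * ((1 + τ) * edgeRadius c τ F k s j)) ^ 2 =
          (1 + τ) ^ (4 * r s) * ∏ j, edgeRadius c τ F k s j ^ 2 := by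
        have : ∀ j, ((1 + τ) * ((1 + τ) * edgeRadius c τ F k s j)) ^ 2 =
            (1 + τ) ^ 4 * edgeRadius c τ F k s j ^ 2 := fun j => by ring
        simp_rw [this]
        rw [Finset.prod_mul_distrib, Finset.prod_const, Finset.card_univ, ← pow_mul]
      have h4 : A s = (1 + τ) ^ (4 * r s) * (∏ j, edgeRadius c τ F k s j ^ 2) /
          (d s / (1 + τ)) := by
        rw [hA]
        simp only
        rw [pow_succ]
        field_simp
      have h5 : 0 ≤ ∏ j, edgeRadius c τ F k s j ^ 2 :=
        Finset.prod_nonneg fun _ _ => by positivity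
      rw [h3, h4]
      gcongr
      have : 0 < (Matrix.gram ℂ (X ∘ headIdx F k s)).det.re := hdpos.trans hdX
      positivity
      exact hdX.le
  · intro X hX
    have hdX := hdet₃ (Matrix.gram ℂ (baseFam ⟨1, hF.1⟩ X)) (fun i j => by
      have h1 := hX (⟨1, hF.1⟩, i) (⟨1, hF.1⟩, j)
      have h2 := congrFun (congrFun (hq.2.1 ⟨1, hF.1⟩) i) j
      rw [← h2]
      exact h1.trans hδle3)
    have hdpos : 0 < 1 / (1 + τ) := by positivity
    refine (hn₁ _ _ (fun j => hXn X hX _) (fun h0 => ?_)).trans (ENNReal.ofReal_le_ofReal ?_)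
    · replace hdX := hdX.trans_eq ((congrArg Complex.re h0).trans Complex.zero_re)
      linarith
    · have h3 : ∏ _j : Fin k, ((1 + τ) * radius c τ (1 : FreeGroup S)) ^ 2 =
          (1 + τ) ^ (2 * k) * ∏ _j : Fin k, radius c τ (1 : FreeGroup S) ^ 2 := by
        simp only [Finset.prod_const, Finset.card_univ, Fintype.card_fin, mul_pow, ← pow_mul]
      have h4 : A₁ = (1 + τ) ^ (2 * k) * (∏ _j : Fin k, radius c τ (1 : FreeGroup S) ^ 2) /
          (1 / (1 + τ)) := by
        rw [hA₁, pow_succ]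
        field_simp
      have h5 : 0 ≤ ∏ _j : Fin k, radius c τ (1 : FreeGroup S) ^ 2 :=
        Finset.prod_nonneg fun _ _ => by positivity
      rw [h3, h4]
      gcongr
      have : 0 < (Matrix.gram ℂ (baseFam ⟨1, hF.1⟩ X)).det.re := hdpos.trans hdX
      positivity
      exact hdX.le
  · intro u hu X hX i j
    have h1 := norm_gram_sub_gram_le (X := X) (Y := orbitFam (V n) F u) hcT1
      (fun i => norm_orbitVec (hV n hkn) u _ _)
      (fun i => (hX i).trans (hrad_le i)) i j
    have h2 := hu i j
    rw [gramMatrix_eq_gram] at h2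
    calc ‖Matrix.gram ℂ X i j - q i j‖
        ≤ ‖Matrix.gram ℂ X i j - Matrix.gram ℂ (orbitFam (V n) F u) i j‖ +
          ‖Matrix.gram ℂ (orbitFam (V n) F u) i j - q i j‖ :=
            norm_sub_le_norm_sub_add_norm_sub _ _ _
      _ ≤ δ := by linarith
  · intro u
    have hr0 : ∀ p : F × Fin k, 0 ≤ radius c τ p.1.1 := fun p => (radius_pos hc0 hτ0 p.1.1).le
    exact (volume_famBall (orbitFam (V n) F u) hr0).ge

set_option maxHeartbeats 800000 in
/-- The lower bound of large deviations type at a nonsingular point. -/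
lemma eventually_le_law (hF : SuffixClosed F) {q : BlockMatrix F k}
    (hq : q ∈ partialPD F k) (hdet : q.det ≠ 0) {y : ℝ} (hy0 : 0 ≤ y) (hy :
      y * ∏ s : S, (q.submatrix (headIdx F k s) (headIdx F k s)).det.re < q.det.re)
    (V : (n : ℕ) → Matrix (Fin n) (Fin k) ℂ) (hV : ∀ n, k ≤ n → (V n)ᴴ * V n = 1)
    {δ₀ : ℝ} (hδ₀ : 0 < δ₀) :
    ∀ᶠ n : ℕ in atTop, ENNReal.ofReal (y ^ n) ≤ generatorLaw S n
      {u | ∀ i j, ‖gramMatrix (V n) F u i j - q i j‖ < δ₀} := by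
  have hqpd : q.PosDef := hq.1.posDef_iff_det_ne_zero.mpr hdet
  have hspd : ∀ s, (q.submatrix (headIdx F k s) (headIdx F k s)).PosDef := fun s =>
    hqpd.submatrix (headIdx_injective s)
  set d : S → ℝ := fun s => (q.submatrix (headIdx F k s) (headIdx F k s)).det.re with hd
  have hd0 : ∀ s, 0 < d s := fun s => (Complex.lt_def.mp (hspd s).det_pos).1
  have hdq : 0 < q.det.re := (Complex.lt_def.mp hqpd.det_pos).1
  have hD0 : 0 < ∏ s, d s := Finset.prod_pos fun s _ => hd0 s
  set r : S → ℕ := fun s =>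
    Fintype.card ((F ∩ (FreeGroup.of s • F) : Finset (FreeGroup S)) × Fin k) with hr
  set m := Fintype.card (F × Fin k) with hm
  -- Per vector, two factors `1 + τ` come from the enlarged radius constant `(1 + τ) * c` and one
  -- from the loss in `eventually_le_hit`. The `2 * m` factors `1 + 2 * τ` come from
  -- `close_of_edge`.
  set N : ℕ := (∑ s, 3 * r s) + 3 * k with hN
  obtain ⟨τ, hτ0, hτ1, hτ⟩ : ∃ τ : ℝ, 0 < τ ∧ τ ≤ 1 / 2 ∧
      y * (∏ s, d s) * ((1 + τ) ^ N * (1 + 2 * τ) ^ (2 * m)) < q.det.re := by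
    have hc : Continuous fun τ : ℝ =>
        y * (∏ s, d s) * ((1 + τ) ^ N * (1 + 2 * τ) ^ (2 * m)) := by fun_prop
    have h0 := hc.tendsto 0
    simp only [add_zero, one_pow, mul_one, mul_zero] at h0
    have h1 := (h0.eventually (gt_mem_nhds hy)).filter_mono
      (nhdsWithin_le_nhds (s := Set.Ioi 0))
    obtain ⟨τ, h2, h3⟩ := (h1.and (Ioc_mem_nhdsGT (half_pos one_pos))).exists
    exact ⟨τ, h3.1, h3.2, h2⟩
  have hex : ∀ s, ∃ c₀ > 0, ∀ c, 0 < c → c < c₀ → ∃ δ > 0, ∀ᶠ n : ℕ in atTop, ∀ Y Z :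
      (F ∩ (FreeGroup.of s • F) : Finset (FreeGroup S)) × Fin k → Vec n,
      Y ∈ gramNear (q.submatrix (headIdx F k s) (headIdx F k s)) n δ →
      Z ∈ gramNear (q.submatrix (headIdx F k s) (headIdx F k s)) n δ →
      ENNReal.ofReal (1 / 2 * ((∏ j, (c * edgeRadius 1 τ F k s j) ^ 2) /
        (d s * (1 + τ) ^ r s)) ^ n) ≤
      hit Y Z fun j => (1 + τ) * (c * edgeRadius 1 τ F k s j) :=
    fun s => eventually_le_hit (hspd s) hτ0 fun p => radius_pos one_pos hτ0 _
  choose c₁ hc₁ hlow using hex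
  clear_value d
  obtain ⟨c₂, hc₂, hlow₁⟩ := eventually_le_hit (ι := Fin k) (Matrix.PosDef.one (R := ℂ)) hτ0
    (e := fun _ => radius 1 τ (1 : FreeGroup S)) fun p => radius_pos one_pos hτ0 _
  obtain ⟨c₃, hc₃, hc₃'⟩ : ∃ δ > 0, ∀ s, δ ≤ c₁ s := by
    rcases isEmpty_or_nonempty S with h | h
    · exact ⟨1, one_pos, fun s => h.elim s⟩
    · obtain ⟨s, hs⟩ := Finite.exists_min c₁
      exact ⟨c₁ s, hc₁ s, hs⟩
  set T := τ⁻¹ ^ (∑ h ∈ F, h.norm) with hT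
  have hT0 : 0 < T := by positivity
  -- One `c` serves the base and all generators. The orbit is within `3 * (c * T)` of `X`, so the
  -- Gram matrix moves by at most `9 * (c * T) < δ₀ / 2`; the other half of `δ₀` is left for `δ`.
  set c := min (min c₂ c₃) (min (1 / (3 * T)) (δ₀ / 18 / T)) / 2 with hc
  have hc0 : 0 < c := by positivity
  have hclt : c < min (min c₂ c₃) (min (1 / (3 * T)) (δ₀ / 18 / T)) :=
    half_lt_self (by positivity)
  have hc2 : c < c₂ := hclt.trans_le ((min_le_left _ _).trans (min_le_left _ _))
  have hc3 : c < c₃ := hclt.trans_le ((min_le_left _ _).trans (min_le_right _ _))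
  have hcT1 : 3 * (c * T) < 1 := by
    have := hclt.trans_le ((min_le_right _ _).trans (min_le_left _ _))
    rw [lt_div_iff₀ (by positivity)] at this
    linarith
  have hcT2 : c * T < δ₀ / 18 := by
    rw [← lt_div_iff₀ hT0]
    exact hclt.trans_le ((min_le_right _ _).trans (min_le_right _ _))
  have hrad_le : ∀ p : F × Fin k, radius c τ p.1.1 ≤ c * T := fun p =>
    radius_le hc0 hτ0 (by linarith) p.1.2
  clear_value T c
  have hex2 := fun s => hlow s c hc0 (hc3.trans_le (hc₃' s))
  choose δ₁ hδ₁ hlow' using hex2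
  obtain ⟨δ₂, hδ₂, hlow₁'⟩ := hlow₁ c hc0 hc2
  obtain ⟨δ₃, hδ₃, hδ₃'⟩ : ∃ δ > 0, ∀ s, δ ≤ δ₁ s := by
    rcases isEmpty_or_nonempty S with h | h
    · exact ⟨1, one_pos, fun s => h.elim s⟩
    · obtain ⟨s, hs⟩ := Finite.exists_min δ₁
      exact ⟨δ₁ s, hδ₁ s, hs⟩
  set δ := min (min δ₂ δ₃) (δ₀ / 2) with hδ
  have hδ0 : 0 < δ := by positivity
  have hδle2 : δ ≤ δ₂ := (min_le_left _ _).trans (min_le_left _ _)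
  have hδle3 : δ ≤ δ₃ := (min_le_left _ _).trans (min_le_right _ _)
  have hδle0 : δ ≤ δ₀ / 2 := min_le_right _ _
  clear_value δ
  have hedge : ∀ s p, edgeRadius ((1 + τ) * c) τ F k s p =
      (1 + τ) * (c * edgeRadius 1 τ F k s p) := fun s p => by
    rw [edgeRadius, edgeRadius, radius_mul, ← radius_mul c, mul_one]
  have hrad : radius ((1 + τ) * c) τ (1 : FreeGroup S) =
      (1 + τ) * (c * radius 1 τ (1 : FreeGroup S)) := by
    rw [radius_mul, ← radius_mul c, mul_one]
  set base := q.det.re / ((∏ s, d s) * ((1 + τ) ^ N * (1 + 2 * τ) ^ (2 * m))) with hbase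
  have hbasey : y < base := by
    rw [hbase, lt_div_iff₀ (by positivity), ← mul_assoc]; exact hτ
  clear_value base
  -- The constant `2 ^ card S * 4` collects the factors `1 / 2` lost per generator, at the base, and
  -- in the volume of `gramNear`.
  filter_upwards [eventually_all.mpr hlow', hlow₁', eventually_le_volume_gramNear hq.1 hδ0,
    eventually_const_mul_pow_le (2 ^ Fintype.card S * 4) hy0 hbasey,
    eventually_ge_atTop k] with n hn hn₁ hvol hfin hkn
  set A : S → ℝ := fun s => (∏ j, (c * edgeRadius 1 τ F k s j) ^ 2) / (d s * (1 + τ) ^ r s) with hA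
  set A₁ : ℝ := (∏ _i : Fin k, (c * radius 1 τ (1 : FreeGroup S)) ^ 2) / (1 + τ) ^ k with hA₁
  clear_value A A₁
  have hA0 : ∀ s, 0 ≤ A s := fun s => by
    rw [hA]
    have := hd0 s
    have : 0 ≤ ∏ j, (c * edgeRadius 1 τ F k s j) ^ 2 := Finset.prod_nonneg fun _ _ => by positivity
    positivity
  have hA₁0 : 0 ≤ A₁ := by
    rw [hA₁]
    have : 0 ≤ ∏ _i : Fin k, (c * radius 1 τ (1 : FreeGroup S)) ^ 2 :=
      Finset.prod_nonneg fun _ _ => by positivity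
    positivity
  have key := le_volume_mul_law (n := n) hF (V n) (q := q) (c := (1 + τ) * c) (τ := τ) (δ := δ)
    (by positivity) hτ0 hτ1
    (H := fun s => ENNReal.ofReal (1 / 2 * A s ^ n)) (H₁ := ENNReal.ofReal (1 / 2 * A₁ ^ n))
    (A := {u | ∀ i j, ‖gramMatrix (V n) F u i j - q i j‖ < δ₀})
    (v := ENNReal.ofReal ((∏ p : F × Fin k,
      ((1 + 2 * τ) * radius ((1 + τ) * c) τ p.1.1) ^ 2) ^ n) * ballVol n ^ m)
    ?_ ?_ ?_ ?_
  · set Rt := ∏ p : F × Fin k, ((1 + 2 * τ) * radius ((1 + τ) * c) τ p.1.1) ^ 2 with hRt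
    have hRt0 : 0 < Rt := Finset.prod_pos fun p _ => by
      have := radius_pos (c := (1 + τ) * c) (by positivity) hτ0 p.1.1; positivity
    set B := ballVol n ^ m with hB
    have hB0 : B ≠ 0 := pow_ne_zero _ (ballVol_ne_zero n)
    have hBt : B ≠ ⊤ := ENNReal.pow_ne_top (ballVol_ne_top n)
    set Pr := generatorLaw S n {u | ∀ i j, ‖gramMatrix (V n) F u i j - q i j‖ < δ₀} with hPr
    have h2 : (∏ s, A s) * A₁ * q.det.re = base * Rt := by
      have e1 : Rt = (1 + 2 * τ) ^ (2 * m) *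
          ((∏ _i : Fin k, radius ((1 + τ) * c) τ (1 : FreeGroup S) ^ 2) *
            ∏ s, ∏ p, edgeRadius ((1 + τ) * c) τ F k s p ^ 2) := by
        rw [hRt, ← prod_radius hF]
        simp only [mul_pow, Finset.prod_mul_distrib, Finset.prod_const, Finset.card_univ, ← pow_mul,
          hm]
      have e2 : ∀ s, ∏ p, edgeRadius ((1 + τ) * c) τ F k s p ^ 2 =
          (1 + τ) ^ (2 * r s) * ∏ j, (c * edgeRadius 1 τ F k s j) ^ 2 := by
        intro s
        simp_rw [hedge, mul_pow (1 + τ)]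
        rw [Finset.prod_mul_distrib, Finset.prod_const, Finset.card_univ, ← pow_mul]
      have e3 : ∏ _i : Fin k, radius ((1 + τ) * c) τ (1 : FreeGroup S) ^ 2 =
          (1 + τ) ^ (2 * k) * ∏ _i : Fin k, (c * radius 1 τ (1 : FreeGroup S)) ^ 2 := by
        simp_rw [hrad, mul_pow (1 + τ)]
        rw [Finset.prod_mul_distrib, Finset.prod_const, Finset.card_univ, Fintype.card_fin,
          ← pow_mul]
      have e4 : (1 + τ) ^ N = ((∏ s, (1 + τ) ^ r s) * ∏ s, (1 + τ) ^ (2 * r s)) *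
          ((1 + τ) ^ k * (1 + τ) ^ (2 * k)) := by
        rw [hN, Finset.prod_pow_eq_pow_sum, Finset.prod_pow_eq_pow_sum, ← pow_add, ← pow_add,
          ← pow_add]
        congr 1
        rw [← Finset.sum_add_distrib]
        congr 1
        · exact Finset.sum_congr rfl fun s _ => by ring
        · ring
      rw [e1, e3, Finset.prod_congr rfl fun s _ => e2 s, hbase, e4, hA, hA₁]
      simp only [Finset.prod_div_distrib, Finset.prod_mul_distrib]
      have : (∏ s, (1 + τ) ^ r s) ≠ 0 := Finset.prod_ne_zero_iff.mpr fun s _ => by positivity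
      have : (∏ s, (1 + τ) ^ (2 * r s)) ≠ 0 := Finset.prod_ne_zero_iff.mpr fun s _ => by positivity
      field_simp
    have h1 : ENNReal.ofReal ((base * Rt) ^ n) * B ≤
        ENNReal.ofReal (2 ^ Fintype.card S * 4 * Rt ^ n) * Pr * B := by
      calc ENNReal.ofReal ((base * Rt) ^ n) * B
          = ENNReal.ofReal (2 ^ Fintype.card S * 2) * ((∏ s, ENNReal.ofReal (1 / 2 * A s ^ n)) *
            (ENNReal.ofReal (1 / 2 * A₁ ^ n) * (ENNReal.ofReal (q.det.re ^ n) * B))) := by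
            rw [← ENNReal.ofReal_prod_of_nonneg (fun s _ => by have := hA0 s; positivity)]
            simp only [← mul_assoc]
            rw [← ENNReal.ofReal_mul (by positivity),
              ← ENNReal.ofReal_mul (mul_nonneg (by positivity)
              (Finset.prod_nonneg fun s _ => by have := hA0 s; positivity)),
              ← ENNReal.ofReal_mul (mul_nonneg (mul_nonneg (by positivity)
              (Finset.prod_nonneg fun s _ => by have := hA0 s; positivity)) (by positivity))]
            congr 2
            rw [← h2, Finset.prod_mul_distrib, Finset.prod_const, Finset.card_univ,
              Finset.prod_pow, mul_pow, mul_pow, one_div, inv_pow]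
            field_simp
        _ ≤ ENNReal.ofReal (2 ^ Fintype.card S * 2) * ((∏ s, ENNReal.ofReal (1 / 2 * A s ^ n)) *
            (ENNReal.ofReal (1 / 2 * A₁ ^ n) * (2 * volume (gramNear q n δ)))) := by gcongr
        _ = ENNReal.ofReal (2 ^ Fintype.card S * 2) * 2 *
            ((∏ s, ENNReal.ofReal (1 / 2 * A s ^ n)) *
            (ENNReal.ofReal (1 / 2 * A₁ ^ n) * volume (gramNear q n δ))) := by ring
        _ ≤ ENNReal.ofReal (2 ^ Fintype.card S * 2) * 2 * (ENNReal.ofReal (Rt ^ n) * B * Pr) := by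
            gcongr
        _ = _ := by
            have e : ENNReal.ofReal (2 ^ Fintype.card S * 4 * Rt ^ n) =
                ENNReal.ofReal (2 ^ Fintype.card S * 2) * 2 * ENNReal.ofReal (Rt ^ n) := by
              rw [← ENNReal.ofReal_ofNat 2, ← ENNReal.ofReal_mul (by positivity),
                ← ENNReal.ofReal_mul (by positivity)]
              congr 1
              ring
            rw [e]
            ring
    rw [ENNReal.mul_le_mul_iff_left hB0 hBt, mul_pow,
      mul_comm (ENNReal.ofReal (2 ^ Fintype.card S * 4 * Rt ^ n))] at h1
    have h3 : ENNReal.ofReal (y ^ n) * ENNReal.ofReal (2 ^ Fintype.card S * 4 * Rt ^ n) ≤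
        Pr * ENNReal.ofReal (2 ^ Fintype.card S * 4 * Rt ^ n) := by
      refine le_trans ?_ h1
      rw [← ENNReal.ofReal_mul (by positivity)]
      refine ENNReal.ofReal_le_ofReal ?_
      calc y ^ n * (2 ^ Fintype.card S * 4 * Rt ^ n)
          = (2 ^ Fintype.card S * 4 * y ^ n) * Rt ^ n := by ring
        _ ≤ _ := by gcongr
    rwa [ENNReal.mul_le_mul_iff_left (ENNReal.ofReal_pos.mpr (by positivity)).ne'
      ENNReal.ofReal_ne_top] at h3
  · intro X hX s
    have h1 := hn s (X ∘ tailIdx F k s) (X ∘ headIdx F k s) (fun i j => by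
      rw [← submatrix_tailIdx hq]
      exact (hX _ _).trans (hδle3.trans (hδ₃' s)))
      (fun i j => (hX _ _).trans (hδle3.trans (hδ₃' s)))
    simp_rw [← hedge] at h1
    rw [hA]
    exact h1
  · intro X hX
    have h1 := hn₁ (colVec (V n)) (baseFam ⟨1, hF.1⟩ X) (fun i j => by
      have h2 : Matrix.gram ℂ (colVec (V n)) = 1 := (gram_column (V n)).trans (hV n hkn)
      rw [h2, sub_self, norm_zero]
      exact hδ₂.le) (fun i j => by
      have h1 := hX (⟨1, hF.1⟩, i) (⟨1, hF.1⟩, j)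
      have h2 := congrFun (congrFun (hq.2.1 ⟨1, hF.1⟩) i) j
      rw [← h2]
      exact h1.trans hδle2)
    simp only [← hrad, Matrix.det_one, Complex.one_re, one_mul, Fintype.card_fin] at h1
    rw [hA₁]
    exact h1
  · intro u X hX hXo i j
    have hP : ∀ p : F × Fin k, (1 + 2 * τ) * radius ((1 + τ) * c) τ p.1.1 ≤ 3 * (c * T) := by
      intro p
      have h1 := hrad_le p
      have h2 := radius_pos hc0 hτ0 p.1.1
      rw [radius_mul, ← mul_assoc]
      calc (1 + 2 * τ) * (1 + τ) * radius c τ p.1.1 ≤ 3 * radius c τ p.1.1 := by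
            gcongr; nlinarith
        _ ≤ _ := by gcongr
    have h1 := norm_gram_sub_gram_le (X := X) (Y := orbitFam (V n) F u) hcT1.le
      (fun i => norm_orbitVec (hV n hkn) u _ _) (fun i => (hXo i).trans (hP i)) i j
    rw [gramMatrix_eq_gram]
    have h2 := hX i j
    rw [norm_sub_rev] at h1
    calc ‖Matrix.gram ℂ (orbitFam (V n) F u) i j - q i j‖
        ≤ ‖Matrix.gram ℂ (orbitFam (V n) F u) i j - Matrix.gram ℂ X i j‖ +
          ‖Matrix.gram ℂ X i j - q i j‖ := norm_sub_le_norm_sub_add_norm_sub _ _ _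
      _ < δ₀ := by linarith
  · exact fun u => (volume_famBall _ fun p => by
      have := radius_pos (c := (1 + τ) * c) (by positivity) hτ0 p.1.1; positivity).le

end Bounds

/-! ### Zero-one law for the vanishing of the Gram determinant -/

section ZeroOne

/-- A closed set that meets almost no point of each orbit of a one-parameter group, or all of it,
is almost everywhere invariant under this one-parameter group. -/
lemma measure_sep_notMem_eq_zero {G : Type*} [Group G] [TopologicalSpace G] [IsTopologicalGroup G]
    [MeasurableSpace G] [BorelSpace G] [SecondCountableTopology G] {μ : Measure G} [SFinite μ]
    [μ.IsMulLeftInvariant] {A : Set G} (hA : IsClosed A) {φ : ℝ → G} (hφ : Continuous φ)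
    (hadd : ∀ s t, φ (s + t) = φ s * φ t)
    (hdich : ∀ u, (∀ t, φ t * u ∈ A) ∨ ∀ᵐ t : ℝ, φ t * u ∉ A) (s : ℝ) :
    μ {u ∈ A | φ s * u ∉ A} = 0 := by
  -- `B` collects the orbits contained in `A`. For each `u`, almost no `t` has `φ t * u ∈ A \ B`; by
  -- Fubini and left invariance `A \ B` is null.
  set B : Set G := {u | ∀ t, φ t * u ∈ A} with hB
  have hBc : IsClosed B := by
    simp only [hB, Set.ofPred_forall]
    exact isClosed_iInter fun t => hA.preimage (continuous_const_mul (φ t))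
  have hm : MeasurableSet (A \ B) := hA.measurableSet.diff hBc.measurableSet
  have hcont : Continuous fun p : ℝ × G => φ p.1 * p.2 :=
    (hφ.comp continuous_fst).mul continuous_snd
  have key := double_counting (μ := (volume.restrict (Set.Ioc (0 : ℝ) 1))) (ν := μ)
    (R := {p : ℝ × G | φ p.1 * p.2 ∈ A \ B}) (hcont.measurable hm) (A := Set.univ)
    (B := Set.univ) (x := μ (A \ B)) (y := 0)
    (fun t _ => (measure_preimage_mul μ (φ t) (A \ B)).ge)
    (fun u _ => ?_) (fun _ _ _ => Set.mem_univ _)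
  · have h0 : μ (A \ B) = 0 := by simpa using key
    refine measure_mono_null (t := A \ B) (fun u hu => ⟨hu.1, fun h => hu.2 (h s)⟩) h0
  · refine (Measure.restrict_apply_le _ _).trans (le_of_eq ?_)
    rcases hdich u with h | h
    · convert measure_empty (μ := (volume : Measure ℝ))
      refine Set.eq_empty_of_forall_notMem fun t ht => ht.2 fun r => ?_
      rw [← mul_assoc, ← hadd]
      exact h _
    · exact measure_mono_null (fun t ht => not_not.mpr ht.1) h

/-- A closed set that is not the whole group and is almost everywhere invariant is null. -/
lemma measure_eq_zero_of_ae_invariant {G : Type*} [Group G] [TopologicalSpace G]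
    [IsTopologicalGroup G] [CompactSpace G] [MeasurableSpace G] {μ : Measure G} {A : Set G}
    (hA : IsClosed A) (hne : A ≠ Set.univ) (hinv : ∀ g, μ {u ∈ A | g * u ∉ A} = 0) : μ A = 0 := by
  obtain ⟨v, hv⟩ := (Set.ne_univ_iff_exists_notMem A).mp hne
  have hopen : ∀ g : G, IsOpen {u | g * u ∉ A} := fun g =>
    hA.isOpen_compl.preimage (continuous_const_mul g)
  -- Translates of the nonempty open complement cover the group. Finitely many suffice, so `A` is a
  -- finite union of null sets.
  obtain ⟨T, hT⟩ := isCompact_univ.elim_finite_subcover (fun g : G => {u | g * u ∉ A}) hopen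
    (fun u _ => Set.mem_iUnion_of_mem (v * u⁻¹)
      (show v * u⁻¹ * u ∉ A by rwa [inv_mul_cancel_right]))
  refine measure_mono_null (t := ⋃ g ∈ T, {u ∈ A | g * u ∉ A}) (fun u hu => ?_)
    ((measure_biUnion_null_iff T.countable_toSet).mpr fun g _ => hinv g)
  obtain ⟨g, hg, h⟩ := Set.mem_iUnion₂.mp (hT (Set.mem_univ u))
  exact Set.mem_iUnion₂.mpr ⟨g, hg, hu, h⟩

open scoped Matrix.Norms.L2Operator

variable {S : Type*} {n k : ℕ}

/-- Every unitary matrix is the product of two exponentials. -/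
lemma exists_expUnitary_mul_eq (U : Matrix.unitaryGroup (Fin n) ℂ) :
    ∃ H K : selfAdjoint (Matrix (Fin n) (Fin n) ℂ),
      selfAdjoint.expUnitary H * selfAdjoint.expUnitary K = U := by
  -- The spectrum is finite, so a scalar rotation moves it off `-1`; the rotated unitary then has a
  -- self-adjoint argument. The scalar is the other exponential.
  obtain ⟨θ, hθ⟩ : ∃ θ : ℝ, -Complex.exp (θ * Complex.I) ∉
      spectrum ℂ (U : Matrix (Fin n) (Fin n) ℂ) := by
    have hinj : Set.InjOn (fun θ : ℝ => -Complex.exp (θ * Complex.I)) (Set.Icc 0 Real.pi) := by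
      intro a ha b hb hab
      have h := congrArg Complex.re (neg_injective hab)
      rw [Complex.exp_ofReal_mul_I_re, Complex.exp_ofReal_mul_I_re] at h
      exact Real.injOn_cos ha hb h
    obtain ⟨_, ⟨θ, -, rfl⟩, h⟩ := ((Set.Icc_infinite Real.pi_pos).image hinj).exists_notMem_finite
      (Matrix.finite_spectrum (U : Matrix (Fin n) (Fin n) ℂ))
    exact ⟨θ, h⟩
  set H : selfAdjoint (Matrix (Fin n) (Fin n) ℂ) := θ • 1 with hH
  have hcoe : (selfAdjoint.expUnitary H : Matrix (Fin n) (Fin n) ℂ) =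
      algebraMap ℂ _ (Complex.exp (θ * Complex.I)) := by
    rw [selfAdjoint.expUnitary_coe, Complex.exp_eq_exp_ℂ, NormedSpace.algebraMap_exp_comm]
    congr 1
    rw [hH, Algebra.algebraMap_eq_smul_one]
    ext i j
    simp [mul_comm, mul_assoc]
  refine ⟨H, Unitary.argSelfAdjoint ((selfAdjoint.expUnitary H)⁻¹ * U), ?_⟩
  rw [expUnitary_argSelfAdjoint, mul_inv_cancel_left]
  rw [Unitary.norm_sub_one_lt_two_iff (SetLike.coe_mem _), spectrum.notMem_iff]
  rw [spectrum.notMem_iff] at hθ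
  have hunit : IsUnit (((selfAdjoint.expUnitary H)⁻¹ : Matrix.unitaryGroup (Fin n) ℂ) :
      Matrix (Fin n) (Fin n) ℂ) :=
    (Group.isUnit (selfAdjoint.expUnitary H)⁻¹).map (Matrix.unitaryGroup (Fin n) ℂ).subtype
  convert hunit.mul hθ using 1
  rw [map_neg, map_neg, map_one, ← hcoe, mul_sub, mul_neg]
  congr 2
  exact (congrArg Subtype.val (inv_mul_cancel (selfAdjoint.expUnitary H))).symm

/-- The one-parameter group with generators `H`. -/
def expGroup (H : S → selfAdjoint (Matrix (Fin n) (Fin n) ℂ)) (t : ℝ) :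
    S → Matrix.unitaryGroup (Fin n) ℂ :=
  fun s => selfAdjoint.expUnitary (t • H s)

lemma continuous_expGroup (H : S → selfAdjoint (Matrix (Fin n) (Fin n) ℂ)) :
    Continuous (expGroup H) := by
  refine continuous_pi fun s => ?_
  exact selfAdjoint.continuous_expUnitary.comp (continuous_id.smul continuous_const)

lemma expGroup_add (H : S → selfAdjoint (Matrix (Fin n) (Fin n) ℂ)) (a b : ℝ) :
    expGroup H (a + b) = expGroup H a * expGroup H b := by
  ext1 s
  rw [expGroup, add_smul, Commute.expUnitary_add]
  · rfl
  · exact ((Commute.refl (H s : Matrix (Fin n) (Fin n) ℂ)).smul_left a).smul_right b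

lemma analyticOnNhd_expUnitary (H : selfAdjoint (Matrix (Fin n) (Fin n) ℂ)) (i j : Fin n) :
    AnalyticOnNhd ℝ (fun t : ℝ => (selfAdjoint.expUnitary (t • H) : Matrix (Fin n) (Fin n) ℂ) i j)
      Set.univ := by
  intro t _
  have h : ∀ t : ℝ, (selfAdjoint.expUnitary (t • H) : Matrix (Fin n) (Fin n) ℂ) i j =
      Matrix.entryLinearMap ℝ ℂ i j
        (NormedSpace.exp (t • (Complex.I • (H : Matrix (Fin n) (Fin n) ℂ)))) := by
    intro t
    rw [selfAdjoint.expUnitary_coe, smul_comm]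
    rfl
  simp_rw [h]
  have h1 : AnalyticAt ℝ (fun t : ℝ => t • (Complex.I • (H : Matrix (Fin n) (Fin n) ℂ))) t :=
    analyticAt_id.smul analyticAt_const
  exact ((LinearMap.toContinuousLinearMap (Matrix.entryLinearMap ℝ ℂ i j)).analyticAt _).comp
    ((NormedSpace.exp_analytic (𝕂 := ℝ) _).comp h1)

lemma analyticOnNhd_freeRep (H : S → selfAdjoint (Matrix (Fin n) (Fin n) ℂ))
    (u : S → Matrix.unitaryGroup (Fin n) ℂ) (g : FreeGroup S) (i j : Fin n) :
    AnalyticOnNhd ℝ (fun t : ℝ => (freeRep (expGroup H t * u) g : Matrix (Fin n) (Fin n) ℂ) i j)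
      Set.univ := by
  have hof : ∀ (s : S) (i j : Fin n), AnalyticOnNhd ℝ (fun t : ℝ =>
      (freeRep (expGroup H t * u) (FreeGroup.of s) : Matrix (Fin n) (Fin n) ℂ) i j) Set.univ := by
    intro s i j
    have h : ∀ t, (freeRep (expGroup H t * u) (FreeGroup.of s) : Matrix (Fin n) (Fin n) ℂ) i j =
        ∑ l, (selfAdjoint.expUnitary (t • H s) : Matrix (Fin n) (Fin n) ℂ) i l *
          (u s : Matrix (Fin n) (Fin n) ℂ) l j := by
      intro t
      simp only [freeRep, FreeGroup.lift_apply_of]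
      exact Matrix.mul_apply
    simp_rw [h]
    exact Finset.analyticOnNhd_fun_sum _ fun l _ =>
      (analyticOnNhd_expUnitary (H s) i l).mul analyticOnNhd_const
  induction g using FreeGroup.induction_on generalizing i j with
  | C1 => simp only [map_one]; exact analyticOnNhd_const
  | of s => exact hof s i j
  | inv_of s _ =>
    have h : ∀ t, (freeRep (expGroup H t * u) (FreeGroup.of s)⁻¹ : Matrix (Fin n) (Fin n) ℂ) i j =
        Complex.conjCLE
          ((freeRep (expGroup H t * u) (FreeGroup.of s) : Matrix (Fin n) (Fin n) ℂ) j i) := by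
      intro t
      rw [map_inv]
      rfl
    simp_rw [h]
    exact fun t ht => (Complex.conjCLE.toContinuousLinearMap.analyticAt _).comp (hof s j i t ht)
  | mul x y hx hy =>
    have h : ∀ t, (freeRep (expGroup H t * u) (x * y) : Matrix (Fin n) (Fin n) ℂ) i j =
        ∑ l, (freeRep (expGroup H t * u) x : Matrix (Fin n) (Fin n) ℂ) i l *
          (freeRep (expGroup H t * u) y : Matrix (Fin n) (Fin n) ℂ) l j := by
      intro t
      rw [map_mul]
      exact Matrix.mul_apply
    simp_rw [h]
    exact Finset.analyticOnNhd_fun_sum _ fun l _ => (hx i l).mul (hy l j)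

lemma analyticOnNhd_det_gramMatrix [DecidableEq S] (V : Matrix (Fin n) (Fin k) ℂ)
    (F : Finset (FreeGroup S)) (H : S → selfAdjoint (Matrix (Fin n) (Fin n) ℂ))
    (u : S → Matrix.unitaryGroup (Fin n) ℂ) :
    AnalyticOnNhd ℝ (fun t : ℝ => (gramMatrix V F (expGroup H t * u)).det) Set.univ := by
  simp_rw [Matrix.det_apply']
  refine Finset.analyticOnNhd_fun_sum _ fun σ _ => analyticOnNhd_const.mul
    (Finset.analyticOnNhd_fun_prod _ fun p _ => ?_)
  have h : ∀ t, gramMatrix V F (expGroup H t * u) (σ p) p = ∑ b, (∑ a, Vᴴ (σ p).2 a *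
      (freeRep (expGroup H t * u) (((σ p).1 : FreeGroup S)⁻¹ * p.1) :
        Matrix (Fin n) (Fin n) ℂ) a b) * V b p.2 := by
    intro t
    simp only [gramMatrix, compress, Matrix.of_apply, Matrix.mul_apply]
  simp_rw [h]
  exact Finset.analyticOnNhd_fun_sum _ fun b _ => (Finset.analyticOnNhd_fun_sum _ fun a _ =>
    analyticOnNhd_const.mul (analyticOnNhd_freeRep H u _ a b)).mul analyticOnNhd_const

/-- The Gram matrix is almost surely nonsingular if it is nonsingular for some choice of
the generators. -/
lemma ae_det_gramMatrix_ne_zero [Fintype S] [DecidableEq S] (V : Matrix (Fin n) (Fin k) ℂ)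
    (F : Finset (FreeGroup S)) {u₀ : S → Matrix.unitaryGroup (Fin n) ℂ}
    (hu₀ : (gramMatrix V F u₀).det ≠ 0) :
    ∀ᵐ u ∂(generatorLaw S n), (gramMatrix V F u).det ≠ 0 := by
  set A := {u : S → Matrix.unitaryGroup (Fin n) ℂ | (gramMatrix V F u).det = 0} with hAdef
  have hA : IsClosed A := isClosed_eq (continuous_gramMatrix V F).matrix_det continuous_const
  have : (generatorLaw S n).IsMulLeftInvariant :=
    inferInstanceAs (Measure.pi fun _ : S => unitaryHaar n).IsMulLeftInvariant
  have hexp : ∀ (H : S → selfAdjoint (Matrix (Fin n) (Fin n) ℂ)) (t : ℝ),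
      generatorLaw S n {u ∈ A | expGroup H t * u ∉ A} = 0 := fun H t => by
    refine measure_sep_notMem_eq_zero hA (continuous_expGroup H) (expGroup_add H) (fun u => ?_) t
    -- A real analytic function on the line vanishes identically or only on a null set.
    rcases (analyticOnNhd_det_gramMatrix V F H u).eqOn_zero_or_eventually_ne_zero_of_preconnected
      isPreconnected_univ with h | h
    · exact Or.inl fun t => h (Set.mem_univ t)
    · right
      have := ae_restrict_le_codiscreteWithin (μ := (volume : Measure ℝ)) MeasurableSet.univ h
      rwa [Measure.restrict_univ] at this
  have hzero : generatorLaw S n A = 0 := by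
    refine measure_eq_zero_of_ae_invariant hA (fun h => hu₀ (h ▸ Set.mem_univ u₀ : u₀ ∈ A))
      fun g => ?_
    -- Any translation is a composition of two from one-parameter groups. A point of `A` moved out
    -- of `A` leaves it at the first or the second, and each exceptional set is null.
    choose H K hHK using fun s => exists_expUnitary_mul_eq (g s)
    have hg : g = expGroup H 1 * expGroup K 1 := by
      ext1 s
      simp only [Pi.mul_apply, expGroup, one_smul, hHK]
    have h1 := (measure_preimage_mul (generatorLaw S n) (expGroup K 1) _).trans (hexp H 1)
    refine measure_mono_null (fun u hu => ?_) (measure_union_null (hexp K 1) h1)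
    by_cases h : expGroup K 1 * u ∈ A
    · refine Or.inr ⟨h, ?_⟩
      have := hu.2
      rwa [hg, mul_assoc] at this
    · exact Or.inl ⟨hu.1, h⟩
  exact measure_eq_zero_iff_ae_notMem.mp hzero

end ZeroOne

/-! ### From entrywise balls and powers to neighbourhoods and logarithms -/

section Assembly

lemma entryBall_mem_nhds {ι : Type*} [Fintype ι] (q : Matrix ι ι ℂ) {δ : ℝ} (hδ : 0 < δ) :
    {q' : Matrix ι ι ℂ | ∀ i j, ‖q' i j - q i j‖ < δ} ∈ 𝓝 q := by
  refine Filter.eventually_all.mpr fun i => Filter.eventually_all.mpr fun j => ?_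
  have hc : ContinuousAt (fun q' : Matrix ι ι ℂ => ‖q' i j - q i j‖) q :=
    ((continuous_id.matrix_elem i j).sub continuous_const).norm.continuousAt
  refine hc.eventually (gt_mem_nhds ?_)
  change ‖q i j - q i j‖ < δ
  rwa [sub_self, norm_zero]

lemma exists_entryBall_subset {ι : Type*} [Fintype ι] {q : Matrix ι ι ℂ} {u : Set (Matrix ι ι ℂ)}
    (hu : u ∈ 𝓝 q) : ∃ δ > 0, ∀ q' : Matrix ι ι ℂ, (∀ i j, ‖q' i j - q i j‖ < δ) → q' ∈ u := by
  have hu' : (Matrix.of ⁻¹' u : Set (ι → ι → ℂ)) ∈ 𝓝 (fun i j => q i j) := hu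
  obtain ⟨δ, hδ, h⟩ := Metric.mem_nhds_iff.mp hu'
  refine ⟨δ, hδ, fun q' hq' => h (a := fun i j => q' i j) ?_⟩
  refine (dist_pi_lt_iff hδ).mpr fun i => (dist_pi_lt_iff hδ).mpr fun j => ?_
  rw [dist_eq_norm]
  exact hq' i j

lemma log_ofReal_exp_pow (a : ℝ) (n : ℕ) :
    ENNReal.log (ENNReal.ofReal (Real.exp a ^ n)) = ((a * n : ℝ) : EReal) := by
  rw [ENNReal.log_ofReal_of_pos (by positivity), Real.log_pow, Real.log_exp, mul_comm]

variable {S : Type*} [Fintype S] [DecidableEq S] {k : ℕ} {F : Finset (FreeGroup S)}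

lemma one_mem_partialPD {S : Type*} [DecidableEq S] (k : ℕ) (F : Finset (FreeGroup S)) :
    (1 : BlockMatrix F k) ∈ partialPD F k := by
  have h : ∀ (g h : F) (i j : Fin k), block (1 : BlockMatrix F k) g h i j =
      if (g : FreeGroup S)⁻¹ * h = 1 then (1 : Matrix (Fin k) (Fin k) ℂ) i j else 0 := by
    intro g h i j
    simp only [block, Matrix.of_apply, Matrix.one_apply, Prod.mk.injEq, inv_mul_eq_one,
      Subtype.ext_iff]
    split_ifs <;> simp_all
  refine ⟨Matrix.PosSemidef.one, fun g => ?_, fun g₁ h₁ g₂ h₂ e => ?_⟩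
  · ext i j
    rw [h, if_pos (inv_mul_cancel _)]
  · ext i j
    rw [h, h, e]

/-- The lower bound at the identity matrix gives positive probability to Gram matrices near it,
which are nonsingular. All determinants are `1` there, so any rate `y < 1` would do. -/
lemma eventually_exists_det_ne_zero (hF : SuffixClosed F)
    (V : (n : ℕ) → Matrix (Fin n) (Fin k) ℂ) (hV : ∀ n, k ≤ n → (V n)ᴴ * V n = 1) :
    ∀ᶠ n : ℕ in atTop, ∃ u, (gramMatrix (V n) F u).det ≠ 0 := by
  obtain ⟨δ, hδ, h⟩ := exists_det_close (1 : BlockMatrix F k) one_pos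
  have hlow := eventually_le_law hF (one_mem_partialPD k F) (y := 1 / 2) (by simp) (by norm_num)
    (by simp only [Matrix.submatrix_one _ (headIdx_injective _), Matrix.det_one, Complex.one_re,
          Finset.prod_const_one]; norm_num) V hV hδ
  filter_upwards [hlow] with n hn
  have hpos : generatorLaw S n {u | ∀ i j,
      ‖gramMatrix (V n) F u i j - (1 : BlockMatrix F k) i j‖ < δ} ≠ 0 :=
    ((ENNReal.ofReal_pos.mpr (by positivity)).trans_le hn).ne'
  obtain ⟨u, hu⟩ := nonempty_of_measure_ne_zero hpos
  refine ⟨u, fun h0 => ?_⟩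
  have := h (gramMatrix (V n) F u) fun i j => (hu i j).le
  rw [h0, Matrix.det_one] at this
  norm_num at this

/-- Translates `hFun` into the determinant inequalities of the exponential bounds; the slack `b` is
`0` for the upper bound and `-c` for the lower one. -/
lemma exp_hFun (q : BlockMatrix F k) (hq : q.PosDef) (b : ℝ) :
    Real.exp (logDet q - ∑ s : S, logDet (blockSubmatrix
      (Finset.inter_subset_left : F ∩ (FreeGroup.of s • F) ⊆ F) q) + b) *
      ∏ s : S, (q.submatrix (headIdx F k s) (headIdx F k s)).det.re =
      Real.exp b * q.det.re := by
  have h0 : 0 < q.det.re := (Complex.lt_def.mp hq.det_pos).1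
  have hs : ∀ s, 0 < (q.submatrix (headIdx F k s) (headIdx F k s)).det.re := fun s =>
    (Complex.lt_def.mp (hq.submatrix (headIdx_injective s)).det_pos).1
  have h1 : ∏ s : S, (q.submatrix (headIdx F k s) (headIdx F k s)).det.re =
      Real.exp (∑ s : S, logDet (blockSubmatrix
        (Finset.inter_subset_left : F ∩ (FreeGroup.of s • F) ⊆ F) q)) := by
    rw [Real.exp_sum]
    exact Finset.prod_congr rfl fun s _ => (Real.exp_log (hs s)).symm
  have h2 : q.det.re = Real.exp (logDet q) := (Real.exp_log h0).symm
  rw [h1, h2, ← Real.exp_add, ← Real.exp_add]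
  congr 1
  ring

lemma exists_nhds_eventually_law_le (hF : SuffixClosed F) {q : BlockMatrix F k}
    (hq : q ∈ partialPD F k) {a : ℝ} (ha : hFun q < (a : EReal))
    (V : (n : ℕ) → Matrix (Fin n) (Fin k) ℂ) (hV : ∀ n, k ≤ n → (V n)ᴴ * V n = 1) :
    ∃ O ∈ 𝓝 q, ∀ᶠ n : ℕ in atTop, generatorLaw S n {u | gramMatrix (V n) F u ∈ O} ≤
      ENNReal.ofReal (Real.exp a ^ n) := by
  by_cases hdet : q.det = 0
  -- The determinant on `E` vanishes, so every positive `y` is allowed. The Gram matrix over `E` is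
  -- a submatrix, hence closeness over `F` implies closeness over `E`.
  · obtain ⟨E, hE, hEs, hE0, hEd⟩ := exists_minimal_singular hF hq hdet
    have hpos : ∀ s, 0 < ((blockSubmatrix hE q).submatrix (headIdx E k s)
        (headIdx E k s)).det.re := fun s => (Complex.lt_def.mp
      (((blockSubmatrix_mem_partialPD hE hq).1.submatrix
        (headIdx E k s)).posDef_iff_det_ne_zero.mpr (hEd s)).det_pos).1
    obtain ⟨δ, hδ, h⟩ := exists_eventually_law_le hEs (blockSubmatrix_mem_partialPD hE hq) hEd
      (y := Real.exp a) (by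
        rw [hE0, Complex.zero_re]
        exact mul_pos (Real.exp_pos a) (Finset.prod_pos fun s _ => hpos s)) V hV
    refine ⟨_, entryBall_mem_nhds q hδ, h.mono fun n hn => (measure_mono fun u hu => ?_).trans hn⟩
    exact fun i j => hu (⟨i.1.1, hE i.1.2⟩, i.2) (⟨j.1.1, hE j.1.2⟩, j.2)
  · have hpd : q.PosDef := hq.1.posDef_iff_det_ne_zero.mpr hdet
    rw [hFun, if_pos hdet, EReal.coe_lt_coe_iff] at ha
    obtain ⟨δ, hδ, h⟩ := exists_eventually_law_le hF hq
      (fun s => (hpd.submatrix (headIdx_injective s)).det_pos.ne') (y := Real.exp a) (by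
        have h1 := exp_hFun q hpd 0
        rw [add_zero, Real.exp_zero, one_mul] at h1
        rw [← h1]
        have hs : ∀ s, 0 < (q.submatrix (headIdx F k s) (headIdx F k s)).det.re := fun s =>
          (Complex.lt_def.mp (hpd.submatrix (headIdx_injective s)).det_pos).1
        exact mul_lt_mul_of_pos_right (Real.exp_lt_exp.mpr ha)
          (Finset.prod_pos fun s _ => hs s)) V hV
    exact ⟨_, entryBall_mem_nhds q hδ, h⟩

lemma eventually_le_law_of_mem_nhdsWithin (hF : SuffixClosed F) {q : BlockMatrix F k}
    (hq : q ∈ partialPD F k) (hdet : q.det ≠ 0) {c : ℝ} (hc : 0 < c)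
    (V : (n : ℕ) → Matrix (Fin n) (Fin k) ℂ) (hV : ∀ n, k ≤ n → (V n)ᴴ * V n = 1)
    {O : Set (BlockMatrix F k)} (hO : O ∈ 𝓝[partialPD F k] q) :
    ∀ᶠ n : ℕ in atTop, ENNReal.ofReal (Real.exp (logDet q - ∑ s : S, logDet (blockSubmatrix
      (Finset.inter_subset_left : F ∩ (FreeGroup.of s • F) ⊆ F) q) - c) ^ n) ≤
      generatorLaw S n {u | gramMatrix (V n) F u ∈ O} := by
  have hpd : q.PosDef := hq.1.posDef_iff_det_ne_zero.mpr hdet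
  obtain ⟨u, hu, huO⟩ := mem_nhdsWithin_iff_exists_mem_nhds_inter.mp hO
  obtain ⟨δ, hδ, hδu⟩ := exists_entryBall_subset hu
  have h := eventually_le_law hF hq hdet (Real.exp_pos _).le (by
    rw [exp_hFun q hpd (-c)]
    have h0 : 0 < q.det.re := (Complex.lt_def.mp hpd.det_pos).1
    exact mul_lt_of_lt_one_left h0 (by simpa using hc)) V hV hδ
  filter_upwards [h, eventually_ge_atTop k] with n hn hkn
  rw [sub_eq_add_neg _ c]
  exact hn.trans (measure_mono fun w hw =>
    huO ⟨hδu _ hw, gramMatrix_mem_partialPD (hV n hkn) F w⟩)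

/-- A sequence of probabilities that decays at an exponential rate at most `h`. -/
lemma exists_isLittleO_le_log {P : ℕ → ENNReal} (hP : ∀ n, P n ≤ 1) {h : ℝ}
    (hlow : ∀ c > 0, ∀ᶠ n : ℕ in atTop, ENNReal.ofReal (Real.exp (h - c) ^ n) ≤ P n) :
    ∃ ε : ℕ → ℝ, ε =o[atTop] (fun n : ℕ => (n : ℝ)) ∧ ∀ᶠ n : ℕ in atTop,
      (h : EReal) * ((n : ℝ) : EReal) - (ε n : EReal) ≤ ENNReal.log (P n) := by
  have hlog : ∀ c > 0, ∀ᶠ n : ℕ in atTop,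
      (((h - c) * n : ℝ) : EReal) ≤ ENNReal.log (P n) := fun c hc =>
    (hlow c hc).mono fun n hn => by
      rw [← log_ofReal_exp_pow]
      exact ENNReal.log_monotone hn
  have hle : ∀ n, ENNReal.log (P n) ≤ 0 := fun n => by
    rw [← ENNReal.log_one]; exact ENNReal.log_monotone (hP n)
  have hcoe : ∀ {n : ℕ} {x : ℝ}, (x : EReal) ≤ ENNReal.log (P n) →
      ((ENNReal.log (P n)).toReal : EReal) = ENNReal.log (P n) := fun {n x} hx =>
    EReal.coe_toReal (ne_top_of_le_ne_top EReal.zero_ne_top (hle n))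
      (ne_bot_of_le_ne_bot (EReal.coe_ne_bot x) hx)
  -- The actual deficit, truncated at zero so that only upper estimates are needed for it to be
  -- `o(n)`.
  refine ⟨fun n => max 0 (h * n - (ENNReal.log (P n)).toReal), ?_, ?_⟩
  · refine isLittleO_iff.mpr fun c hc => ?_
    filter_upwards [hlog c hc] with n hn
    rw [← hcoe hn, EReal.coe_le_coe_iff] at hn
    rw [Real.norm_of_nonneg (le_max_left _ _), Real.norm_of_nonneg (Nat.cast_nonneg n)]
    exact max_le (by positivity) (by linarith)
  · filter_upwards [hlog 1 one_pos] with n hn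
    conv_rhs => rw [← hcoe hn]
    rw [← EReal.coe_mul, ← EReal.coe_sub, EReal.coe_le_coe_iff]
    have := le_max_right 0 (h * n - (ENNReal.log (P n)).toReal)
    linarith

end Assembly

end

end FreeGram

open FreeGram
theorem theoremB {S : Type*} [Fintype S] [DecidableEq S] (k : ℕ)
    (F : Finset (FreeGroup S)) (hF : IsGrounded F)
    (V : (n : ℕ) → Matrix (Fin n) (Fin k) ℂ) (hV : ∀ n, k ≤ n → (V n)ᴴ * V n = 1)
    (q : BlockMatrix F k) (hq : q ∈ partialPD F k) :
    (∀ᶠ n : ℕ in atTop, ∀ᵐ u ∂(generatorLaw S n), (gramMatrix (V n) F u).det ≠ 0) ∧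
    (∀ O ∈ 𝓝[partialPD F k] q, ∃ ε : ℕ → ℝ, ε =o[atTop] (fun n : ℕ => (n : ℝ)) ∧
      ∀ᶠ n : ℕ in atTop,
        hFun q * ((n : ℝ) : EReal) - (ε n : EReal) ≤
          ENNReal.log (generatorLaw S n {u | gramMatrix (V n) F u ∈ O})) ∧
    (∀ a : ℝ, hFun q < (a : EReal) → ∃ O ∈ 𝓝[partialPD F k] q,
      ∃ ε : ℕ → ℝ, ε =o[atTop] (fun n : ℕ => (n : ℝ)) ∧
        ∀ᶠ n : ℕ in atTop,
          ENNReal.log (generatorLaw S n {u | gramMatrix (V n) F u ∈ O}) ≤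
            ((a * n + ε n : ℝ) : EReal)) := by
  have hS := hF.suffixClosed
  refine ⟨?_, fun O hO => ?_, fun a ha => ?_⟩
  · filter_upwards [eventually_exists_det_ne_zero hS V hV] with n ⟨u, hu⟩
    exact ae_det_gramMatrix_ne_zero (V n) F hu
  · by_cases hdet : q.det = 0
    · refine ⟨fun _ => 0, isLittleO_zero _ _, ?_⟩
      -- Positivity of `n` matters because `⊥ * 0 = 0` in `EReal`.
      filter_upwards [eventually_gt_atTop 0] with n hn
      have hn' : (0 : EReal) < ((n : ℝ) : EReal) := by exact_mod_cast hn
      rw [hFun, if_neg (not_not.mpr hdet), EReal.bot_mul_of_pos hn', EReal.bot_sub]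
      exact bot_le
    · rw [hFun, if_pos hdet]
      exact exists_isLittleO_le_log (fun n => prob_le_one) fun c hc =>
        eventually_le_law_of_mem_nhdsWithin hS hq hdet hc V hV hO
  · obtain ⟨O, hO, h⟩ := exists_nhds_eventually_law_le hS hq ha V hV
    -- The strict inequality `hFun q < a` has already absorbed all subexponential factors, so no
    -- error term remains.
    refine ⟨O, mem_nhdsWithin_of_mem_nhds hO, fun _ => 0, isLittleO_zero _ _, ?_⟩
    filter_upwards [h] with n hn
    rw [add_zero, ← log_ofReal_exp_pow]
    exact ENNReal.log_monotone hn
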